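/- Let $n\ge 3$, let $W=\mathfrak S_n$ with simple reflections $S=\{(i,i+1)\mid 1\le i<n\}$ and length function $l$, let $w_0$ be the longest element of $W$, and let $\sigma$ be the graph automorphism of order $2$ of $W$, that is, conjugation by $w_0$. Let $\tilde W=W\rtimes\langle\sigma\rangle$. Put $\mathbf I=\{w\in W\mid w^2=1\}$ and let $V=\bigoplus_{w\in\mathbf I}\mathbb Q\,a_w$. Let $\tilde\rho$ be the character of the representation $\tilde R$ of $\tilde W$ on $V$ determined, for $s\in S$ and $w\in\mathbf I$, by $$\tilde R(s)a_w=\begin{cases}-a_w&\text{if } sw=ws \text{ and } l(ws)<l(w),\\ a_{sws}&\text{otherwise,}\end{cases}\qquad \tilde R(\sigma)a_w=a_{\sigma(w)} .$$ For a partition $\alpha\vdash n$ let $\varphi_\alpha$ be the irreducible complex character of $\mathfrak S_n$ afforded by the Specht module $\mathbb C[\mathfrak S_n]c_\alpha$, where $c_\alpha$ is the Young symmetrizer (so $\varphi_{(n)}$ is trivial). Let $\mathcal H$ be the Iwahori--Hecke algebra of $W$ over $\mathbb C(v)$ with standard basis $(T_w)_{w\in W}$ and quadratic relations $(T_s-u)(T_s+1)=0$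 for $s\in S$, where $u=v^2$. Let $\chi_\alpha$ be the character of $\mathcal H$ whose values $\chi_\alpha(T_w)$ specialize to $\varphi_\alpha(w)$ at $v=1$ for all $w\in W$, and let $$D_\alpha=\frac{\varphi_\alpha(1)\sum_{w\in W}u^{l(w)}}{\sum_{w\in W}u^{-l(w)}\chi_\alpha(T_w)\chi_\alpha(T_{w^{-1}})}$$ be its generic degree. Let $a_\alpha$ be the exponent of the highest power of $u$ that divides $D_\alpha$ (half of the order of vanishing of $D_\alpha$ at $v=0$); this is a well-defined natural number. Then there is a unique character $\tilde\varphi_\alpha$ of $\tilde W$ that extends $\varphi_\alpha$ and satisfies $\tilde\varphi_\alpha(w_0\sigma)=(-1)^{a_\alpha}\varphi_\alpha(1)$ (Lusztig's preferred extension), and on the coset $W.\sigma$ we have $$\tilde\rho(w\sigma)=\sum_{\alpha\vdash n}\tilde\varphi_\alpha(w\sigma)\qquad\text{for all } w\in W .$$ -/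

import Mathlib

open scoped BigOperators

namespace TwistedInvolution

/-! ### The symmetric group as a Coxeter group -/

/-- The simple reflections of `𝔖ₙ`: the transpositions `(i, i+1)`. -/
def IsSimple {n : ℕ} (s : Equiv.Perm (Fin n)) : Prop :=
  ∃ i j : Fin n, (i : ℕ) + 1 = j ∧ s = Equiv.swap i j

/-- The Coxeter length of `w ∈ 𝔖ₙ`, i.e. its number of inversions. -/
def length {n : ℕ} (w : Equiv.Perm (Fin n)) : ℕ :=
  (Finset.univ.filter fun p : Fin n × Fin n => p.1 < p.2 ∧ w p.2 < w p.1).card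

/-- The longest element `w₀ : i ↦ n + 1 - i`. -/
def w₀ (n : ℕ) : Equiv.Perm (Fin n) := Fin.revPerm

/-- The graph automorphism of `𝔖ₙ`: conjugation by `w₀`. -/
def graphAut (n : ℕ) : MulAut (Equiv.Perm (Fin n)) := MulAut.conj (w₀ n)

/-- The extended group `W̃ = W ⋊ ⟨σ⟩`. -/
abbrev ExtGroup (n : ℕ) : Type :=
  Equiv.Perm (Fin n) ⋊[(Subgroup.zpowers (graphAut n)).subtype] (Subgroup.zpowers (graphAut n))

/-- `w ∈ W` as an element of `W̃`. -/
def ofW {n : ℕ} (w : Equiv.Perm (Fin n)) : ExtGroup n := SemidirectProduct.inl w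

/-- `σ` as an element of `W̃`. -/
def sg (n : ℕ) : ExtGroup n :=
  SemidirectProduct.inr ⟨graphAut n, Subgroup.mem_zpowers (graphAut n)⟩

/-! ### The extended involution module -/

/-- The set `𝐈 = {w ∈ W ∣ w² = 1}`. -/
abbrev Inv (n : ℕ) : Type := {w : Equiv.Perm (Fin n) // w ^ 2 = 1}

/-- Automorphisms of `W` act on `𝐈`. -/
def Inv.map {n : ℕ} (τ : MulAut (Equiv.Perm (Fin n))) (w : Inv n) : Inv n :=
  ⟨τ w.1, by rw [← map_pow, w.2, map_one]⟩

/-- `(-1)^k`, where `k` is the number of two-cycles `{i < w i}` of the involution `w` (these are the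
positive imaginary roots of `w`) whose order is reversed by `g`. -/
def invSign {n : ℕ} (g w : Equiv.Perm (Fin n)) : ℚ :=
  ∏ i ∈ Finset.univ.filter (fun i => i < w i), if g (w i) < g i then -1 else 1

theorem inv_apply_apply {n : ℕ} {w : Equiv.Perm (Fin n)} (hw : w ^ 2 = 1) (i : Fin n) :
    w (w i) = i := by
  rw [← Equiv.Perm.mul_apply, ← pow_two, hw, Equiv.Perm.one_apply]

theorem invSign_one {n : ℕ} (w : Equiv.Perm (Fin n)) : invSign 1 w = 1 := by
  unfold invSign
  refine Finset.prod_eq_one fun i hi => ?_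
  rw [Finset.mem_filter] at hi
  rw [Equiv.Perm.one_apply, Equiv.Perm.one_apply, if_neg hi.2.not_gt]

theorem invSign_prod_conj {n : ℕ} (h w : Equiv.Perm (Fin n)) (hw : w ^ 2 = 1)
    (F : Fin n → Fin n → ℚ) (hF : ∀ i j, F i j = F j i) :
    ∏ i ∈ Finset.univ.filter (fun i => i < w i), F (h i) (h (w i)) =
      ∏ k ∈ Finset.univ.filter (fun k => k < (h * w * h⁻¹) k), F k ((h * w * h⁻¹) k) := by
  have hww := inv_apply_apply hw
  refine Finset.prod_bij (fun i _ => if h i < h (w i) then h i else h (w i)) ?_ ?_ ?_ ?_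
  · intro i hi
    rw [Finset.mem_filter] at hi
    have hne : h i ≠ h (w i) := fun e => hi.2.ne (h.injective e)
    rw [Finset.mem_filter]
    refine ⟨Finset.mem_univ _, ?_⟩
    split_ifs with hlt
    · simpa using hlt
    · simpa [hww] using lt_of_le_of_ne (not_lt.1 hlt) hne.symm
  · intro i hi j hj hij
    rw [Finset.mem_filter] at hi hj
    split_ifs at hij with h1 h2 h2
    · exact h.injective hij
    · have e := h.injective hij
      rw [e, hww] at hi
      exact absurd hi.2 hj.2.not_gt
    · have e := h.injective hij
      rw [← e, hww] at hj
      exact absurd hj.2 hi.2.not_gt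
    · exact w.injective (h.injective hij)
  · intro k hk
    rw [Finset.mem_filter] at hk
    have hk2 : k < h (w (h⁻¹ k)) := hk.2
    have hhk : h (h⁻¹ k) = k := h.apply_symm_apply k
    have hne : h⁻¹ k ≠ w (h⁻¹ k) := fun e => by
      rw [← e, hhk] at hk2
      exact lt_irrefl _ hk2
    rcases lt_or_gt_of_ne hne with hlt | hgt
    · refine ⟨h⁻¹ k, by simpa using hlt, ?_⟩
      simp only [hhk]
      rw [if_pos hk2]
    · refine ⟨w (h⁻¹ k), by simpa [hww] using hgt, ?_⟩
      simp only [hww, hhk]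
      rw [if_neg hk2.not_gt]
  · intro i hi
    split_ifs with hlt
    · simp
    · rw [hF]; simp [hww]

theorem invSign_mul {n : ℕ} (g h w : Equiv.Perm (Fin n)) (hw : w ^ 2 = 1) :
    invSign (g * h) w = invSign g (h * w * h⁻¹) * invSign h w := by
  set F : Fin n → Fin n → ℚ := fun i j =>
    if (i < j ∧ g j < g i) ∨ (j < i ∧ g i < g j) then -1 else 1 with hFdef
  have hF : ∀ i j, F i j = F j i := by
    intro i j
    simp only [hFdef]
    congr 1
    exact propext or_comm
  have e1 : invSign g (h * w * h⁻¹) =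
      ∏ k ∈ Finset.univ.filter (fun k => k < (h * w * h⁻¹) k), F k ((h * w * h⁻¹) k) := by
    unfold invSign
    refine Finset.prod_congr rfl fun k hk => ?_
    rw [Finset.mem_filter] at hk
    simp only [hFdef]
    congr 1
    exact propext ⟨fun h1 => Or.inl ⟨hk.2, h1⟩, fun h1 => h1.elim (fun a => a.2)
      fun a => absurd a.1 hk.2.not_gt⟩
  rw [e1, ← invSign_prod_conj h w hw F hF]
  unfold invSign
  rw [← Finset.prod_mul_distrib]
  refine Finset.prod_congr rfl fun i hi => ?_
  rw [Finset.mem_filter] at hi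
  have hne : h i ≠ h (w i) := fun e => hi.2.ne (h.injective e)
  have hne' : g (h i) ≠ g (h (w i)) := fun e => hne (g.injective e)
  simp only [hFdef, Equiv.Perm.mul_apply]
  rcases lt_or_gt_of_ne hne with h1 | h1 <;> rcases lt_or_gt_of_ne hne' with h2 | h2 <;>
    simp [h1, h2, h1.not_gt, h2.not_gt]

theorem invSign_graphAut {n : ℕ} (g w : Equiv.Perm (Fin n)) (hw : w ^ 2 = 1) :
    invSign (graphAut n g) (graphAut n w) = invSign g w := by
  have hww := inv_apply_apply hw
  have key : ∀ (u : Equiv.Perm (Fin n)) i, graphAut n u i = (u i.rev).rev := fun u i => by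
    simp [graphAut, MulAut.conj_apply, Equiv.Perm.mul_apply, w₀]
  unfold invSign
  refine Finset.prod_bij' (fun i _ => w i.rev) (fun i _ => (w i).rev) ?_ ?_ ?_ ?_ ?_
  · intro i hi
    simp only [Finset.mem_filter, Finset.mem_univ, true_and, key, hww] at hi ⊢
    exact Fin.lt_rev_iff.1 hi
  · intro i hi
    simp only [Finset.mem_filter, Finset.mem_univ, true_and, key, hww, Fin.rev_rev] at hi ⊢
    exact Fin.rev_lt_rev.2 hi
  · intro i _; simp [hww]
  · intro i _; simp [hww]
  · intro i _
    simp [key, hww]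

/-- The involution module `R` of `W = 𝔖ₙ` on `V = ⨁_{w ∈ 𝐈} ℚ a_w`, where `a_w` is
`Finsupp.single w 1`. It is written down for all group elements at once; `involutionRep_simple` is
the defining formula on the simple reflections, which generate `W`. -/
noncomputable def involutionRep (n : ℕ) :
    Representation ℚ (Equiv.Perm (Fin n)) (Inv n →₀ ℚ) where
  toFun g := Finsupp.linearCombination ℚ fun w : Inv n =>
    Finsupp.single (Inv.map (MulAut.conj g) w) (invSign g w.1)
  map_one' := by
    ext w : 2
    simp [invSign_one, Inv.map]
  map_mul' g h := by
    ext w : 2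
    simp [invSign_mul g h w.1 w.2, Inv.map, mul_comm]

/-- The permutation action of the automorphisms of `W` on the basis of `V`. -/
noncomputable def autRep (n : ℕ) :
    Representation ℚ (Subgroup.zpowers (graphAut n)) (Inv n →₀ ℚ) where
  toFun τ := Finsupp.lmapDomain ℚ ℚ (Inv.map τ.1)
  map_one' := by
    ext w : 2
    simp [Inv.map]
  map_mul' g h := by
    ext w : 2
    simp [Inv.map]

theorem autRep_conj {n : ℕ} (τ : Subgroup.zpowers (graphAut n)) (g : Equiv.Perm (Fin n)) :
    autRep n τ * involutionRep n g = involutionRep n (τ.1 g) * autRep n τ := by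
  have hsq : graphAut n ^ 2 = 1 := by
    rw [graphAut, ← map_pow]
    have : w₀ n ^ 2 = 1 := by ext i; simp [w₀, pow_two]
    rw [this, map_one]
  have hτ : ∀ g w : Equiv.Perm (Fin n), w ^ 2 = 1 → invSign (τ.1 g) (τ.1 w) = invSign g w := by
    obtain ⟨k, hk⟩ := Subgroup.mem_zpowers_iff.1 τ.2
    intro g w hw
    rw [← hk]
    rcases Int.even_or_odd' k with ⟨m, rfl | rfl⟩
    · have : graphAut n ^ (2 * m) = 1 := by
        rw [zpow_mul, zpow_ofNat, hsq, one_zpow]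
      rw [this]; rfl
    · have : graphAut n ^ (2 * m + 1) = graphAut n := by
        rw [zpow_add, zpow_mul, zpow_ofNat, hsq, one_zpow, zpow_one, one_mul]
      rw [this]
      exact invSign_graphAut g w hw
  ext w : 2
  simp [autRep, involutionRep, Inv.map, hτ g w.1 w.2]

/-- The extension `R̃` of `R` to `W̃`, for which `σ` acts by `a_w ↦ a_{σ(w)}`. -/
noncomputable def extInvolutionRep (n : ℕ) : Representation ℚ (ExtGroup n) (Inv n →₀ ℚ) where
  toFun x := involutionRep n x.left * autRep n x.right
  map_one' := by simp
  map_mul' x y := by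
    have h := autRep_conj x.right y.left
    simp only [SemidirectProduct.mul_left, SemidirectProduct.mul_right, map_mul]
    rw [mul_assoc, mul_assoc, ← mul_assoc (autRep n x.right), h]
    simp [mul_assoc]

/-- The character `ρ̃` of the extended involution module. -/
noncomputable def extInvolutionChar (n : ℕ) : ExtGroup n → ℚ := (extInvolutionRep n).character

theorem swap_lt_swap_iff {n : ℕ} {i j k l : Fin n} (hij : (i : ℕ) + 1 = j) (hkl : k < l) :
    Equiv.swap i j l < Equiv.swap i j k ↔ k = i ∧ l = j := by
  simp only [Equiv.swap_apply_def]
  grind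

theorem length_lt_length_mul_swap {n : ℕ} {i j : Fin n} (hij : (i : ℕ) + 1 = j)
    (w : Equiv.Perm (Fin n)) (h : w i < w j) : length w < length (w * Equiv.swap i j) := by
  unfold length
  have hlt : i < j := by rw [Fin.lt_def]; omega
  rw [← Finset.card_map (Equiv.prodCongr (Equiv.swap i j) (Equiv.swap i j)).toEmbedding]
  refine Finset.card_lt_card ((Finset.ssubset_iff_of_subset ?_).2 ⟨(i, j), ?_, ?_⟩)
  · intro p hp
    simp only [Finset.mem_map, Finset.mem_filter, Finset.mem_univ, true_and] at hp ⊢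
    obtain ⟨⟨k, l⟩, ⟨hkl, hw⟩, rfl⟩ := hp
    simp only [Equiv.toEmbedding_apply, Equiv.prodCongr_apply, Prod.map_apply,
      Equiv.Perm.mul_apply, Equiv.swap_apply_self]
    refine ⟨lt_of_le_of_ne (not_lt.1 fun hh => ?_) fun e => hkl.ne ((Equiv.swap i j).injective e),
      hw⟩
    obtain ⟨rfl, rfl⟩ := (swap_lt_swap_iff hij hkl).1 hh
    exact absurd h hw.not_gt
  · rw [Finset.mem_filter]
    simp [hlt, h]
  · simp only [Finset.mem_map, Finset.mem_filter, Finset.mem_univ, true_and, not_exists, not_and]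
    rintro ⟨k, l⟩ ⟨hkl, hw⟩ he
    simp only [Equiv.toEmbedding_apply, Equiv.prodCongr_apply, Prod.map_apply,
      Prod.mk.injEq] at he
    have h1 : k = j := by rw [← Equiv.swap_apply_self i j k, he.1, Equiv.swap_apply_left]
    have h2 : l = i := by rw [← Equiv.swap_apply_self i j l, he.2, Equiv.swap_apply_right]
    subst h1 h2
    exact absurd hkl hlt.not_gt

/-- The formula that defines `R`: for `s ∈ S`, one has `R(s) a_w = -a_w` if `sw = ws` and
`l(ws) < l(w)`, and `R(s) a_w = a_{sws}` otherwise. -/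
theorem involutionRep_simple {n : ℕ} (s : Equiv.Perm (Fin n)) (hs : IsSimple s) (w : Inv n) :
    involutionRep n s (Finsupp.single w 1) =
      if s * w.1 = w.1 * s ∧ length (w.1 * s) < length w.1 then -Finsupp.single w 1
      else Finsupp.single (Inv.map (MulAut.conj s) w) 1 := by
  obtain ⟨i, j, hij, rfl⟩ := hs
  have hww := inv_apply_apply w.2
  have hlt : i < j := by rw [Fin.lt_def]; omega
  have hsign : invSign (Equiv.swap i j) w.1 = if w.1 i = j then -1 else 1 := by
    unfold invSign
    have : ∀ k ∈ Finset.univ.filter (fun k => k < w.1 k),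
        (if Equiv.swap i j (w.1 k) < Equiv.swap i j k then (-1 : ℚ) else 1) =
          if k = i then (if w.1 i = j then -1 else 1) else 1 := by
      intro k hk
      rw [Finset.mem_filter] at hk
      simp only [swap_lt_swap_iff hij hk.2]
      by_cases hki : k = i
      · subst hki; simp
      · simp [hki]
    rw [Finset.prod_congr rfl this, Finset.prod_ite_eq']
    by_cases hw : w.1 i = j
    · simp [hw, hlt]
    · simp [hw]
  have hiff : (Equiv.swap i j * w.1 = w.1 * Equiv.swap i j ∧
      length (w.1 * Equiv.swap i j) < length w.1) ↔ w.1 i = j := by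
    constructor
    · rintro ⟨hc, hl⟩
      by_contra hne
      have hi : Equiv.swap i j (w.1 i) = w.1 j := by
        have := Equiv.congr_fun hc i
        simpa using this
      have hwne : w.1 i ≠ w.1 j := fun e => hlt.ne (w.1.injective e)
      have hwi : w.1 i = i := by
        by_contra h2
        rw [Equiv.swap_apply_of_ne_of_ne h2 hne] at hi
        exact hwne hi
      rw [hwi, Equiv.swap_apply_left] at hi
      have := length_lt_length_mul_swap hij w.1 (by rw [hwi, ← hi]; exact hlt)
      omega
    · intro hw
      have hwj : w.1 j = i := by rw [← hw, hww]
      refine ⟨?_, ?_⟩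
      · have := Equiv.mul_swap_eq_swap_mul w.1 i j
        rw [this, hw, hwj, Equiv.swap_comm]
      · have := length_lt_length_mul_swap hij (w.1 * Equiv.swap i j) (by simpa [hw, hwj] using hlt)
        simpa [mul_assoc] using this
  have hact : involutionRep n (Equiv.swap i j) (Finsupp.single w 1) =
      Finsupp.single (Inv.map (MulAut.conj (Equiv.swap i j)) w)
        (invSign (Equiv.swap i j) w.1) := by
    simp [involutionRep]
  rw [hact, hsign]
  by_cases hw : w.1 i = j
  · rw [if_pos hw, if_pos (hiff.2 hw), ← Finsupp.single_neg]
    congr 1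
    refine Subtype.ext ?_
    simp only [Inv.map, MulAut.conj_apply]
    rw [(hiff.2 hw).1, mul_assoc, mul_inv_cancel, mul_one]
  · rw [if_neg hw, if_neg fun h => hw (hiff.1 h)]

theorem extInvolutionRep_ofW {n : ℕ} (g : Equiv.Perm (Fin n)) :
    extInvolutionRep n (ofW g) = involutionRep n g := by
  simp [extInvolutionRep, ofW]

theorem extInvolutionRep_sg {n : ℕ} (w : Inv n) :
    extInvolutionRep n (sg n) (Finsupp.single w 1) =
      Finsupp.single (Inv.map (graphAut n) w) 1 := by
  simp [extInvolutionRep, sg, autRep]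

/-! ### The irreducible characters of `𝔖ₙ` -/

/-- The cell (row, column) of the `k`-th entry when a diagram with row lengths `l` is filled row by
row, starting from `k = 0`. -/
def cellOf : List ℕ → ℕ → ℕ × ℕ
  | [], k => (0, k)
  | a :: l, k => if k < a then (0, k) else ((cellOf l (k - a)).1 + 1, (cellOf l (k - a)).2)

/-- The canonical Young tableau of shape `α ⊢ n`. -/
def tableau {n : ℕ} (α : n.Partition) (k : Fin n) : ℕ × ℕ :=
  cellOf (α.parts.sort (· ≥ ·)) k

open Classical in
/-- The Young symmetrizer `c_α = (∑_{p} p) (∑_{q} sgn(q) q)`, where `p` runs over the row stabilizer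
and `q` over the column stabilizer of the canonical tableau of shape `α`. -/
noncomputable def youngSymmetrizer {n : ℕ} (α : n.Partition) :
    MonoidAlgebra ℂ (Equiv.Perm (Fin n)) :=
  (∑ p ∈ Finset.univ.filter (fun p : Equiv.Perm (Fin n) =>
      ∀ k, (tableau α (p k)).1 = (tableau α k).1), MonoidAlgebra.single p 1) *
  (∑ q ∈ Finset.univ.filter (fun q : Equiv.Perm (Fin n) =>
      ∀ k, (tableau α (q k)).2 = (tableau α k).2),
    MonoidAlgebra.single q ((Equiv.Perm.sign q : ℤ) : ℂ))

/-- The Specht module `ℂ[𝔖ₙ] c_α`, with `𝔖ₙ` acting by left multiplication. -/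
noncomputable def spechtRep {n : ℕ} (α : n.Partition) :
    Representation ℂ (Equiv.Perm (Fin n))
      (LinearMap.range (LinearMap.mulRight ℂ (youngSymmetrizer α))) where
  toFun g := (LinearMap.mulLeft ℂ (MonoidAlgebra.single g (1 : ℂ))).restrict (by
    rintro _ ⟨y, rfl⟩
    exact ⟨MonoidAlgebra.single g 1 * y, by simp [mul_assoc]⟩)
  map_one' := by
    ext x : 2
    simp [← MonoidAlgebra.one_def]
  map_mul' g h := by
    ext x : 2
    simp [← mul_assoc, MonoidAlgebra.single_mul_single]

/-- The irreducible character `φ_α` of `𝔖ₙ` labelled by `α ⊢ n`; `φ_{(n)}` is the trivial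
character. -/
noncomputable def irrChar {n : ℕ} (α : n.Partition) : Equiv.Perm (Fin n) → ℂ :=
  (spechtRep α).character

/-! ### Generic degrees and the invariant `a_φ` -/

/-- A matrix representation over `ℂ(v)` of the Iwahori–Hecke algebra of `𝔖ₙ` with parameter `v²`,
given by the images `T w` of the standard basis elements. -/
structure IsHeckeRep {n d : ℕ}
    (T : Equiv.Perm (Fin n) → Matrix (Fin d) (Fin d) (RatFunc ℂ)) : Prop where
  one : T 1 = 1
  mul_of_lt : ∀ s w, IsSimple s → length w < length (s * w) → T s * T w = T (s * w)
  mul_of_gt : ∀ s w, IsSimple s → length (s * w) < length w →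
    T s * T w = (RatFunc.X : RatFunc ℂ) ^ 2 • T (s * w) + ((RatFunc.X : RatFunc ℂ) ^ 2 - 1) • T w

/-- The character of `T` specializes to `φ` at `v = 1`. -/
def SpecializesTo {n d : ℕ} (T : Equiv.Perm (Fin n) → Matrix (Fin d) (Fin d) (RatFunc ℂ))
    (φ : Equiv.Perm (Fin n) → ℂ) : Prop :=
  ∀ w, (T w).trace.denom.eval 1 ≠ 0 ∧ RatFunc.eval (RingHom.id ℂ) 1 (T w).trace = φ w

/-- The generic degree
`d · (∑_w u^{l(w)}) / ∑_w u^{-l(w)} χ(T_w) χ(T_{w⁻¹})`, with `u = v²`, of a `d`-dimensional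
representation `T` with character `χ`. -/
noncomputable def genericDegree {n d : ℕ}
    (T : Equiv.Perm (Fin n) → Matrix (Fin d) (Fin d) (RatFunc ℂ)) : RatFunc ℂ :=
  (d : RatFunc ℂ) * (∑ w : Equiv.Perm (Fin n), ((RatFunc.X : RatFunc ℂ) ^ 2) ^ length w) /
    ∑ w : Equiv.Perm (Fin n),
      (((RatFunc.X : RatFunc ℂ) ^ 2) ^ length w)⁻¹ * (T w).trace * (T w⁻¹).trace

/-- `a = a_φ`: the generic degree associated with `φ` is divisible by `u^a`, where `u = v²`, and by
no higher power of `u`; i.e. it is `v^{2a}` times a rational function in `v` which is defined and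
non-zero at `v = 0`. -/
def IsAInvariant {n : ℕ} (φ : Equiv.Perm (Fin n) → ℂ) (a : ℕ) : Prop :=
  ∃ (d : ℕ) (T : Equiv.Perm (Fin n) → Matrix (Fin d) (Fin d) (RatFunc ℂ)),
    IsHeckeRep T ∧ SpecializesTo T φ ∧
    ∃ p q : Polynomial ℂ, p.eval 0 ≠ 0 ∧ q.eval 0 ≠ 0 ∧
      genericDegree T =
        RatFunc.X ^ (2 * a) * (algebraMap _ (RatFunc ℂ) p / algebraMap _ (RatFunc ℂ) q)

/-! ### Preferred extensions -/

/-- `ψ` is the character of a finite-dimensional complex representation of `W̃` and restricts to `φ`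
on `W`. -/
def IsExtension {n : ℕ} (φ : Equiv.Perm (Fin n) → ℂ) (ψ : ExtGroup n → ℂ) : Prop :=
  (∃ (d : ℕ) (r : Representation ℂ (ExtGroup n) (Fin d → ℂ)), ψ = r.character) ∧
    ∀ w, ψ (ofW w) = φ w

/-- Lusztig's preferred extension: `ψ(w₀σ) = (-1)^{a_φ} φ(1)`. -/
def IsPreferredExtension {n : ℕ} (φ : Equiv.Perm (Fin n) → ℂ) (ψ : ExtGroup n → ℂ) : Prop :=
  IsExtension φ ψ ∧ ∃ a, IsAInvariant φ a ∧ ψ (ofW (w₀ n) * sg n) = (-1) ^ a * φ 1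

end TwistedInvolution

/-! Both sides are evaluated through `w₀σ`, which has square 1 and commutes with `W`. In a preferred
extension its trace is ±φ_α(1), so it acts by the scalar (-1)^{a_α}, and φ̃_α(wσ) = (-1)^{a_α} φ_α(w
w₀). On `V` it multiplies a_y by (-1)^k, where k is the number of two-cycles of y. Splitting V = V₊
⊕ V₋ by the parity of k gives ρ̃(wσ) = tr(w w₀ | V₊) - tr(w w₀ | V₋). The theorem thus says that
every φ_α occurs exactly once in `V`, in the part whose parity is that of a_α
(`trace_parityRep_sub`).

Multiplicities. Every φ_α has Frobenius–Schur indicator 1, so dim V, the number of involutions,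
equals the sum of the degrees (`card_inv_eq_sum_card`), and it suffices that each φ_α occurs in the
right part at least once. Let n(α) be the sum of the row indices, from 0, of the cells of α. Pairing
rows 2i and 2i+1 inside each column yields an involution y whose number of two-cycles is congruent
to n(α) mod 2. In c_α a_y the coefficient of a_y counts the pairs (p, q) for which pq centralizes y,
because the sign of q cancels the sign of the action (`sign_mul_invSign_domino`). It is positive,
and c_α kills every irreducible representation other than φ_α.

The equality a_α = n(α) (`isAInvariant_iff`). Young's seminormal matrices are built over any field
with quantum integers, so that q = u and q = 1 are treated together. Jucys–Murphy eigenvalues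
separate standard tableaux; this yields Schur's lemma and orthogonality of matrix coefficients.
Together with ∑ f_α² = n! it decomposes every Hecke representation, so a representation which
specializes to φ_α has the seminormal character (`trace_eq_of_specializesTo`). The Schur element is
computed from the coefficients between the row-filled and the column-filled tableau. Their product
is multiplied by q under the row group on the left and by q⁻¹ under the column group on the right.
It is therefore supported on permutations transversal to rows and columns, where it is a monomial
times its value at the column reading `d`. The leading pole u^{-n(α)} has a positive coefficient
(`schurElement_hasValue_zero`).

The same semi-invariance with the constants 1 and -1 gives c_α ℂ[𝔖ₙ] c_α ⊆ ℂ c_α, which identifies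
the Specht characters with the seminormal ones (`irrChar_eq_youngChar`). -/

namespace TwistedInvolution

open Equiv (Perm swap)

/-! ### Inversions, descents and induction on the length -/

section Length

variable {n : ℕ}

theorem lt_of_adj {i j : Fin n} (hij : (i : ℕ) + 1 = j) : i < j := by
  rw [Fin.lt_def]; omega

/-- Applying `swap i j` to both positions carries the inversions of `w` to those of `w * swap i j`;
only the pair `(i, j)` is new, since it is the only ordered pair of positions that an adjacent
transposition reverses. -/
theorem length_mul_swap {i j : Fin n} (hij : (i : ℕ) + 1 = j) (w : Perm (Fin n))
    (h : w i < w j) : length (w * swap i j) = length w + 1 := by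
  have hlt : i < j := lt_of_adj hij
  unfold length
  rw [← Finset.card_map (s := Finset.univ.filter fun p : Fin n × Fin n => p.1 < p.2 ∧ w p.2 < w p.1)
      (Equiv.prodCongr (swap i j) (swap i j)).toEmbedding,
    ← Finset.card_insert_of_notMem (a := (i, j))]
  · congr 1
    ext ⟨k, l⟩
    simp only [Finset.mem_insert, Finset.mem_map, Finset.mem_filter, Finset.mem_univ, true_and,
      Equiv.toEmbedding_apply, Equiv.prodCongr_apply, Prod.exists, Prod.map_apply, Prod.mk.injEq]
    simp only [Equiv.Perm.mul_apply]
    constructor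
    · rintro ⟨hkl, hw⟩
      by_cases he : k = i ∧ l = j
      · exact Or.inl he
      · refine Or.inr ⟨swap i j k, swap i j l, ⟨?_, hw⟩, by simp, by simp⟩
        refine lt_of_le_of_ne (not_lt.1 fun hh => ?_) fun e => hkl.ne ((swap i j).injective e)
        exact he ((swap_lt_swap_iff hij hkl).1 hh)
    · rintro (⟨rfl, rfl⟩ | ⟨a, b, ⟨hab, hw⟩, rfl, rfl⟩)
      · simpa using ⟨hlt, h⟩
      · simp only [Equiv.swap_apply_self]
        refine ⟨?_, hw⟩
        refine lt_of_le_of_ne (not_lt.1 fun hh => ?_) fun e => hab.ne ((swap i j).injective e)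
        obtain ⟨rfl, rfl⟩ := (swap_lt_swap_iff hij hab).1 hh
        exact absurd h hw.not_gt
  · simp only [Finset.mem_map, Finset.mem_filter, Finset.mem_univ, true_and, not_exists, not_and]
    rintro ⟨k, l⟩ ⟨hkl, hw⟩ he
    simp only [Equiv.toEmbedding_apply, Equiv.prodCongr_apply, Prod.map_apply,
      Prod.mk.injEq] at he
    have h1 : k = j := by rw [← Equiv.swap_apply_self i j k, he.1, Equiv.swap_apply_left]
    have h2 : l = i := by rw [← Equiv.swap_apply_self i j l, he.2, Equiv.swap_apply_right]
    subst h1 h2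
    exact absurd hkl hlt.not_gt

theorem length_mul_swap_of_gt {i j : Fin n} (hij : (i : ℕ) + 1 = j) (w : Perm (Fin n))
    (h : w j < w i) : length w = length (w * swap i j) + 1 := by
  have := length_mul_swap hij (w * swap i j) (by simpa using h)
  simpa [mul_assoc] using this

theorem length_inv (w : Perm (Fin n)) : length w⁻¹ = length w := by
  unfold length
  refine Finset.card_bij' (fun p _ => (w⁻¹ p.2, w⁻¹ p.1)) (fun p _ => (w p.2, w p.1)) ?_ ?_ ?_ ?_
  · rintro ⟨a, b⟩; simp; tauto
  · rintro ⟨a, b⟩; simp; tauto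
  · rintro ⟨a, b⟩; simp
  · rintro ⟨a, b⟩; simp

theorem length_one : length (1 : Perm (Fin n)) = 0 := by
  unfold length
  rw [Finset.card_eq_zero, Finset.filter_eq_empty_iff]
  rintro ⟨a, b⟩ - ⟨h1, h2⟩
  exact absurd h1 (not_lt.2 h2.le)

theorem length_swap_mul {i j : Fin n} (hij : (i : ℕ) + 1 = j) (w : Perm (Fin n))
    (h : w⁻¹ i < w⁻¹ j) : length (swap i j * w) = length w + 1 := by
  rw [← length_inv, mul_inv_rev, Equiv.swap_inv, length_mul_swap hij _ h, length_inv]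

theorem length_swap_mul_of_gt {i j : Fin n} (hij : (i : ℕ) + 1 = j) (w : Perm (Fin n))
    (h : w⁻¹ j < w⁻¹ i) : length w = length (swap i j * w) + 1 := by
  rw [← length_inv w, length_mul_swap_of_gt hij _ h, ← length_inv (swap i j * w), mul_inv_rev,
    Equiv.swap_inv]

theorem lt_or_gt_of_adj {i j : Fin n} (hij : (i : ℕ) + 1 = j) (w : Perm (Fin n)) :
    w i < w j ∨ w j < w i :=
  lt_or_gt_of_ne fun e => (lt_of_adj hij).ne (w.injective e)

theorem eq_one_of_forall_adj_lt (w : Perm (Fin n))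
    (h : ∀ i j : Fin n, (i : ℕ) + 1 = j → w i < w j) : w = 1 := by
  have hm : Monotone w := by
    cases n with
    | zero => intro a; exact a.elim0
    | succ m => exact Fin.monotone_iff_le_succ.2 fun i => (h _ _ (by simp)).le
  have := (Equiv.Perm.monotone_iff w).1 hm
  exact this

theorem exists_right_descent {w : Perm (Fin n)} (hw : w ≠ 1) :
    ∃ i j : Fin n, (i : ℕ) + 1 = j ∧ w j < w i := by
  by_contra! hc
  exact hw (eq_one_of_forall_adj_lt w fun i j hij =>
    lt_of_le_of_ne (hc i j hij) fun e => (lt_of_adj hij).ne (w.injective e))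

theorem exists_left_descent {w : Perm (Fin n)} (hw : w ≠ 1) :
    ∃ i j : Fin n, (i : ℕ) + 1 = j ∧ w⁻¹ j < w⁻¹ i :=
  exists_right_descent (inv_ne_one.2 hw)

/-- Induction on the length, removing a simple reflection on the left. -/
theorem left_induction {P : Perm (Fin n) → Prop} (one : P 1)
    (mul : ∀ (i j : Fin n) (w : Perm (Fin n)), (i : ℕ) + 1 = j → w⁻¹ i < w⁻¹ j → P w →
      P (swap i j * w)) (w : Perm (Fin n)) : P w := by
  induction hk : length w using Nat.strong_induction_on generalizing w with
  | _ k ih =>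
    by_cases hw : w = 1
    · rw [hw]; exact one
    · obtain ⟨i, j, hij, hd⟩ := exists_left_descent hw
      have hl := length_swap_mul_of_gt hij w hd
      have := mul i j (swap i j * w) hij (by simpa using hd)
        (ih _ (by omega) _ rfl)
      simpa using this

/-- Induction on the length, removing a simple reflection on the right. -/
theorem right_induction {P : Perm (Fin n) → Prop} (one : P 1)
    (mul : ∀ (i j : Fin n) (w : Perm (Fin n)), (i : ℕ) + 1 = j → w i < w j → P w →
      P (w * swap i j)) (w : Perm (Fin n)) : P w := by
  have := left_induction (P := fun w => P w⁻¹) (by simpa using one)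
    (fun i j w hij h hw => by simpa using mul i j w⁻¹ hij h hw) w⁻¹
  simpa using this

end Length

/-! ### Matsumoto's theorem -/

section Matsumoto

variable {n : ℕ} {A : Type*} [Monoid A]

/-- `IsReducedProd S w a`: the element `a` is the product of the `S i j` along a reduced word
of `w`. -/
inductive IsReducedProd (S : Fin n → Fin n → A) : Perm (Fin n) → A → Prop
  | one : IsReducedProd S 1 1
  | mul (i j : Fin n) (w : Perm (Fin n)) (a : A) : (i : ℕ) + 1 = j → w⁻¹ i < w⁻¹ j →
      IsReducedProd S w a → IsReducedProd S (swap i j * w) (S i j * a)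

theorem exists_isReducedProd (S : Fin n → Fin n → A) (w : Perm (Fin n)) :
    ∃ a, IsReducedProd S w a :=
  left_induction (P := fun w => ∃ a, IsReducedProd S w a) ⟨1, .one⟩
    (fun i j w hij h ⟨a, ha⟩ => ⟨_, .mul i j w a hij h ha⟩) w

theorem IsReducedProd.mul' {S : Fin n → Fin n → A} {i j : Fin n} {w : Perm (Fin n)} {a : A}
    (hij : (i : ℕ) + 1 = j) (h : w⁻¹ j < w⁻¹ i) (ha : IsReducedProd S (swap i j * w) a) :
    IsReducedProd S w (S i j * a) := by
  have := IsReducedProd.mul i j _ a hij (by simpa using h) ha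
  simpa using this

/-- Induction on the length. Two reduced words with different first letters are both compared with a
reduced word that begins with the longest element of the rank two parabolic subgroup generated by
these letters; the braid or commutation relation exchanges its two beginnings. -/
theorem IsReducedProd.unique {S : Fin n → Fin n → A}
    (hbraid : ∀ i j k : Fin n, (i : ℕ) + 1 = j → (j : ℕ) + 1 = k →
      S i j * S j k * S i j = S j k * S i j * S j k)
    (hcomm : ∀ i j k l : Fin n, (i : ℕ) + 1 = j → (k : ℕ) + 1 = l → j < k →
      S i j * S k l = S k l * S i j) (w : Perm (Fin n)) :
    ∀ a b, IsReducedProd S w a → IsReducedProd S w b → a = b := by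
  induction hk : length w using Nat.strong_induction_on generalizing w with
  | _ N ih =>
  have far : ∀ (i j k l : Fin n) (a b : A), (i : ℕ) + 1 = j → (k : ℕ) + 1 = l → j < k →
      w⁻¹ j < w⁻¹ i → w⁻¹ l < w⁻¹ k → IsReducedProd S (swap i j * w) a →
      IsReducedProd S (swap k l * w) b → S i j * a = S k l * b := by
    intro i j k l a b hij hkl hjk h1 h2 ha hb
    have e : swap i j * (swap k l * w) = swap k l * (swap i j * w) := by
      rw [← mul_assoc, ← mul_assoc]
      congr 1
      exact ((Equiv.Perm.disjoint_swap_swap (by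
        simp [List.nodup_cons]; grind))).commute
    have n1 : swap i j k = k := Equiv.swap_apply_of_ne_of_ne (by grind) (by grind)
    have n2 : swap i j l = l := Equiv.swap_apply_of_ne_of_ne (by grind) (by grind)
    have n3 : swap k l i = i := Equiv.swap_apply_of_ne_of_ne (by grind) (by grind)
    have n4 : swap k l j = j := Equiv.swap_apply_of_ne_of_ne (by grind) (by grind)
    -- Both letters are descents of `w`, so a reduced word of `w` may begin with the two commuting
    -- letters; `c` is the product of the rest.
    obtain ⟨c, hc⟩ := exists_isReducedProd S (swap i j * (swap k l * w))
    have l1 := length_swap_mul_of_gt hij w h1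
    have l2 := length_swap_mul_of_gt hkl w h2
    have ea : a = S k l * c := ih _ (by omega) _ rfl _ _ ha
      (IsReducedProd.mul' hkl (by simpa [n1, n2] using h2) (e ▸ hc))
    have eb : b = S i j * c := ih _ (by omega) _ rfl _ _ hb
      (IsReducedProd.mul' hij (by simpa [n3, n4] using h1) hc)
    rw [ea, eb, ← mul_assoc, ← mul_assoc, hcomm i j k l hij hkl hjk]
  have adj : ∀ (i j k : Fin n) (a b : A), (i : ℕ) + 1 = j → (j : ℕ) + 1 = k →
      w⁻¹ j < w⁻¹ i → w⁻¹ k < w⁻¹ j → IsReducedProd S (swap i j * w) a →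
      IsReducedProd S (swap j k * w) b → S i j * a = S j k * b := by
    intro i j k a b hij hjk h1 h2 ha hb
    have e : swap i j * (swap j k * (swap i j * w)) = swap j k * (swap i j * (swap j k * w)) := by
      simp only [← mul_assoc]
      congr 1
      ext x
      simp only [Equiv.Perm.mul_apply, Equiv.swap_apply_def]
      grind
    have n1 : swap i j k = k := Equiv.swap_apply_of_ne_of_ne (by grind) (by grind)
    have n3 : swap j k i = i := Equiv.swap_apply_of_ne_of_ne (by grind) (by grind)
    -- Two adjacent descents allow the whole braid word to be split off from `w`; `c` is the product
    -- of the rest.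
    obtain ⟨c, hc⟩ := exists_isReducedProd S (swap i j * (swap j k * (swap i j * w)))
    have l1 := length_swap_mul_of_gt hij w h1
    have l2 := length_swap_mul_of_gt hjk w h2
    have ea : a = S j k * (S i j * c) := ih _ (by omega) _ rfl _ _ ha
      (.mul' hjk (by simpa [n1, n3] using h2.trans h1)
        (.mul' hij (by simpa [n1, n3] using h2) hc))
    have eb : b = S i j * (S j k * c) := ih _ (by omega) _ rfl _ _ hb
      (.mul' hij (by simpa [n1, n3] using h2.trans h1)
        (.mul' hjk (by simpa [n1, n3] using h1) (e ▸ hc)))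
    rw [ea, eb]
    simpa only [← mul_assoc] using congrArg (· * c) (hbraid i j k hij hjk)
  have split : ∀ a, IsReducedProd S w a → (w = 1 ∧ a = 1) ∨ ∃ (i j : Fin n) (a' : A),
      (i : ℕ) + 1 = j ∧ w⁻¹ j < w⁻¹ i ∧ IsReducedProd S (swap i j * w) a' ∧ a = S i j * a' := by
    intro a ha
    cases ha with
    | one => exact Or.inl ⟨rfl, rfl⟩
    | mul i j w' a' hij h ha' =>
      exact Or.inr ⟨i, j, a', hij, by simpa using h, by simpa using ha', rfl⟩
  intro a b ha hb
  rcases split a ha with ⟨h1, rfl⟩ | ⟨i, j, a', hij, hd, ha', rfl⟩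
  · rcases split b hb with ⟨-, rfl⟩ | ⟨k, l, b', hkl, hd', -, -⟩
    · rfl
    · rw [h1] at hd'
      simp only [inv_one, Equiv.Perm.one_apply] at hd'
      exact absurd (lt_of_adj hkl) hd'.not_gt
  · rcases split b hb with ⟨h1, rfl⟩ | ⟨k, l, b', hkl, hd', hb', rfl⟩
    · rw [h1] at hd
      simp only [inv_one, Equiv.Perm.one_apply] at hd
      exact absurd (lt_of_adj hij) hd.not_gt
    · have l1 := length_swap_mul_of_gt hij w hd
      have cases5 : (i = k ∧ j = l) ∨ j < k ∨ l < i ∨ j = k ∨ l = i := by grind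
      rcases cases5 with ⟨rfl, rfl⟩ | h | h | rfl | rfl
      · rw [ih _ (by omega) _ rfl _ _ ha' hb']
      · exact far _ _ _ _ _ _ hij hkl h hd hd' ha' hb'
      · exact (far _ _ _ _ _ _ hkl hij h hd' hd hb' ha').symm
      · exact adj _ _ _ _ _ hij hkl hd hd' ha' hb'
      · exact (adj _ _ _ _ _ hkl hij hd' hd hb' ha').symm

/-- Matsumoto's theorem for the symmetric group. -/
theorem exists_braid_lift (S : Fin n → Fin n → A)
    (hbraid : ∀ i j k : Fin n, (i : ℕ) + 1 = j → (j : ℕ) + 1 = k →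
      S i j * S j k * S i j = S j k * S i j * S j k)
    (hcomm : ∀ i j k l : Fin n, (i : ℕ) + 1 = j → (k : ℕ) + 1 = l → j < k →
      S i j * S k l = S k l * S i j) :
    ∃ T : Perm (Fin n) → A, T 1 = 1 ∧ ∀ (i j : Fin n) (w : Perm (Fin n)), (i : ℕ) + 1 = j →
      w⁻¹ i < w⁻¹ j → T (swap i j * w) = S i j * T w := by
  choose T hT using exists_isReducedProd S
  exact ⟨T, IsReducedProd.unique hbraid hcomm _ _ _ (hT 1) .one, fun i j w hij h =>
    IsReducedProd.unique hbraid hcomm _ _ _ (hT _) (.mul i j w _ hij h (hT w))⟩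

end Matsumoto

/-! ### Representations of the Hecke algebra and averaging -/

section Hecke

variable {n : ℕ} {K ι : Type*} [Field K] [Fintype ι]

/-- A (not necessarily unital) matrix representation of the Iwahori–Hecke algebra of `𝔖ₙ` with
parameter `q`. -/
structure IsHecke (q : K) (T : Perm (Fin n) → Matrix ι ι K) : Prop where
  one_mul : ∀ w, T 1 * T w = T w
  mul_of_lt : ∀ (i j : Fin n) (w : Perm (Fin n)), (i : ℕ) + 1 = j → w⁻¹ i < w⁻¹ j →
    T (swap i j) * T w = T (swap i j * w)
  mul_of_gt : ∀ (i j : Fin n) (w : Perm (Fin n)), (i : ℕ) + 1 = j → w⁻¹ j < w⁻¹ i →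
    T (swap i j) * T w = q • T (swap i j * w) + (q - 1) • T w

namespace IsHecke

variable {q : K} {T : Perm (Fin n) → Matrix ι ι K}

theorem mul_one (hT : IsHecke q T) (w : Perm (Fin n)) : T w * T 1 = T w := by
  induction w using left_induction with
  | one => exact hT.one_mul 1
  | mul i j w hij h ih => rw [← hT.mul_of_lt i j w hij h, Matrix.mul_assoc, ih]

/-- The right-hand rule follows from the left-hand one by peeling simple reflections off the left.
Length counts exclude the wrong orders, because a one-sided multiplication changes the length by
exactly one. -/
theorem mul_swap_of_lt (hT : IsHecke q T) {i j : Fin n} (hij : (i : ℕ) + 1 = j)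
    (w : Perm (Fin n)) (h : w i < w j) : T w * T (swap i j) = T (w * swap i j) := by
  induction w using left_induction with
  | one => rw [hT.one_mul, _root_.one_mul]
  | mul k l w hkl hw ih =>
    have hw' : w i < w j := by
      rcases lt_or_gt_of_adj hij w with h1 | h1
      · exact h1
      · exfalso
        have l1 := length_swap_mul hkl w hw
        have l2 := length_mul_swap_of_gt hij w h1
        have l3 := length_mul_swap hij _ h
        rw [mul_assoc] at l3
        rcases lt_or_gt_of_adj hkl (w * swap i j)⁻¹ with h2 | h2
        · have := length_swap_mul hkl _ h2; omega
        · have := length_swap_mul_of_gt hkl _ h2; omega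
    rw [← hT.mul_of_lt k l w hkl hw, Matrix.mul_assoc, ih hw', mul_assoc]
    refine hT.mul_of_lt k l _ hkl ?_
    rcases lt_or_gt_of_adj hkl (w * swap i j)⁻¹ with h2 | h2
    · exact h2
    · exfalso
      have l1 := length_swap_mul hkl w hw
      have l2 := length_mul_swap hij w hw'
      have l3 := length_mul_swap hij _ h
      have := length_swap_mul_of_gt hkl _ h2
      rw [mul_assoc] at l3
      omega

theorem mul_swap_of_gt (hT : IsHecke q T) {i j : Fin n} (hij : (i : ℕ) + 1 = j)
    (w : Perm (Fin n)) (h : w j < w i) :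
    T w * T (swap i j) = q • T (w * swap i j) + (q - 1) • T w := by
  have e : T w = T (w * swap i j) * T (swap i j) := by
    rw [hT.mul_swap_of_lt hij _ (by simpa using h)]
    simp [mul_assoc]
  have e2 := hT.mul_of_gt i j (swap i j) hij (by simpa using lt_of_adj hij)
  rw [Equiv.swap_mul_self] at e2
  conv_lhs => rw [e]
  rw [Matrix.mul_assoc, e2, Matrix.mul_add, Matrix.mul_smul, Matrix.mul_smul, ← e, hT.mul_one]

end IsHecke

/-- Averaging over the Hecke algebra with respect to the dual bases `T_w`, `q^{-l(w)} T_{w⁻¹}`. -/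
theorem sum_hecke_average {q : K} (hq : q ≠ 0) {ι' : Type*} [Fintype ι']
    {T : Perm (Fin n) → Matrix ι ι K} {T' : Perm (Fin n) → Matrix ι' ι' K}
    (hT : IsHecke q T) (hT' : IsHecke q T') {i j : Fin n} (hij : (i : ℕ) + 1 = j)
    (a b : ι) (c d : ι') :
    ∑ w, (q ^ length w)⁻¹ * (T (swap i j) * T w) a b * T' w⁻¹ c d =
      ∑ w, (q ^ length w)⁻¹ * T w a b * (T' w⁻¹ * T' (swap i j)) c d := by
  rw [← sub_eq_zero, ← Finset.sum_sub_distrib]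
  -- The difference of the two sums cancels over each pair `w`, `s w`: the quadratic relation enters
  -- on the left for one element and on the right for the other.
  have key : ∀ w : Perm (Fin n), w⁻¹ i < w⁻¹ j →
      ((q ^ length w)⁻¹ * (T (swap i j) * T w) a b * T' w⁻¹ c d -
        (q ^ length w)⁻¹ * T w a b * (T' w⁻¹ * T' (swap i j)) c d) +
      ((q ^ length (swap i j * w))⁻¹ * (T (swap i j) * T (swap i j * w)) a b *
          T' (swap i j * w)⁻¹ c d -
        (q ^ length (swap i j * w))⁻¹ * T (swap i j * w) a b *
          (T' (swap i j * w)⁻¹ * T' (swap i j)) c d) = 0 := by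
    intro w h
    have h2 : (swap i j * w)⁻¹ j < (swap i j * w)⁻¹ i := by simpa using h
    rw [length_swap_mul hij w h, hT.mul_of_lt i j w hij h, hT.mul_of_gt i j _ hij h2,
      hT'.mul_swap_of_lt hij _ h, hT'.mul_swap_of_gt hij _ h2, mul_inv_rev, Equiv.swap_inv,
      ← mul_assoc (swap i j), Equiv.swap_mul_self, one_mul, mul_assoc w⁻¹,
      Equiv.swap_mul_self, mul_one]
    simp only [Matrix.add_apply, Matrix.smul_apply, smul_eq_mul]
    field_simp
    ring
  refine Finset.sum_involution (fun w _ => swap i j * w) ?_ ?_ ?_ ?_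
  · intro w _
    rcases lt_or_gt_of_adj hij w⁻¹ with h | h
    · exact key w h
    · have := key (swap i j * w) (by simpa using h)
      rw [← mul_assoc, Equiv.swap_mul_self, one_mul] at this
      rw [add_comm]
      exact this
  · intro w _ _ e
    have : swap i j = 1 := mul_eq_right.1 e
    exact (lt_of_adj hij).ne (Equiv.swap_eq_one_iff.1 this)
  · intro w _; exact Finset.mem_univ _
  · intro w _; simp

end Hecke

/-! ### Standard tableaux and contents -/

section Shape

variable {n : ℕ}

/-- `t` lists the cells (row, column) of a Young diagram row by row. -/
structure IsShape (t : Fin n → ℕ × ℕ) : Prop where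
  inj : Function.Injective t
  lower : ∀ k x, x ≤ t k → ∃ j, t j = x
  lex : ∀ j k, j < k → (t j).1 < (t k).1 ∨ ((t j).1 = (t k).1 ∧ (t j).2 < (t k).2)

/-- The filling `k ↦ t (w k)` is a standard Young tableau. -/
def Std (t : Fin n → ℕ × ℕ) (w : Perm (Fin n)) : Prop :=
  ∀ j k, t (w j) ≤ t (w k) → j ≤ k

/-- The content of a cell. -/
def content (x : ℕ × ℕ) : ℤ := (x.2 : ℤ) - x.1

/-- The difference of the contents of the cells which contain `j` and `i`. -/
def contentDiff (t : Fin n → ℕ × ℕ) (w : Perm (Fin n)) (i j : Fin n) : ℤ :=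
  content (t (w j)) - content (t (w i))

variable {t : Fin n → ℕ × ℕ} {w : Perm (Fin n)} {i j k l : Fin n}

theorem IsShape.std_one (ht : IsShape t) : Std t 1 := by
  intro j k h
  by_contra hc
  have := ht.lex k j (not_le.1 hc)
  have h2 := Prod.le_def.1 h
  simp only [Equiv.Perm.one_apply] at h2
  omega

/-- Exchanging two consecutive entries alters no order relation except the one between these
entries, so it can only fail if their cells are comparable. -/
theorem le_of_not_std_mul_swap (hw : Std t w) (hij : (i : ℕ) + 1 = j)
    (h : ¬ Std t (w * swap i j)) : t (w i) ≤ t (w j) := by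
  unfold Std at h
  push Not at h
  obtain ⟨a, b, hab, hlt⟩ := h
  simp only [Equiv.Perm.mul_apply] at hab
  have h1 := hw _ _ hab
  have h2 : swap i j a < swap i j b :=
    lt_of_le_of_ne h1 fun e => hlt.ne' ((swap i j).injective e)
  have h3 := (swap_lt_swap_iff hij h2).1 (by simpa using hlt)
  rwa [h3.1, h3.2] at hab

theorem Std.not_le_of_mul_swap (h : Std t (w * swap i j)) (hij : (i : ℕ) + 1 = j) :
    ¬ t (w i) ≤ t (w j) := by
  intro hle
  have := h j i (by simpa using hle)
  exact absurd (lt_of_adj hij) this.not_gt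

theorem Std.not_le (h : Std t w) (hij : i < j) : ¬ t (w j) ≤ t (w i) :=
  fun hle => absurd hij (h _ _ hle).not_gt

/-- The two cells are incomparable, hence one lies strictly above and strictly to the right of the
other. -/
theorem Std.two_le_contentDiff (hw : Std t w) (h : Std t (w * swap i j)) (hij : (i : ℕ) + 1 = j) :
    contentDiff t w i j ≤ -2 ∨ 2 ≤ contentDiff t w i j := by
  have h1 := h.not_le_of_mul_swap hij
  have h2 := hw.not_le (lt_of_adj hij)
  rw [Prod.le_def] at h1 h2
  unfold contentDiff content
  omega

/-- The cells are comparable, and a cell between them would carry an entry strictly between two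
consecutive numbers. So they are neighbours in a row or in a column. -/
theorem contentDiff_of_not_std (ht : IsShape t) (hw : Std t w) (h : ¬ Std t (w * swap i j))
    (hij : (i : ℕ) + 1 = j) :
    ((t (w j)).1 = (t (w i)).1 ∧ contentDiff t w i j = 1) ∨
      ((t (w j)).2 = (t (w i)).2 ∧ contentDiff t w i j = -1) := by
  have hle := le_of_not_std_mul_swap hw hij h
  have hlt := lt_of_adj hij
  have hne : t (w i) ≠ t (w j) := fun e => hlt.ne (w.injective (ht.inj e))
  have key : ∀ x, t (w i) ≤ x → x ≤ t (w j) → t (w i) ≠ x → x = t (w j) := by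
    intro x h1 h2 h3
    obtain ⟨m, rfl⟩ := ht.lower _ _ h2
    obtain ⟨m, rfl⟩ := w.surjective m
    have a1 := hw _ _ h1
    have a2 := hw _ _ h2
    have a3 : m ≠ i := by rintro rfl; exact h3 rfl
    have : m = j := by
      rw [Fin.le_def] at a1 a2
      have : (m : ℕ) ≠ i := fun e => a3 (Fin.ext e)
      exact Fin.ext (by omega)
    rw [this]
  have hle' := Prod.le_def.1 hle
  by_cases hr : (t (w i)).1 < (t (w j)).1
  · right
    have := key ((t (w i)).1 + 1, (t (w i)).2) ⟨by simp, by simp⟩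
      (Prod.le_def.2 ⟨by simpa using hr, hle'.2⟩)
      (fun e => by have := congrArg Prod.fst e; simp at this)
    unfold contentDiff content
    rw [← this]
    simp
  · left
    have hr' : (t (w i)).1 = (t (w j)).1 := by omega
    have hc : (t (w i)).2 ≠ (t (w j)).2 := fun e => hne (Prod.ext hr' e)
    have := key ((t (w i)).1, (t (w i)).2 + 1) ⟨by simp, by simp⟩
      (Prod.le_def.2 ⟨hle'.1, by show (t (w i)).2 + 1 ≤ _; omega⟩)
      (fun e => by have := congrArg Prod.snd e; simp at this)
    unfold contentDiff content
    rw [← this]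
    simp

theorem contentDiff_ne_zero (ht : IsShape t) (hw : Std t w) (hij : (i : ℕ) + 1 = j) :
    contentDiff t w i j ≠ 0 := by
  by_cases h : Std t (w * swap i j)
  · have := hw.two_le_contentDiff h hij; omega
  · have := contentDiff_of_not_std ht hw h hij; omega

/-- Otherwise the second cell lies strictly below and to the right of the first, and the neighbours
of the first cell below it and to its right would both have to contain the single intermediate entry
`j`. -/
theorem contentDiff_two_ne_zero (ht : IsShape t) (hw : Std t w) (hij : (i : ℕ) + 1 = j)
    (hjk : (j : ℕ) + 1 = k) : contentDiff t w i k ≠ 0 := by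
  intro h
  have hik : i < k := (lt_of_adj hij).trans (lt_of_adj hjk)
  have h1 := hw.not_le hik
  have hne : t (w i) ≠ t (w k) := fun e => hik.ne (w.injective (ht.inj e))
  rw [Prod.le_def] at h1
  unfold contentDiff content at h
  have hlt : (t (w i)).1 < (t (w k)).1 ∧ (t (w i)).2 < (t (w k)).2 := by
    have : ¬ ((t (w i)).1 = (t (w k)).1 ∧ (t (w i)).2 = (t (w k)).2) :=
      fun e => hne (Prod.ext e.1 e.2)
    omega
  have key : ∀ x, t (w i) ≤ x → x ≤ t (w k) → t (w i) ≠ x → x ≠ t (w k) → x = t (w j) := by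
    intro x h1 h2 h3 h4
    obtain ⟨m, rfl⟩ := ht.lower _ _ h2
    obtain ⟨m, rfl⟩ := w.surjective m
    have a1 := hw _ _ h1
    have a2 := hw _ _ h2
    have a3 : (m : ℕ) ≠ i := fun e => h3 (by rw [Fin.ext e])
    have a4 : (m : ℕ) ≠ k := fun e => h4 (by rw [Fin.ext e])
    rw [Fin.le_def] at a1 a2
    rw [Fin.ext (show (m : ℕ) = j by omega)]
  have e1 := key ((t (w i)).1 + 1, (t (w i)).2) ⟨by simp, by simp⟩
      (Prod.le_def.2 ⟨by simpa using hlt.1, hlt.2.le⟩)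
      (fun e => by have := congrArg Prod.fst e; simp at this)
      (fun e => by have := congrArg Prod.snd e; simp at this; omega)
  have e2 := key ((t (w i)).1, (t (w i)).2 + 1) ⟨by simp, by simp⟩
      (Prod.le_def.2 ⟨hlt.1.le, by simpa using hlt.2⟩)
      (fun e => by have := congrArg Prod.snd e; simp at this)
      (fun e => by have := congrArg Prod.fst e; simp at this; omega)
  have := congrArg Prod.fst (e1.trans e2.symm)
  simp at this

/-- The index set of standard tableaux of shape `t`. -/
abbrev SYT (t : Fin n → ℕ × ℕ) : Type := {w : Perm (Fin n) // Std t w}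

noncomputable instance (t : Fin n → ℕ × ℕ) : Fintype (SYT t) :=
  Fintype.ofFinite _

end Shape

/-! ### Quantum integers -/

section Bracket

/-- `br` is the function of quantum integers with parameter `q`, and `q` is not a root of unity
other than `1`. -/
structure IsBracket {K : Type*} [Field K] (q : K) (br : ℤ → K) : Prop where
  q_ne : q ≠ 0
  one : br 1 = 1
  add : ∀ d e, br (d + e) = br d + q ^ d * br e
  ne_zero : ∀ d, d ≠ 0 → br d ≠ 0

namespace IsBracket

variable {K : Type*} [Field K] {q : K} {br : ℤ → K}

theorem zero (hb : IsBracket q br) : br 0 = 0 := by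
  have := hb.add 0 0
  simpa using this

theorem zpow (hb : IsBracket q br) (d : ℤ) : q ^ d = 1 + (q - 1) * br d := by
  have h1 := hb.add d 1
  have h2 := hb.add 1 d
  rw [add_comm, h2, hb.one, zpow_one] at h1
  linear_combination -h1

theorem neg_inv (hb : IsBracket q br) {d : ℤ} (hd : d ≠ 0) :
    (br (-d))⁻¹ = -(br d)⁻¹ - (q - 1) := by
  have h := hb.add d (-d)
  rw [add_neg_cancel, hb.zero, hb.zpow] at h
  have h1 := hb.ne_zero d hd
  have h2 := hb.ne_zero (-d) (neg_ne_zero.2 hd)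
  field_simp
  linear_combination -h

/-- The three-term identity to which the braid relation of the seminormal matrices reduces. -/
theorem add_inv (hb : IsBracket q br) {d e : ℤ} (hd : d ≠ 0) (he : e ≠ 0) (hde : d + e ≠ 0) :
    (br (d + e))⁻¹ * ((br d)⁻¹ + (br e)⁻¹ + (q - 1)) = (br d)⁻¹ * (br e)⁻¹ := by
  have h := hb.add d e
  rw [hb.zpow] at h
  have h1 := hb.ne_zero d hd
  have h2 := hb.ne_zero e he
  have h3 := hb.ne_zero _ hde
  field_simp
  linear_combination -h

theorem injective (hb : IsBracket q br) : Function.Injective br := by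
  intro d e h
  by_contra hne
  have h1 := hb.add e (d - e)
  rw [add_sub_cancel, h] at h1
  have h2 := hb.ne_zero (d - e) (sub_ne_zero.2 hne)
  have h3 := zpow_ne_zero e hb.q_ne
  exact mul_ne_zero h3 h2 (by linear_combination -h1)

theorem inv_one (hb : IsBracket q br) : (br 1)⁻¹ = 1 := by rw [hb.one, _root_.inv_one]

theorem inv_neg_one (hb : IsBracket q br) : (br (-1))⁻¹ = -q := by
  rw [hb.neg_inv one_ne_zero, hb.inv_one]; ring

end IsBracket

end Bracket

/-! ### Young's seminormal form -/

section Seminormal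

variable {n : ℕ} {K : Type*} [Field K] (q : K) (br : ℤ → K) (t : Fin n → ℕ × ℕ)

/-- The seminormal matrix of a simple reflection `(i, j)` on the standard tableaux of shape `t`. -/
noncomputable def simpleMatrix (i j : Fin n) : Matrix (SYT t) (SYT t) K :=
  Matrix.of fun a b => if b = a then q - 1 + (br (contentDiff t a.1 i j))⁻¹
    else if b.1 = a.1 * swap i j then q + (br (contentDiff t a.1 i j))⁻¹ else 0

open Classical in
/-- The entry of a matrix in the row labelled by a tableau; zero for nonstandard tableaux. -/
noncomputable def rowEntry {κ : Type*} (M : Matrix (SYT t) κ K) (w : Perm (Fin n)) (b : κ) : K :=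
  if h : Std t w then M ⟨w, h⟩ b else 0

variable {q br t} {κ : Type*}

theorem rowEntry_coe (M : Matrix (SYT t) κ K) (a : SYT t) (b : κ) :
    rowEntry t M a.1 b = M a b := dif_pos a.2

theorem rowEntry_of_not (M : Matrix (SYT t) κ K) {w : Perm (Fin n)} (h : ¬ Std t w) (b : κ) :
    rowEntry t M w b = 0 := dif_neg h

/-- Left multiplication becomes a two-term row operation. Since `rowEntry` extends rows by zero, a
nonstandard neighbour needs no separate formula; all relations below are verified row by row against
an arbitrary right factor `M`. -/
theorem simpleMatrix_mul_apply {i j : Fin n} (hij : i ≠ j) (M : Matrix (SYT t) κ K) (a : SYT t)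
    (b : κ) : (simpleMatrix q br t i j * M) a b =
      (q - 1 + (br (contentDiff t a.1 i j))⁻¹) * M a b +
      (q + (br (contentDiff t a.1 i j))⁻¹) * rowEntry t M (a.1 * swap i j) b := by
  have hne : a.1 * swap i j ≠ a.1 := fun e => hij (Equiv.swap_eq_one_iff.1 (mul_eq_left.1 e))
  rw [Matrix.mul_apply]
  by_cases h : Std t (a.1 * swap i j)
  · set a' : SYT t := ⟨a.1 * swap i j, h⟩ with ha'
    have hne' : a' ≠ a := fun e => hne (congrArg Subtype.val e)
    have : rowEntry t M (a.1 * swap i j) b = M a' b := dif_pos h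
    rw [this, Finset.sum_eq_add_of_mem a a' (Finset.mem_univ _) (Finset.mem_univ _) hne'.symm]
    · simp only [simpleMatrix, Matrix.of_apply, if_true, if_neg hne']
      simp [ha']
    · intro c _ hc
      have : c.1 ≠ a.1 * swap i j := fun e => hc.2 (Subtype.ext e)
      simp [simpleMatrix, hc.1, this]
  · rw [rowEntry_of_not M h, Finset.sum_eq_single a]
    · simp [simpleMatrix]
    · intro c _ hc
      have : c.1 ≠ a.1 * swap i j := fun e => h (e ▸ c.2)
      simp [simpleMatrix, hc, this]
    · simp

theorem rowEntry_simpleMatrix_mul {i j : Fin n} (hij : i ≠ j) (M : Matrix (SYT t) κ K)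
    {w : Perm (Fin n)} (hw : Std t w) (b : κ) : rowEntry t (simpleMatrix q br t i j * M) w b =
      (q - 1 + (br (contentDiff t w i j))⁻¹) * rowEntry t M w b +
      (q + (br (contentDiff t w i j))⁻¹) * rowEntry t M (w * swap i j) b := by
  have h1 : rowEntry t (simpleMatrix q br t i j * M) w b =
    (simpleMatrix q br t i j * M) ⟨w, hw⟩ b := dif_pos hw
  have h2 : rowEntry t M w b = M ⟨w, hw⟩ b := dif_pos hw
  rw [h1, h2, simpleMatrix_mul_apply hij]

theorem contentDiff_mul_swap (w : Perm (Fin n)) (i j : Fin n) :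
    contentDiff t (w * swap i j) i j = -contentDiff t w i j := by
  simp [contentDiff]

/-- With x = 1/[d], this is the relation (λ - q)(λ + 1) = 0 for the diagonal entry λ = q - 1 + x,
which forms a block of size one here. -/
theorem inv_br_of_not_std (hb : IsBracket q br) (ht : IsShape t) {w : Perm (Fin n)} {i j : Fin n}
    (hw : Std t w) (h : ¬ Std t (w * swap i j)) (hij : (i : ℕ) + 1 = j) :
    (q + (br (contentDiff t w i j))⁻¹) * (1 - (br (contentDiff t w i j))⁻¹) = 0 := by
  rcases contentDiff_of_not_std ht hw h hij with h1 | h1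
  · rw [h1.2, hb.inv_one]; ring
  · rw [h1.2, hb.inv_neg_one]; ring

theorem simpleMatrix_mul_self_mul (hb : IsBracket q br) (ht : IsShape t) {i j : Fin n}
    (hij : (i : ℕ) + 1 = j) (M : Matrix (SYT t) κ K) :
    simpleMatrix q br t i j * (simpleMatrix q br t i j * M) =
      q • M + (q - 1) • (simpleMatrix q br t i j * M) := by
  have hne := (lt_of_adj hij).ne
  ext a b
  have hd := contentDiff_ne_zero ht a.2 hij
  rw [simpleMatrix_mul_apply hne, Matrix.add_apply, Matrix.smul_apply, Matrix.smul_apply,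
    simpleMatrix_mul_apply hne]
  by_cases h : Std t (a.1 * swap i j)
  · rw [rowEntry_simpleMatrix_mul hne M h, contentDiff_mul_swap, hb.neg_inv hd, mul_assoc a.1,
      Equiv.swap_mul_self, mul_one, rowEntry_coe]
    simp only [smul_eq_mul]
    ring
  · rw [rowEntry_of_not _ h, rowEntry_of_not _ h]
    simp only [smul_eq_mul]
    linear_combination -(M a b) * inv_br_of_not_std hb ht a.2 h hij

theorem simpleMatrix_comm {i j k l : Fin n}
    (hij : (i : ℕ) + 1 = j) (hkl : (k : ℕ) + 1 = l) (hjk : j < k) :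
    simpleMatrix q br t i j * simpleMatrix q br t k l =
      simpleMatrix q br t k l * simpleMatrix q br t i j := by
  rw [← Matrix.mul_one (simpleMatrix q br t k l), ← Matrix.mul_one (simpleMatrix q br t i j),
    Matrix.mul_assoc, Matrix.mul_assoc, Matrix.one_mul, Matrix.one_mul]
  have hne := (lt_of_adj hij).ne
  have hne' := (lt_of_adj hkl).ne
  have n1 : swap i j k = k := Equiv.swap_apply_of_ne_of_ne (by grind) (by grind)
  have n2 : swap i j l = l := Equiv.swap_apply_of_ne_of_ne (by grind) (by grind)
  have n3 : swap k l i = i := Equiv.swap_apply_of_ne_of_ne (by grind) (by grind)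
  have n4 : swap k l j = j := Equiv.swap_apply_of_ne_of_ne (by grind) (by grind)
  generalize (1 : Matrix (SYT t) (SYT t) K) = M
  ext a b
  have e : a.1 * swap k l * swap i j = a.1 * swap i j * swap k l := by
    rw [mul_assoc, mul_assoc]
    congr 1
    exact ((Equiv.Perm.disjoint_swap_swap (by
      simp [List.nodup_cons]; grind))).commute.symm
  have d1 : contentDiff t (a.1 * swap i j) k l = contentDiff t a.1 k l := by
    simp [contentDiff, n1, n2]
  have d2 : contentDiff t (a.1 * swap k l) i j = contentDiff t a.1 i j := by
    simp [contentDiff, n3, n4]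
  -- A comparability of the cells of `i` and `j` is not affected by the distant transposition.
  have f1 : ¬ Std t (a.1 * swap i j) → ¬ Std t (a.1 * swap i j * swap k l) := by
    intro h h2
    have := h2 j i (by simpa [n3, n4] using le_of_not_std_mul_swap a.2 hij h)
    exact absurd (lt_of_adj hij) this.not_gt
  have f2 : ¬ Std t (a.1 * swap k l) → ¬ Std t (a.1 * swap i j * swap k l) := by
    intro h h2
    have := h2 l k (by simpa [n1, n2] using le_of_not_std_mul_swap a.2 hkl h)
    exact absurd (lt_of_adj hkl) this.not_gt
  simp only [simpleMatrix_mul_apply hne, simpleMatrix_mul_apply hne']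
  by_cases h1 : Std t (a.1 * swap i j) <;> by_cases h2 : Std t (a.1 * swap k l)
  · rw [rowEntry_simpleMatrix_mul hne' _ h1, rowEntry_simpleMatrix_mul hne _ h2, d1, d2, e]
    ring
  · rw [rowEntry_simpleMatrix_mul hne' _ h1, rowEntry_of_not _ h2, rowEntry_of_not _ h2,
      rowEntry_of_not _ (f2 h2), d1]
    ring
  · rw [rowEntry_simpleMatrix_mul hne _ h2, rowEntry_of_not _ h1, rowEntry_of_not _ h1, e,
      rowEntry_of_not _ (f1 h1), d2]
    ring
  · simp only [rowEntry_of_not _ h1, rowEntry_of_not _ h2]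
    ring

/-- Both sides expand over the at most six tableaux obtained by permuting the entries `i`, `j`, `k`.
The coefficients agree by `IsBracket.add_inv` for the content differences d1, d2, d1 + d2; where a
simple exchange is not standard, the degenerate quadratic relation replaces the missing row. -/
theorem simpleMatrix_braid (hb : IsBracket q br) (ht : IsShape t) {i j k : Fin n}
    (hij : (i : ℕ) + 1 = j) (hjk : (j : ℕ) + 1 = k) :
    simpleMatrix q br t i j * simpleMatrix q br t j k * simpleMatrix q br t i j =
      simpleMatrix q br t j k * simpleMatrix q br t i j * simpleMatrix q br t j k := by
  suffices H : ∀ M : Matrix (SYT t) (SYT t) K,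
      simpleMatrix q br t i j * (simpleMatrix q br t j k * (simpleMatrix q br t i j * M)) =
      simpleMatrix q br t j k * (simpleMatrix q br t i j * (simpleMatrix q br t j k * M)) by
    simpa [Matrix.mul_assoc] using H 1
  intro M
  ext a b
  have hne := (lt_of_adj hij).ne
  have hne' := (lt_of_adj hjk).ne
  obtain ⟨w, hw⟩ := a
  set d1 := contentDiff t w i j with hd1
  set d2 := contentDiff t w j k with hd2
  have z1 : d1 ≠ 0 := contentDiff_ne_zero ht hw hij
  have z2 : d2 ≠ 0 := contentDiff_ne_zero ht hw hjk
  have hd12 : contentDiff t w i k = d1 + d2 := by simp only [hd1, hd2, contentDiff]; ring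
  have z12 : d1 + d2 ≠ 0 := hd12 ▸ contentDiff_two_ne_zero ht hw hij hjk
  set s := swap i j with hs
  set r := swap j k with hr
  have n1 : swap i j k = k := Equiv.swap_apply_of_ne_of_ne (by grind) (by grind)
  have n3 : swap j k i = i := Equiv.swap_apply_of_ne_of_ne (by grind) (by grind)
  have c1 : contentDiff t (w * s) i j = -d1 := by simp [contentDiff, hd1, hs]
  have c2 : contentDiff t (w * s) j k = d1 + d2 := by
    rw [← hd12]; simp [contentDiff, hs, n1]
  have c3 : contentDiff t (w * r) i j = d1 + d2 := by
    rw [← hd12]; simp [contentDiff, hr, n3]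
  have c4 : contentDiff t (w * r) j k = -d2 := by simp [contentDiff, hd2, hr]
  have c5 : contentDiff t (w * s * r) i j = d2 := by simp [contentDiff, hd2, hr, hs, n1, n3]
  have c6 : contentDiff t (w * r * s) j k = d1 := by simp [contentDiff, hd1, hr, hs, n1, n3]
  have esrs : w * s * r * s = w * r * s * r := by
    simp only [mul_assoc]
    congr 1
    ext x
    simp only [hs, hr, Equiv.Perm.mul_apply, Equiv.swap_apply_def]
    grind
  have ess : w * s * s = w := by simp [mul_assoc, hs]
  have err : w * r * r = w := by simp [mul_assoc, hr]
  -- a comparability between two of the three cells is violated in every tableau reversing them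
  have g1 : ¬ Std t (w * s) → t (w i) ≤ t (w j) := le_of_not_std_mul_swap hw hij
  have g2 : ¬ Std t (w * r) → t (w j) ≤ t (w k) := le_of_not_std_mul_swap hw hjk
  have lik : ¬ k ≤ i := by grind
  have lij : ¬ j ≤ i := by grind
  have ljk : ¬ k ≤ j := by grind
  have b1 : Std t (w * s * r) → ¬ t (w i) ≤ t (w j) := fun h hle =>
    lik (h k i (by simpa [hs, hr, n1, n3] using hle))
  have b2 : Std t (w * r * s) → ¬ t (w j) ≤ t (w k) := fun h hle =>
    lik (h k i (by simpa [hs, hr, n1, n3] using hle))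
  have b3 : Std t (w * r * s * r) → ¬ t (w i) ≤ t (w j) := fun h hle =>
    ljk (h k j (by simpa [hs, hr, n1, n3] using hle))
  have b4 : Std t (w * r * s * r) → ¬ t (w j) ≤ t (w k) := fun h hle =>
    lij (h j i (by simpa [hs, hr, n1, n3] using hle))
  have b5 : Std t (w * r * s * r) → ¬ t (w i) ≤ t (w k) := fun h hle =>
    lik (h k i (by simpa [hs, hr, n1, n3] using hle))
  have g3 : Std t (w * s) → ¬ Std t (w * s * r) → t (w i) ≤ t (w k) := fun h h2 => by
    simpa [hs, n1] using le_of_not_std_mul_swap h hjk h2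
  have g4 : Std t (w * r) → ¬ Std t (w * r * s) → t (w i) ≤ t (w k) := fun h h2 => by
    simpa [hr, n3] using le_of_not_std_mul_swap h hij h2
  have P := hb.add_inv z1 z2 z12
  have q1 := hb.neg_inv z1
  have q2 := hb.neg_inv z2
  have h0 : ∀ (w' : Perm (Fin n)) (N : Matrix (SYT t) (SYT t) K) , ¬ Std t w' →
    rowEntry t N w' b = 0 := fun w' N h => rowEntry_of_not N h b
  have hN : ∀ N : Matrix (SYT t) (SYT t) K, N ⟨w, hw⟩ b = rowEntry t N w b :=
    fun N => (rowEntry_coe N ⟨w, hw⟩ b).symm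
  refine (hN _).trans (Eq.trans ?_ (hN _).symm)
  rw [rowEntry_simpleMatrix_mul hne _ hw, rowEntry_simpleMatrix_mul hne' _ hw,
    rowEntry_simpleMatrix_mul hne' _ hw, rowEntry_simpleMatrix_mul hne _ hw,
    rowEntry_simpleMatrix_mul hne _ hw, rowEntry_simpleMatrix_mul hne' _ hw]
  simp only [← hs, ← hr, ← hd1, ← hd2]
  by_cases h1 : Std t (w * s) <;> by_cases h2 : Std t (w * r)
  · simp only [rowEntry_simpleMatrix_mul hne' _ h1, rowEntry_simpleMatrix_mul hne _ h1,
      rowEntry_simpleMatrix_mul hne _ h2, rowEntry_simpleMatrix_mul hne' _ h2]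
    simp only [← hs, ← hr, c1, c2, c3, c4, ess, err, q1, q2]
    by_cases h3 : Std t (w * r * s * r)
    · have h4 : Std t (w * s * r) := by_contra fun h => b5 h3 (g3 h1 h)
      have h5 : Std t (w * r * s) := by_contra fun h => b5 h3 (g4 h2 h)
      rw [rowEntry_simpleMatrix_mul hne _ h4, rowEntry_simpleMatrix_mul hne' _ h5]
      simp only [← hs, ← hr, c5, c6, esrs]
      -- The multipliers of `P` belong to the rows `w`, `w s` and `w r`; the coefficients of the
      -- other rows agree without it.
      linear_combination (-(br d1)⁻¹ * rowEntry t M w b + (br d2)⁻¹ * rowEntry t M w b -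
        (q + (br d1)⁻¹) * rowEntry t M (w * s) b + (q + (br d2)⁻¹) * rowEntry t M (w * r) b) * P
    -- The tableau `w s r s` is missing; if `w s r` is missing as well, both sides vanish by the
    -- zero convention.
    · have e4 : rowEntry t (simpleMatrix q br t i j * M) (w * s * r) b =
          (q - 1 + (br d2)⁻¹) * rowEntry t M (w * s * r) b := by
        by_cases h4 : Std t (w * s * r)
        · rw [rowEntry_simpleMatrix_mul hne _ h4, ← hs, esrs, h0 _ M h3, c5]; ring
        · rw [h0 _ _ h4, h0 _ _ h4]; ring
      have e5 : rowEntry t (simpleMatrix q br t j k * M) (w * r * s) b =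
          (q - 1 + (br d1)⁻¹) * rowEntry t M (w * r * s) b := by
        by_cases h4 : Std t (w * r * s)
        · rw [rowEntry_simpleMatrix_mul hne' _ h4, ← hr, h0 _ M h3, c6]; ring
        · rw [h0 _ _ h4, h0 _ _ h4]; ring
      rw [e4, e5]
      linear_combination (-(br d1)⁻¹ * rowEntry t M w b + (br d2)⁻¹ * rowEntry t M w b -
        (q + (br d1)⁻¹) * rowEntry t M (w * s) b + (q + (br d2)⁻¹) * rowEntry t M (w * r) b) * P
  · have B2 := inv_br_of_not_std hb ht hw h2 hjk
    have h3 : ¬ Std t (w * r * s * r) := fun h => b4 h (g2 h2)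
    have h5 : ¬ Std t (w * r * s) := fun h => b2 h (g2 h2)
    have e4 : rowEntry t (simpleMatrix q br t i j * M) (w * s * r) b =
          (q - 1 + (br d2)⁻¹) * rowEntry t M (w * s * r) b := by
      by_cases h4 : Std t (w * s * r)
      · rw [rowEntry_simpleMatrix_mul hne _ h4, ← hs, esrs, h0 _ M h3, c5]; ring
      · rw [h0 _ _ h4, h0 _ _ h4]; ring
    simp only [rowEntry_simpleMatrix_mul hne' _ h1, rowEntry_simpleMatrix_mul hne _ h1]
    simp only [← hs, ← hr, c1, c2, ess, q1, e4, h0 _ _ h2]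
    linear_combination (-(br d1)⁻¹ * rowEntry t M w b + (br d2)⁻¹ * rowEntry t M w b -
        (q + (br d1)⁻¹) * rowEntry t M (w * s) b) * P +
        (q - 1 + (br (d1 + d2))⁻¹) * rowEntry t M w b * B2
  · have B1 := inv_br_of_not_std hb ht hw h1 hij
    have h3 : ¬ Std t (w * r * s * r) := fun h => b3 h (g1 h1)
    have h5 : ¬ Std t (w * s * r) := fun h => b1 h (g1 h1)
    have e5 : rowEntry t (simpleMatrix q br t j k * M) (w * r * s) b =
          (q - 1 + (br d1)⁻¹) * rowEntry t M (w * r * s) b := by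
      by_cases h4 : Std t (w * r * s)
      · rw [rowEntry_simpleMatrix_mul hne' _ h4, ← hr, h0 _ M h3, c6]; ring
      · rw [h0 _ _ h4, h0 _ _ h4]; ring
    simp only [rowEntry_simpleMatrix_mul hne _ h2, rowEntry_simpleMatrix_mul hne' _ h2]
    simp only [← hs, ← hr, c3, c4, err, q2, e5, h0 _ _ h1]
    linear_combination (-(br d1)⁻¹ * rowEntry t M w b + (br d2)⁻¹ * rowEntry t M w b +
        (q + (br d2)⁻¹) * rowEntry t M (w * r) b) * P -
        (q - 1 + (br (d1 + d2))⁻¹) * rowEntry t M w b * B1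
  · have B1 := inv_br_of_not_std hb ht hw h1 hij
    have B2 := inv_br_of_not_std hb ht hw h2 hjk
    simp only [h0 _ _ h1, h0 _ _ h2]
    linear_combination (-(br d1)⁻¹ * rowEntry t M w b + (br d2)⁻¹ * rowEntry t M w b) * P -
        (q - 1 + (br (d1 + d2))⁻¹) * rowEntry t M w b * B1 +
        (q - 1 + (br (d1 + d2))⁻¹) * rowEntry t M w b * B2

/-- The seminormal representation of the Hecke algebra on the standard tableaux of shape `t`. -/
noncomputable def seminormal (hb : IsBracket q br) (ht : IsShape t) :
    Perm (Fin n) → Matrix (SYT t) (SYT t) K :=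
  (exists_braid_lift (simpleMatrix q br t) (fun _ _ _ => simpleMatrix_braid hb ht)
    fun _ _ _ _ => simpleMatrix_comm).choose

section

variable (hb : IsBracket q br) (ht : IsShape t)

theorem seminormal_one : seminormal hb ht 1 = 1 :=
  (exists_braid_lift (simpleMatrix q br t) (fun _ _ _ => simpleMatrix_braid hb ht)
    fun _ _ _ _ => simpleMatrix_comm).choose_spec.1

theorem seminormal_swap_mul {i j : Fin n} (hij : (i : ℕ) + 1 = j) (w : Perm (Fin n))
    (h : w⁻¹ i < w⁻¹ j) :
    seminormal hb ht (swap i j * w) = simpleMatrix q br t i j * seminormal hb ht w :=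
  (exists_braid_lift (simpleMatrix q br t) (fun _ _ _ => simpleMatrix_braid hb ht)
    fun _ _ _ _ => simpleMatrix_comm).choose_spec.2 i j w hij h

theorem seminormal_swap {i j : Fin n} (hij : (i : ℕ) + 1 = j) :
    seminormal hb ht (swap i j) = simpleMatrix q br t i j := by
  have := seminormal_swap_mul hb ht hij 1 (by simpa using lt_of_adj hij)
  rwa [mul_one, seminormal_one, Matrix.mul_one] at this

theorem isHecke_seminormal : IsHecke q (seminormal hb ht) where
  one_mul w := by rw [seminormal_one, Matrix.one_mul]
  mul_of_lt i j w hij h := by rw [seminormal_swap hb ht hij, seminormal_swap_mul hb ht hij w h]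
  mul_of_gt i j w hij h := by
    have := seminormal_swap_mul hb ht hij (swap i j * w) (by simpa using h)
    rw [← mul_assoc, Equiv.swap_mul_self, one_mul] at this
    rw [seminormal_swap hb ht hij, this, simpleMatrix_mul_self_mul hb ht hij]

end

end Seminormal

/-! ### Jucys–Murphy elements and Schur's lemma -/

section Intertwiners

variable {n : ℕ} {K : Type*} [Field K] {q : K} {br : ℤ → K} {t t' : Fin n → ℕ × ℕ}

/-- The diagonal matrix by which a Jucys–Murphy element acts on the seminormal basis. -/
noncomputable def jucysMurphy (br : ℤ → K) (t : Fin n → ℕ × ℕ) (k : Fin n) :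
    Matrix (SYT t) (SYT t) K :=
  Matrix.diagonal fun a => br (content (t (a.1 k)))

theorem rowEntry_jucysMurphy_mul {κ : Type*} (k : Fin n) (M : Matrix (SYT t) κ K)
    (w : Perm (Fin n)) (b : κ) :
    rowEntry t (jucysMurphy br t k * M) w b = br (content (t (w k))) * rowEntry t M w b := by
  by_cases h : Std t w
  · have h1 : rowEntry t (jucysMurphy br t k * M) w b = (jucysMurphy br t k * M) ⟨w, h⟩ b :=
      dif_pos h
    have h2 : rowEntry t M w b = M ⟨w, h⟩ b := dif_pos h
    rw [h1, h2, jucysMurphy, Matrix.diagonal_mul]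
  · rw [rowEntry_of_not _ h, rowEntry_of_not _ h, mul_zero]

/-- The recursion q L_{k+1} = T + T L_k T expresses the diagonal content matrices through the simple
matrices; hence everything that commutes with the latter commutes with the former. -/
theorem jucysMurphy_succ (hb : IsBracket q br) (ht : IsShape t) {i j : Fin n}
    (hij : (i : ℕ) + 1 = j) :
    q • jucysMurphy br t j = simpleMatrix q br t i j +
      simpleMatrix q br t i j * (jucysMurphy br t i * simpleMatrix q br t i j) := by
  suffices H : ∀ M : Matrix (SYT t) (SYT t) K, q • (jucysMurphy br t j * M) =
      simpleMatrix q br t i j * M +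
        simpleMatrix q br t i j * (jucysMurphy br t i * (simpleMatrix q br t i j * M)) by
    simpa using H 1
  intro M
  have hne := (lt_of_adj hij).ne
  ext a b
  have hd := contentDiff_ne_zero ht a.2 hij
  have hbd := hb.ne_zero _ hd
  have e : content (t (a.1 j)) = content (t (a.1 i)) + contentDiff t a.1 i j := by
    simp [contentDiff]
  have hY := hb.add (content (t (a.1 i))) (contentDiff t a.1 i j)
  rw [← e, hb.zpow] at hY
  -- With c the content of the cell of `i` and d the difference: ([c + d] - [c]) / [d] = q^c.
  have hp : (br (contentDiff t a.1 i j))⁻¹ * (br (content (t (a.1 j))) -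
      br (content (t (a.1 i)))) = 1 + (q - 1) * br (content (t (a.1 i))) := by
    rw [hY]; field_simp; ring
  rw [Matrix.smul_apply, Matrix.add_apply, simpleMatrix_mul_apply hne, simpleMatrix_mul_apply hne,
    rowEntry_jucysMurphy_mul]
  have e1 : ∀ N : Matrix (SYT t) (SYT t) K, ∀ k,
      (jucysMurphy br t k * N) a b = br (content (t (a.1 k))) * N a b := fun N k => by
    rw [jucysMurphy, Matrix.diagonal_mul]
  rw [e1, e1, simpleMatrix_mul_apply hne]
  simp only [smul_eq_mul, Equiv.Perm.mul_apply, Equiv.swap_apply_left]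
  by_cases h : Std t (a.1 * swap i j)
  · rw [rowEntry_simpleMatrix_mul hne M h, contentDiff_mul_swap, hb.neg_inv hd, mul_assoc a.1,
      Equiv.swap_mul_self, mul_one, rowEntry_coe]
    linear_combination (M a b * ((br (contentDiff t a.1 i j))⁻¹ + q - 1) +
      (q + (br (contentDiff t a.1 i j))⁻¹) * rowEntry t M (a.1 * swap i j) b) * hp
  · rw [rowEntry_of_not _ h, rowEntry_of_not _ h]
    linear_combination M a b * ((br (contentDiff t a.1 i j))⁻¹ + q - 1) * hp +
      M a b * br (content (t (a.1 j))) * inv_br_of_not_std hb ht a.2 h hij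

theorem content_zero (ht : IsShape t) {w : Perm (Fin n)} (hw : Std t w) {k : Fin n}
    (hk : (k : ℕ) = 0) : content (t (w k)) = 0 := by
  obtain ⟨m, hm⟩ := ht.lower (w k) (0, 0) ⟨Nat.zero_le _, Nat.zero_le _⟩
  obtain ⟨m, rfl⟩ := w.surjective m
  have h := hw m k (by rw [hm]; exact ⟨Nat.zero_le _, Nat.zero_le _⟩)
  have : m = k := Fin.ext (by rw [Fin.le_def] at h; omega)
  rw [← this, hm]
  rfl

/-- `P` intertwines the seminormal matrices of the simple reflections. -/
def IsIntertwiner (q : K) (br : ℤ → K) (P : Matrix (SYT t) (SYT t') K) : Prop :=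
  ∀ i j : Fin n, (i : ℕ) + 1 = j → simpleMatrix q br t i j * P = P * simpleMatrix q br t' i j

theorem IsIntertwiner.jucysMurphy_mul (hb : IsBracket q br) (ht : IsShape t) (ht' : IsShape t')
    {P : Matrix (SYT t) (SYT t') K} (hP : IsIntertwiner q br P) (k : Fin n) :
    jucysMurphy br t k * P = P * jucysMurphy br t' k := by
  obtain ⟨k, hk⟩ := k
  induction k with
  | zero =>
    have h1 : jucysMurphy br t ⟨0, hk⟩ = 0 := by
      rw [jucysMurphy, Matrix.diagonal_eq_zero]
      funext a
      rw [content_zero ht a.2 rfl, hb.zero]; rfl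
    have h2 : jucysMurphy br t' ⟨0, hk⟩ = 0 := by
      rw [jucysMurphy, Matrix.diagonal_eq_zero]
      funext a
      rw [content_zero ht' a.2 rfl, hb.zero]; rfl
    rw [h1, h2, Matrix.zero_mul, Matrix.mul_zero]
  | succ k ih =>
    have hij : (((⟨k, by omega⟩ : Fin n) : ℕ)) + 1 = ((⟨k + 1, hk⟩ : Fin n) : ℕ) := rfl
    have hs := hP _ _ hij
    have h := ih (by omega)
    have := hb.q_ne
    refine smul_right_injective _ hb.q_ne ?_
    simp only
    rw [← Matrix.smul_mul, ← Matrix.mul_smul, jucysMurphy_succ hb ht hij,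
      jucysMurphy_succ hb ht' hij, Matrix.add_mul, Matrix.mul_add, hs]
    congr 1
    rw [Matrix.mul_assoc, Matrix.mul_assoc, hs, ← Matrix.mul_assoc (jucysMurphy br t _), h]
    simp only [← Matrix.mul_assoc]
    rw [hs]

/-- On a common diagonal, a smaller row index means that the first cell precedes the second in its
shape. So the second tableau fills it with an earlier entry, and by the hypothesis on earlier
entries the first tableau does too, which contradicts injectivity. -/
theorem cell_not_row_lt (ht' : IsShape t') {a b : Perm (Fin n)} (ht : IsShape t)
    (hb : Std t' b) {k : Fin n}
    (hc : content (t (a k)) = content (t' (b k)))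
    (ih : ∀ m < k, t (a m) = t' (b m)) : ¬ (t (a k)).1 < (t' (b k)).1 := by
  intro hlt
  unfold content at hc
  obtain ⟨m, hm⟩ := ht'.lower (b k) (t (a k)) (Prod.le_def.2 ⟨by omega, by omega⟩)
  obtain ⟨m, rfl⟩ := b.surjective m
  have h := hb m k (by rw [hm]; exact Prod.le_def.2 ⟨by omega, by omega⟩)
  rcases h.lt_or_eq with h | rfl
  · exact h.ne (a.injective (ht.inj (by rw [ih m h, hm])))
  · rw [hm] at hlt; exact lt_irrefl _ hlt

theorem tableau_eq_of_content_eq (ht : IsShape t) (ht' : IsShape t') {a b : Perm (Fin n)}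
    (ha : Std t a) (hb : Std t' b) (hc : ∀ k, content (t (a k)) = content (t' (b k))) (k : Fin n) :
    t (a k) = t' (b k) := by
  induction hk : (k : ℕ) using Nat.strong_induction_on generalizing k with
  | _ N ih =>
    have ih' : ∀ m < k, t (a m) = t' (b m) := fun m hm => ih m (by omega) m rfl
    have h1 := cell_not_row_lt ht' ht hb (hc k) ih'
    have h2 := cell_not_row_lt ht ht' ha (hc k).symm fun m hm => (ih' m hm).symm
    have h3 := hc k
    unfold content at h3
    exact Prod.ext (by omega) (by omega)

theorem IsShape.lt_of_lex (ht : IsShape t) {a b : Fin n}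
    (h : (t a).1 < (t b).1 ∨ ((t a).1 = (t b).1 ∧ (t a).2 < (t b).2)) : a < b := by
  by_contra hc
  rcases (not_lt.1 hc).lt_or_eq with h1 | rfl
  · have := ht.lex b a h1; omega
  · omega

/-- The two shapes have the same cells, and the lexicographic order determines the listing. -/
theorem shape_eq_of_tableau_eq (ht : IsShape t) (ht' : IsShape t') {a b : Perm (Fin n)}
    (h : ∀ k, t (a k) = t' (b k)) : t = t' ∧ a = b := by
  have h' : ∀ k, t ((a * b⁻¹) k) = t' k := fun k => by simpa using h (b⁻¹ k)
  have h1 : a * b⁻¹ = 1 := by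
    refine eq_one_of_forall_adj_lt _ fun i j hij => ht.lt_of_lex ?_
    rw [h', h']
    exact ht'.lex i j (lt_of_adj hij)
  refine ⟨funext fun k => ?_, mul_inv_eq_one.1 h1⟩
  rw [← h' k, h1, Equiv.Perm.one_apply]

/-- The joint eigenvalues of the Jucys–Murphy elements are the content sequences, and these separate
the standard tableaux of all shapes. -/
theorem IsIntertwiner.eq_of_ne_zero (hb : IsBracket q br) (ht : IsShape t) (ht' : IsShape t')
    {P : Matrix (SYT t) (SYT t') K} (hP : IsIntertwiner q br P) {a : SYT t} {b : SYT t'}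
    (h : P a b ≠ 0) : t = t' ∧ a.1 = b.1 := by
  refine shape_eq_of_tableau_eq ht ht' (tableau_eq_of_content_eq ht ht' a.2 b.2 fun k => ?_)
  have := congrFun (congrFun (hP.jucysMurphy_mul hb ht ht' k) a) b
  rw [jucysMurphy, jucysMurphy, Matrix.diagonal_mul, Matrix.mul_diagonal, mul_comm] at this
  exact hb.injective (mul_left_cancel₀ h this)

/-- The superstandard tableau, filled row by row. -/
def rowSYT (ht : IsShape t) : SYT t := ⟨1, ht.std_one⟩

theorem IsShape.le_of_le (ht : IsShape t) {j k : Fin n} (h : t j ≤ t k) : j ≤ k :=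
  ht.std_one j k h

/-- Comparable cells are listed in increasing order, so an adjacent inversion always sits in
incomparable cells. Every standard tableau thus descends to the superstandard one inside the
standard tableaux. -/
theorem std_mul_swap_of_gt (ht : IsShape t) {a : Perm (Fin n)} (ha : Std t a) {i j : Fin n}
    (hij : (i : ℕ) + 1 = j) (h : a j < a i) : Std t (a * swap i j) := by
  by_contra hc
  exact absurd h (ht.le_of_le (le_of_not_std_mul_swap ha hij hc)).not_gt

/-- Induction on standard tableaux, starting from the superstandard one. -/
theorem SYT.induction (ht : IsShape t) {P : SYT t → Prop} (one : P (rowSYT ht))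
    (swap : ∀ (a : SYT t) (i j : Fin n), (i : ℕ) + 1 = j → a.1 j < a.1 i →
      ∀ h : Std t (a.1 * swap i j), P ⟨a.1 * Equiv.swap i j, h⟩ → P a) (a : SYT t) : P a := by
  induction hk : length a.1 using Nat.strong_induction_on generalizing a with
  | _ N ih =>
    by_cases h1 : a.1 = 1
    · rw [show a = rowSYT ht from Subtype.ext h1]; exact one
    · obtain ⟨i, j, hij, hlt⟩ := exists_right_descent h1
      have hs := std_mul_swap_of_gt ht a.2 hij hlt
      have := length_mul_swap_of_gt hij _ hlt
      exact swap a i j hij hlt hs (ih (length (a.1 * Equiv.swap i j)) (by omega) _ rfl)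

theorem IsBracket.q_add_inv (hb : IsBracket q br) {d : ℤ} (hd : d ≠ 0) :
    q + (br d)⁻¹ = br (1 + d) / br d := by
  have := hb.ne_zero d hd
  rw [hb.add, hb.one, zpow_one]
  field_simp
  ring

theorem IsBracket.q_add_inv_ne_zero (hb : IsBracket q br) {d : ℤ} (hd : d ≤ -2 ∨ 2 ≤ d) :
    q + (br d)⁻¹ ≠ 0 := by
  rw [hb.q_add_inv (by omega)]
  exact div_ne_zero (hb.ne_zero _ (by omega)) (hb.ne_zero _ (by omega))

theorem simpleMatrix_apply_swap {i j : Fin n} (hij : i ≠ j) (a : SYT t)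
    (h : Std t (a.1 * swap i j)) :
    simpleMatrix q br t i j a ⟨a.1 * swap i j, h⟩ = q + (br (contentDiff t a.1 i j))⁻¹ := by
  have hne : a.1 * swap i j ≠ a.1 := fun e => hij (Equiv.swap_eq_one_iff.1 (mul_eq_left.1 e))
  have : (⟨a.1 * swap i j, h⟩ : SYT t) ≠ a := fun e => hne (congrArg Subtype.val e)
  simp [simpleMatrix, this]

/-- An intertwiner is diagonal by the separation of tableaux. Comparing an off-diagonal entry, which
is nonzero because |d| ≥ 2, shows that it is constant along each exchange, and exchanges connect all
tableaux. -/
theorem IsIntertwiner.eq_smul_one (hb : IsBracket q br) (ht : IsShape t)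
    {P : Matrix (SYT t) (SYT t) K} (hP : IsIntertwiner q br P) :
    P = P (rowSYT ht) (rowSYT ht) • 1 := by
  have hdiag : ∀ a b, a ≠ b → P a b = 0 := fun a b hab => by
    by_contra h
    exact hab (Subtype.ext (hP.eq_of_ne_zero hb ht ht h).2)
  have key : ∀ a : SYT t, P a a = P (rowSYT ht) (rowSYT ht) := by
    intro a
    induction a using SYT.induction ht with
    | one => rfl
    | swap a i j hij hlt hs ih =>
      rw [← ih]
      have hne := (lt_of_adj hij).ne
      have e := congrFun (congrFun (hP i j hij) a) ⟨a.1 * swap i j, hs⟩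
      rw [Matrix.mul_apply, Matrix.mul_apply, Finset.sum_eq_single ⟨a.1 * swap i j, hs⟩,
        Finset.sum_eq_single a, simpleMatrix_apply_swap hne] at e
      · exact (mul_left_cancel₀ (hb.q_add_inv_ne_zero (a.2.two_le_contentDiff hs hij))
          (e.trans (mul_comm _ _))).symm
      · intro c _ hc; rw [hdiag a c hc.symm, zero_mul]
      · simp
      · intro c _ hc; rw [hdiag _ _ hc, mul_zero]
      · simp
  ext a b
  by_cases hab : a = b
  · subst hab; simp [key]
  · rw [hdiag a b hab]; simp [hab]

end Intertwiners

/-! ### Orthogonality of matrix coefficients -/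

section Schur

variable {n : ℕ} {K : Type*} [Field K] {q : K} {br : ℤ → K} {t t' : Fin n → ℕ × ℕ}
  (hb : IsBracket q br) (ht : IsShape t) (ht' : IsShape t')

/-- The pairing of two matrix coefficients with respect to the symmetrizing trace. -/
noncomputable def coeffPairing (a b : SYT t) (c d : SYT t') : K :=
  ∑ w, (q ^ length w)⁻¹ * seminormal hb ht w a b * seminormal hb ht' w⁻¹ c d

theorem isIntertwiner_coeffPairing (b : SYT t) (c : SYT t') :
    IsIntertwiner q br (Matrix.of fun a d => coeffPairing hb ht ht' a b c d) := by
  intro i j hij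
  ext a d
  have := sum_hecke_average hb.q_ne (isHecke_seminormal hb ht) (isHecke_seminormal hb ht') hij
    a b c d
  rw [seminormal_swap hb ht hij, seminormal_swap hb ht' hij] at this
  simp only [Matrix.mul_apply, Matrix.of_apply, coeffPairing, Finset.mul_sum, Finset.sum_mul]
    at this ⊢
  rw [Finset.sum_comm]
  refine Eq.trans ?_ (this.trans ?_)
  · exact Finset.sum_congr rfl fun w _ => Finset.sum_congr rfl fun e _ => by ring
  · rw [Finset.sum_comm]
    exact Finset.sum_congr rfl fun w _ => Finset.sum_congr rfl fun e _ => by ring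

theorem coeffPairing_of_ne (hne : t ≠ t') (a b : SYT t) (c d : SYT t') :
    coeffPairing hb ht ht' a b c d = 0 := by
  by_contra h
  exact hne ((isIntertwiner_coeffPairing hb ht ht' b c).eq_of_ne_zero hb ht ht'
    (a := a) (b := d) h).1

theorem coeffPairing_comm (a b : SYT t) (c d : SYT t') :
    coeffPairing hb ht ht' a b c d = coeffPairing hb ht' ht c d a b := by
  unfold coeffPairing
  refine Fintype.sum_equiv (Equiv.inv _) _ _ fun w => ?_
  rw [Equiv.inv_apply, inv_inv, length_inv]
  ring

/-- The Schur element of the seminormal representation. -/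
noncomputable def schurElement : K :=
  coeffPairing hb ht ht (rowSYT ht) (rowSYT ht) (rowSYT ht) (rowSYT ht)

/-- Schur's lemma for the averaged matrix controls the outer indices `a`, `d`; the symmetry w ↦ w⁻¹
turns this into control of the inner indices `b`, `c`. -/
theorem coeffPairing_self (a b c d : SYT t) :
    coeffPairing hb ht ht a b c d = if a = d ∧ b = c then schurElement hb ht else 0 := by
  have key : ∀ a b c d : SYT t, coeffPairing hb ht ht a b c d =
      if a = d then coeffPairing hb ht ht (rowSYT ht) b c (rowSYT ht) else 0 := by
    intro a b c d
    have := congrFun (congrFun ((isIntertwiner_coeffPairing hb ht ht b c).eq_smul_one hb ht) a) d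
    simpa [Matrix.one_apply] using this
  rw [key, coeffPairing_comm, key, ite_and]
  simp only [eq_comm (a := c), schurElement]

/-- Identifies the denominator in the generic degree. -/
theorem sum_trace_mul_trace :
    ∑ w, (q ^ length w)⁻¹ * (seminormal hb ht w).trace * (seminormal hb ht w⁻¹).trace =
      Fintype.card (SYT t) * schurElement hb ht := by
  have : ∑ w, (q ^ length w)⁻¹ * (seminormal hb ht w).trace * (seminormal hb ht w⁻¹).trace =
      ∑ a, ∑ c, coeffPairing hb ht ht a a c c := by
    simp only [Matrix.trace, Matrix.diag_apply, coeffPairing, mul_assoc]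
    simp_rw [Finset.sum_mul_sum, Finset.mul_sum]
    rw [Finset.sum_comm]
    exact Finset.sum_congr rfl fun a _ => Finset.sum_comm
  rw [this]
  simp [coeffPairing_self]

end Schur

/-! ### Matrix units and decomposition of Hecke representations -/

section MatrixUnits

theorem exists_nat_trace_eq {K κ : Type*} [Field K] [CharZero K] [Fintype κ] [DecidableEq κ]
    {e : Matrix κ κ K} (he : e * e = e) : ∃ m : ℕ, e.trace = m ∧ (m = 0 → e = 0) := by
  have h : IsIdempotentElem (Matrix.toLin' e) := by
    rw [IsIdempotentElem, Module.End.mul_eq_comp, ← Matrix.toLin'_mul, he]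
  have h1 := (LinearMap.IsIdempotentElem.isProj_range _ h).trace
  rw [Matrix.trace_toLin'_eq] at h1
  refine ⟨_, h1, fun h2 => ?_⟩
  have h3 := (LinearMap.IsIdempotentElem.trace_eq_zero_iff h).1
    (by rw [Matrix.trace_toLin'_eq, h1, h2, Nat.cast_zero])
  exact (LinearEquiv.map_eq_zero_iff _).1 h3

variable {n : ℕ} {K κ : Type*} [Field K] [Fintype κ] {q : K} {br : ℤ → K}
  (hb : IsBracket q br)

/-- The image in a representation `T` of the matrix unit `(a, b)` of the block of the Hecke
algebra which belongs to the shape `t`. -/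
noncomputable def matrixUnit {t : Fin n → ℕ × ℕ} (ht : IsShape t)
    (T : Perm (Fin n) → Matrix κ κ K) (a b : SYT t) : Matrix κ κ K :=
  ∑ w, ((schurElement hb ht)⁻¹ * ((q ^ length w)⁻¹ * seminormal hb ht w⁻¹ b a)) • T w

section

variable {t t' : Fin n → ℕ × ℕ} (ht : IsShape t) (ht' : IsShape t')
  {T : Perm (Fin n) → Matrix κ κ K}

theorem swap_mul_matrixUnit (hT : IsHecke q T) {i j : Fin n} (hij : (i : ℕ) + 1 = j)
    (a b : SYT t) : T (swap i j) * matrixUnit hb ht T a b =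
      ∑ c, seminormal hb ht (swap i j) c a • matrixUnit hb ht T c b := by
  ext x y
  have := sum_hecke_average hb.q_ne hT (isHecke_seminormal hb ht) hij x y b a
  simp only [matrixUnit, Matrix.mul_sum, Matrix.mul_smul, Matrix.sum_apply, Matrix.smul_apply,
    smul_eq_mul]
  rw [← Finset.sum_congr rfl (fun w _ => show (schurElement hb ht)⁻¹ * ((q ^ length w)⁻¹ *
    (T (swap i j) * T w) x y * seminormal hb ht w⁻¹ b a) = _ by ring), ← Finset.mul_sum, this]
  simp only [Matrix.mul_apply, Finset.mul_sum]
  rw [Finset.sum_comm]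
  exact Finset.sum_congr rfl fun w _ => Finset.sum_congr rfl fun c _ => by ring

/-- For fixed `b` the elements E_{ab} transform under T_w exactly like the seminormal basis. -/
theorem mul_matrixUnit (hT : IsHecke q T) (w : Perm (Fin n)) (a b : SYT t) :
    T w * matrixUnit hb ht T a b = ∑ c, seminormal hb ht w c a • matrixUnit hb ht T c b := by
  induction w using left_induction generalizing a with
  | one =>
    rw [seminormal_one, Finset.sum_eq_single a]
    · simp [matrixUnit, Matrix.mul_sum, hT.one_mul]
    · intro c _ hc; simp [hc]
    · simp
  | mul i j w hij h ih =>
    rw [← hT.mul_of_lt i j w hij h, Matrix.mul_assoc, ih, Matrix.mul_sum]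
    simp only [Matrix.mul_smul, swap_mul_matrixUnit hb ht hT hij]
    rw [← (isHecke_seminormal hb ht).mul_of_lt i j w hij h]
    simp only [Matrix.mul_apply, Finset.sum_smul, Finset.smul_sum, smul_smul]
    rw [Finset.sum_comm]
    exact Finset.sum_congr rfl fun w _ => Finset.sum_congr rfl fun c _ => by rw [mul_comm]

theorem matrixUnit_mul_eq_sum (hT : IsHecke q T) (a b : SYT t) (c d : SYT t') :
    matrixUnit hb ht T a b * matrixUnit hb ht' T c d =
      ∑ e, ((schurElement hb ht)⁻¹ * coeffPairing hb ht' ht e c b a) •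
        matrixUnit hb ht' T e d := by
  conv_lhs => rw [matrixUnit]
  simp only [Matrix.sum_mul, Matrix.smul_mul, mul_matrixUnit hb ht' hT, Finset.smul_sum, smul_smul,
    coeffPairing, Finset.mul_sum, Finset.sum_smul]
  rw [Finset.sum_comm]
  exact Finset.sum_congr rfl fun w _ => Finset.sum_congr rfl fun c _ => by congr 1; ring

theorem matrixUnit_mul_self (hγ : schurElement hb ht ≠ 0) (hT : IsHecke q T) (a b c d : SYT t) :
    matrixUnit hb ht T a b * matrixUnit hb ht T c d =
      if b = c then matrixUnit hb ht T a d else 0 := by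
  rw [matrixUnit_mul_eq_sum hb ht ht hT, Finset.sum_eq_single a]
  · rw [coeffPairing_self]
    by_cases h : b = c
    · simp [h, hγ]
    · simp [h, Ne.symm h]
  · intro e _ he
    rw [coeffPairing_self]; simp [he]
  · simp

theorem trace_matrixUnit (hγ : schurElement hb ht ≠ 0) (hT : IsHecke q T) (a b : SYT t) :
    (matrixUnit hb ht T a b).trace =
      if a = b then (matrixUnit hb ht T (rowSYT ht) (rowSYT ht)).trace else 0 := by
  have h1 := matrixUnit_mul_self hb ht hγ hT a (rowSYT ht) (rowSYT ht) b
  have h2 := matrixUnit_mul_self hb ht hγ hT (rowSYT ht) b a (rowSYT ht)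
  rw [if_pos rfl] at h1
  rw [← h1, Matrix.trace_mul_comm, h2]
  by_cases h : a = b
  · simp [h]
  · simp [h, Ne.symm h]

end

variable {Λ : Type*} [Fintype Λ] {t : Λ → Fin n → ℕ × ℕ} (ht : ∀ α, IsShape (t α))

/-- Orthogonality says that the Fourier matrix `M` has the left inverse `N`. Since the squares of
the degrees add up to n!, both are square up to reindexing, so `N` is also a right inverse, which is
the assertion. -/
theorem fourier_inversion (hinj : Function.Injective t) (hγ : ∀ α, schurElement hb (ht α) ≠ 0)
    (hcard : ∑ α, Fintype.card (SYT (t α)) ^ 2 = n.factorial) (w w' : Perm (Fin n)) :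
    ∑ α, ∑ a, ∑ b, seminormal hb (ht α) w a b * ((schurElement hb (ht α))⁻¹ *
      ((q ^ length w')⁻¹ * seminormal hb (ht α) w'⁻¹ b a)) = if w = w' then 1 else 0 := by
  classical
  obtain ⟨M, hM⟩ : ∃ M : Matrix (Perm (Fin n)) (Σ α, SYT (t α) × SYT (t α)) K,
      ∀ w x, M w x = seminormal hb (ht x.1) w x.2.1 x.2.2 := ⟨fun w x => _, fun _ _ => rfl⟩
  obtain ⟨N, hN⟩ : ∃ N : Matrix (Σ α, SYT (t α) × SYT (t α)) (Perm (Fin n)) K,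
      ∀ x w, N x w = (schurElement hb (ht x.1))⁻¹ *
        ((q ^ length w)⁻¹ * seminormal hb (ht x.1) w⁻¹ x.2.2 x.2.1) :=
    ⟨fun x w => _, fun _ _ => rfl⟩
  have hNM : N * M = 1 := by
    ext ⟨α, a, b⟩ ⟨β, c, d⟩
    have e : (N * M) ⟨α, a, b⟩ ⟨β, c, d⟩ = (schurElement hb (ht α))⁻¹ *
        coeffPairing hb (ht β) (ht α) c d b a := by
      rw [Matrix.mul_apply, coeffPairing, Finset.mul_sum]
      exact Finset.sum_congr rfl fun w _ => by rw [hM, hN]; ring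
    rw [e]
    by_cases h : α = β
    · subst h
      rw [coeffPairing_self, Matrix.one_apply]
      have := hγ α
      by_cases h2 : c = a ∧ d = b
      · obtain ⟨rfl, rfl⟩ := h2; simp [this]
      · rw [if_neg h2, mul_zero, if_neg]
        intro h3
        simp only [Sigma.mk.injEq, heq_eq_eq, true_and, Prod.mk.injEq] at h3
        exact h2 ⟨h3.1.symm, h3.2.symm⟩
    · rw [coeffPairing_of_ne _ _ _ fun h2 => h (hinj h2).symm, mul_zero, Matrix.one_apply_ne]
      intro h3
      exact h (congrArg Sigma.fst h3)
  have hc : Fintype.card (Σ α, SYT (t α) × SYT (t α)) = Fintype.card (Perm (Fin n)) := by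
    rw [Fintype.card_perm, Fintype.card_fin, ← hcard, Fintype.card_sigma]
    exact Finset.sum_congr rfl fun α _ => by rw [Fintype.card_prod, sq]
  have hMN := (Matrix.mul_eq_one_comm_of_card_eq _ _ _ hc).1 hNM
  have h1 := congrFun (congrFun hMN w) w'
  rw [Matrix.one_apply, Matrix.mul_apply, Fintype.sum_sigma] at h1
  rw [← h1]
  refine Finset.sum_congr rfl fun α _ => ?_
  rw [Fintype.sum_prod_type]
  simp only [hM, hN]

theorem eq_sum_matrixUnit (hinj : Function.Injective t) (hγ : ∀ α, schurElement hb (ht α) ≠ 0)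
    (hcard : ∑ α, Fintype.card (SYT (t α)) ^ 2 = n.factorial)
    (T : Perm (Fin n) → Matrix κ κ K) (w : Perm (Fin n)) :
    T w = ∑ α, ∑ a, ∑ b, seminormal hb (ht α) w a b • matrixUnit hb (ht α) T a b := by
  have h1 : T w = ∑ w', (if w = w' then (1 : K) else 0) • T w' := by simp
  conv_lhs => rw [h1]
  simp only [← fourier_inversion hb ht hinj hγ hcard, matrixUnit, Finset.smul_sum, smul_smul,
    Finset.sum_smul]
  rw [Finset.sum_comm]
  refine Finset.sum_congr rfl fun α _ => ?_
  rw [Finset.sum_comm]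
  refine Finset.sum_congr rfl fun a _ => ?_
  rw [Finset.sum_comm]

/-- A representation of the Hecke algebra is a sum of seminormal representations. -/
theorem exists_multiplicity [CharZero K] [DecidableEq κ] (hinj : Function.Injective t)
    (hγ : ∀ α, schurElement hb (ht α) ≠ 0)
    (hcard : ∑ α, Fintype.card (SYT (t α)) ^ 2 = n.factorial)
    {T : Perm (Fin n) → Matrix κ κ K} (hT : IsHecke q T) :
    ∃ m : Λ → ℕ, (∀ w, (T w).trace = ∑ α, m α * (seminormal hb (ht α) w).trace) ∧
      ∀ α, m α = 0 → ∀ c : Perm (Fin n) → K,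
        (∀ β, β ≠ α → ∑ w, c w • seminormal hb (ht β) w = 0) → ∑ w, c w • T w = 0 := by
  have hidem : ∀ α, matrixUnit hb (ht α) T (rowSYT (ht α)) (rowSYT (ht α)) *
      matrixUnit hb (ht α) T (rowSYT (ht α)) (rowSYT (ht α)) =
      matrixUnit hb (ht α) T (rowSYT (ht α)) (rowSYT (ht α)) := fun α => by
    rw [matrixUnit_mul_self hb (ht α) (hγ α) hT, if_pos rfl]
  -- The multiplicity is the rank of the idempotent E_{rr}, where r is the superstandard tableau.
  choose m hm hm0 using fun α => exists_nat_trace_eq (hidem α)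
  have htr : ∀ α a b, (matrixUnit hb (ht α) T a b).trace = if a = b then (m α : K) else 0 :=
    fun α a b => by rw [trace_matrixUnit hb (ht α) (hγ α) hT, hm]
  refine ⟨m, fun w => ?_, fun α hα c hc => ?_⟩
  · conv_lhs => rw [eq_sum_matrixUnit hb ht hinj hγ hcard T w]
    simp only [Matrix.trace_sum, Matrix.trace_smul, htr]
    refine Finset.sum_congr rfl fun α _ => ?_
    simp only [smul_eq_mul, mul_ite, mul_zero, Finset.sum_ite_eq, Finset.mem_univ, if_true,
      Matrix.trace, Matrix.diag_apply, Finset.mul_sum]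
    exact Finset.sum_congr rfl fun a _ => mul_comm _ _
  -- Multiplicity zero kills E_{rr}, hence also E_{ab} = E_{ar} E_{rr} E_{rb}.
  · have hz : ∀ a b, matrixUnit hb (ht α) T a b = 0 := by
      intro a b
      have h1 := matrixUnit_mul_self hb (ht α) (hγ α) hT a (rowSYT (ht α)) (rowSYT (ht α)) b
      have h2 := matrixUnit_mul_self hb (ht α) (hγ α) hT (rowSYT (ht α)) (rowSYT (ht α))
        (rowSYT (ht α)) b
      rw [if_pos rfl] at h1 h2
      rw [← h1, ← h2, hm0 α hα, Matrix.zero_mul, Matrix.mul_zero]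
    have e : ∑ w, c w • T w = ∑ β, ∑ a, ∑ b,
        (∑ w, c w • seminormal hb (ht β) w) a b • matrixUnit hb (ht β) T a b := by
      conv_lhs => enter [2, w]; rw [eq_sum_matrixUnit hb ht hinj hγ hcard T w]
      simp only [Matrix.sum_apply, Matrix.smul_apply, Finset.smul_sum, smul_smul, Finset.sum_smul,
        smul_eq_mul]
      rw [Finset.sum_comm]
      refine Finset.sum_congr rfl fun α _ => ?_
      rw [Finset.sum_comm]
      refine Finset.sum_congr rfl fun a _ => ?_
      rw [Finset.sum_comm]
    rw [e]
    refine Finset.sum_eq_zero fun β _ => ?_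
    by_cases h : β = α
    · subst h
      simp [hz]
    · simp [hc β h]

end MatrixUnits

/-! ### Inversions inside the blocks of a labelling -/

section Blocks

variable {n : ℕ}

/-- The number of inversions of `w` at pairs of positions with the same label. -/
def labelInv (f : Fin n → ℕ) (w : Perm (Fin n)) : ℕ :=
  (Finset.univ.filter fun p : Fin n × Fin n => (p.1 < p.2 ∧ f p.1 = f p.2) ∧ w p.2 < w p.1).card

theorem label_swap {f : Fin n → ℕ} {i j : Fin n} (h : f i = f j) (k : Fin n) :
    f (swap i j k) = f k := by
  rw [Equiv.swap_apply_def]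
  split_ifs with h1 h2
  · rw [h1, h]
  · rw [h2, h]
  · rfl

theorem perm_apply_inv (w : Perm (Fin n)) (k : Fin n) : w (w⁻¹ k) = k := w.apply_symm_apply k

theorem perm_inv_apply (w : Perm (Fin n)) (k : Fin n) : w⁻¹ (w k) = k := w.symm_apply_apply k

theorem swap_lt_swap_of_lt {i j k l : Fin n} (hij : (i : ℕ) + 1 = j) (hkl : k < l)
    (h : ¬ (k = i ∧ l = j)) : swap i j k < swap i j l :=
  lt_of_le_of_ne (not_lt.1 fun hh => h ((swap_lt_swap_iff hij hkl).1 hh))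
    fun e => hkl.ne ((swap i j).injective e)

theorem labelInv_mul_swap {f : Fin n → ℕ} {i j : Fin n} (hij : (i : ℕ) + 1 = j) (hf : f i = f j)
    (w : Perm (Fin n)) (h : w i < w j) :
    labelInv f (w * swap i j) = labelInv f w + 1 := by
  have hlt : i < j := lt_of_adj hij
  unfold labelInv
  rw [← Finset.card_map (s := Finset.univ.filter fun p : Fin n × Fin n =>
      (p.1 < p.2 ∧ f p.1 = f p.2) ∧ w p.2 < w p.1)
      (Equiv.prodCongr (swap i j) (swap i j)).toEmbedding,
    ← Finset.card_insert_of_notMem (a := (i, j))]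
  · congr 1
    ext ⟨k, l⟩
    simp only [Finset.mem_insert, Finset.mem_map, Finset.mem_filter, Finset.mem_univ, true_and,
      Equiv.toEmbedding_apply, Equiv.prodCongr_apply, Prod.exists, Prod.map_apply, Prod.mk.injEq]
    simp only [Equiv.Perm.mul_apply]
    constructor
    · rintro ⟨⟨hkl, hfkl⟩, hw⟩
      by_cases he : k = i ∧ l = j
      · exact Or.inl he
      · exact Or.inr ⟨swap i j k, swap i j l, ⟨⟨swap_lt_swap_of_lt hij hkl he,
          by rw [label_swap hf, label_swap hf, hfkl]⟩, hw⟩, by simp, by simp⟩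
    · rintro (⟨rfl, rfl⟩ | ⟨a, b, ⟨⟨hab, hfab⟩, hw⟩, rfl, rfl⟩)
      · simpa using ⟨⟨hlt, hf⟩, h⟩
      · simp only [Equiv.swap_apply_self, label_swap hf]
        refine ⟨⟨swap_lt_swap_of_lt hij hab ?_, hfab⟩, hw⟩
        rintro ⟨rfl, rfl⟩
        exact absurd h hw.not_gt
  · simp only [Finset.mem_map, Finset.mem_filter, Finset.mem_univ, true_and, not_exists, not_and]
    rintro ⟨k, l⟩ ⟨⟨hkl, -⟩, hw⟩ he
    simp only [Equiv.toEmbedding_apply, Equiv.prodCongr_apply, Prod.map_apply,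
      Prod.mk.injEq] at he
    have h1 : k = j := by rw [← Equiv.swap_apply_self i j k, he.1, Equiv.swap_apply_left]
    have h2 : l = i := by rw [← Equiv.swap_apply_self i j l, he.2, Equiv.swap_apply_right]
    subst h1 h2
    exact absurd hkl hlt.not_gt

/-- Exchanging two adjacent values changes the order only at the two positions which carry them, and
these have different labels. -/
theorem labelInv_swap_mul {f : Fin n → ℕ} {i j : Fin n} (hij : (i : ℕ) + 1 = j)
    (w : Perm (Fin n)) (h : f (w⁻¹ i) ≠ f (w⁻¹ j)) :
    labelInv f (swap i j * w) = labelInv f w := by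
  unfold labelInv
  congr 1
  refine Finset.filter_congr fun p _ => and_congr_right fun hp => ?_
  have hne : w p.1 ≠ w p.2 := fun e => hp.1.ne (w.injective e)
  have h1 : ¬ (w p.1 = i ∧ w p.2 = j) := by
    rintro ⟨rfl, rfl⟩; exact h (by simpa using hp.2)
  have h2 : ¬ (w p.2 = i ∧ w p.1 = j) := by
    rintro ⟨rfl, rfl⟩; exact h (by simpa using hp.2.symm)
  simp only [Equiv.Perm.mul_apply]
  rcases lt_or_gt_of_ne hne with h3 | h3
  · exact iff_of_false (swap_lt_swap_of_lt hij h3 h1).not_gt h3.not_gt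
  · exact iff_of_true (swap_lt_swap_of_lt hij h3 h2) h3

theorem lt_of_forall_adj_lt {f : Fin n → ℕ} (hf : Monotone f) (w : Perm (Fin n))
    (h : ∀ i j : Fin n, (i : ℕ) + 1 = j → f i = f j → w i < w j) {i j : Fin n} (hij : i < j)
    (hfij : f i = f j) : w i < w j := by
  obtain ⟨i, hi⟩ := i
  obtain ⟨j, hj⟩ := j
  rw [Fin.mk_lt_mk] at hij
  induction j, hij using Nat.le_induction with
  | base => exact h _ _ rfl hfij
  | succ k hk ih =>
    have hk' : k < n := by omega
    have h1 : f ⟨i, hi⟩ ≤ f ⟨k, hk'⟩ := hf (by rw [Fin.mk_le_mk]; omega)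
    have h2 : f ⟨k, hk'⟩ ≤ f ⟨k + 1, hj⟩ := hf (by rw [Fin.mk_le_mk]; omega)
    exact (ih hk' (by omega)).trans (h _ _ rfl (by omega))

end Blocks

/-! ### Row and column groups, transversal permutations and semi-invariant functions -/

section ColumnReading

variable {n : ℕ} {t : Fin n → ℕ × ℕ}

/-- `d` lists the cells column by column. -/
def IsColReading (t : Fin n → ℕ × ℕ) (d : Perm (Fin n)) : Prop :=
  ∀ i j, i < j → (t (d i)).2 < (t (d j)).2 ∨
    ((t (d i)).2 = (t (d j)).2 ∧ (t (d i)).1 < (t (d j)).1)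

theorem exists_isColReading (ht : IsShape t) : ∃ d, IsColReading t d := by
  refine ⟨Tuple.sort fun k => toLex ((t k).2, (t k).1), fun i j hij => ?_⟩
  have hm := Tuple.monotone_sort (fun k => toLex ((t k).2, (t k).1)) hij.le
  simp only [Function.comp_apply, Prod.Lex.toLex_le_toLex] at hm
  rcases hm with h | ⟨h1, h2⟩
  · exact Or.inl h
  · refine Or.inr ⟨h1, lt_of_le_of_ne h2 fun e => hij.ne ?_⟩
    exact (Equiv.injective _) (ht.inj (Prod.ext e h1))

theorem IsShape.row_monotone (ht : IsShape t) : Monotone fun k => (t k).1 := by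
  intro i j hij
  rcases hij.lt_or_eq with h | rfl
  · have := ht.lex i j h
    simp only
    omega
  · exact le_rfl

theorem IsShape.lt_of_row_lt (ht : IsShape t) {a b : Fin n} (h : (t a).1 < (t b).1) : a < b :=
  ht.lt_of_lex (Or.inl h)

namespace IsColReading

variable {d : Perm (Fin n)}

theorem monotone (hd : IsColReading t d) : Monotone fun k => (t (d k)).2 := by
  intro i j hij
  rcases hij.lt_or_eq with h | rfl
  · have := hd i j h
    simp only
    omega
  · exact le_rfl

theorem lt_of_lex (hd : IsColReading t d) {i j : Fin n} (h : (t (d i)).2 < (t (d j)).2 ∨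
    ((t (d i)).2 = (t (d j)).2 ∧ (t (d i)).1 < (t (d j)).1)) : i < j := by
  by_contra hc
  rcases (not_lt.1 hc).lt_or_eq with h1 | rfl
  · have := hd j i h1; omega
  · omega

theorem std (hd : IsColReading t d) : Std t d := by
  intro j k h
  by_contra hc
  have := hd k j (not_le.1 hc)
  have h2 := Prod.le_def.1 h
  omega

theorem inv_lt_inv (hd : IsColReading t d) (ht : IsShape t) {a b : Fin n} (hab : a < b)
    (h : (t a).1 = (t b).1) : d⁻¹ a < d⁻¹ b := by
  refine hd.lt_of_lex (Or.inl ?_)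
  have := ht.lex a b hab
  simp only [perm_apply_inv]
  omega

theorem lt_of_col_eq (hd : IsColReading t d) (ht : IsShape t) {i j : Fin n} (hij : i < j)
    (h : (t (d i)).2 = (t (d j)).2) : d i < d j := by
  refine ht.lt_of_lex (Or.inl ?_)
  have := hd i j hij
  omega

theorem labelInv_eq_zero (hd : IsColReading t d) (ht : IsShape t) :
    labelInv (fun k => (t k).1) d⁻¹ = 0 ∧ labelInv (fun k => (t (d k)).2) d = 0 := by
  unfold labelInv
  rw [Finset.card_eq_zero, Finset.card_eq_zero, Finset.filter_eq_empty_iff,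
    Finset.filter_eq_empty_iff]
  exact ⟨fun p _ h => absurd h.2 (hd.inv_lt_inv ht h.1.1 h.1.2).not_gt,
    fun p _ h => absurd h.2 (hd.lt_of_col_eq ht h.1.1 h.1.2).not_gt⟩

end IsColReading

/-- The row labels of the values of `w` are distinct on each column block. -/
def IsTransversal (t : Fin n → ℕ × ℕ) (d w : Perm (Fin n)) : Prop :=
  ∀ i j, i ≠ j → (t (d i)).2 = (t (d j)).2 → (t (w i)).1 ≠ (t (w j)).1

variable {d : Perm (Fin n)}

theorem IsTransversal.swap_mul {w : Perm (Fin n)} (hw : IsTransversal t d w) {i j : Fin n}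
    (h : (t i).1 = (t j).1) : IsTransversal t d (swap i j * w) := by
  intro k l hkl hc
  have := hw k l hkl hc
  simpa only [Equiv.Perm.mul_apply, label_swap (f := fun k => (t k).1) h] using this

theorem IsTransversal.mul_swap {w : Perm (Fin n)} (hw : IsTransversal t d w) {i j : Fin n}
    (h : (t (d i)).2 = (t (d j)).2) : IsTransversal t d (w * swap i j) := by
  intro k l hkl hc
  refine hw _ _ (fun e => hkl ((swap i j).injective e)) ?_
  rw [label_swap (f := fun k => (t (d k)).2) h, label_swap (f := fun k => (t (d k)).2) h, hc]

/-- Down a column the rows hit by `w` increase strictly, so they are at least 0, 1, 2, …, the rows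
hit by `d`. The totals agree, hence so do the rows, and monotonicity on each row then fixes `w`. -/
theorem IsTransversal.eq_of_distinguished (ht : IsShape t) (hd : IsColReading t d)
    {w : Perm (Fin n)} (hw : IsTransversal t d w)
    (hrow : ∀ i j : Fin n, i < j → (t i).1 = (t j).1 → w⁻¹ i < w⁻¹ j)
    (hcol : ∀ i j : Fin n, i < j → (t (d i)).2 = (t (d j)).2 → w i < w j) : w = d := by
  have hle : ∀ k, (t (d k)).1 ≤ (t (w k)).1 := by
    intro k
    induction hm : (t (d k)).1 generalizing k with
    | zero => exact Nat.zero_le _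
    | succ m ih =>
      obtain ⟨l, hl⟩ := ht.lower (d k) (m, (t (d k)).2) (Prod.le_def.2 ⟨by simp [hm], le_rfl⟩)
      obtain ⟨l, rfl⟩ := d.surjective l
      have hlk : l < k := hd.lt_of_lex (Or.inr ⟨by rw [hl], by rw [hl, hm]; simp⟩)
      have hcl : (t (d l)).2 = (t (d k)).2 := by rw [hl]
      have h1 := ih l (by rw [hl])
      have h2 := ht.row_monotone (hcol l k hlk hcl).le
      have h3 := hw l k hlk.ne hcl
      simp only at h2
      omega
  -- Both sums run over all cells, so the termwise inequality becomes an equality.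
  have hsum : ∑ k, (t (d k)).1 = ∑ k, (t (w k)).1 := by
    rw [Equiv.sum_comp d fun k => (t k).1, Equiv.sum_comp w fun k => (t k).1]
  have heq := (Finset.sum_eq_sum_iff_of_le fun k _ => hle k).1 hsum
  have hg : ∀ a, (t ((w * d⁻¹) a)).1 = (t a).1 := fun a => by
    have := heq (d⁻¹ a) (Finset.mem_univ _)
    simpa using this.symm
  refine mul_inv_eq_one.1 (eq_one_of_forall_adj_lt _ fun a b hab => ?_)
  have hlt := lt_of_adj hab
  have hm := ht.row_monotone hlt.le
  simp only at hm
  rcases hm.lt_or_eq with h | h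
  · exact ht.lt_of_row_lt (by rw [hg, hg]; exact h)
  · rcases lt_or_gt_of_adj hab (w * d⁻¹) with h1 | h1
    · exact h1
    · have h2 := hrow _ _ h1 (by rw [hg, hg, h])
      simp only [Equiv.Perm.mul_apply, perm_inv_apply] at h2
      exact absurd h2 (hd.inv_lt_inv ht hlt h).not_gt

section Semiinvariant

variable {K M : Type*} [Field K] [AddCommGroup M] [Module K M] {F : Perm (Fin n) → M} {c₁ c₂ : K}

/-- `F` transforms by `c₁` under the row subgroup on the left and by `c₂` under the column
subgroup on the right, whenever the length grows. -/
structure IsSemiinvariant (t : Fin n → ℕ × ℕ) (d : Perm (Fin n)) (c₁ c₂ : K)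
    (F : Perm (Fin n) → M) : Prop where
  row : ∀ (i j : Fin n) (w : Perm (Fin n)), (i : ℕ) + 1 = j → (t i).1 = (t j).1 →
    w⁻¹ i < w⁻¹ j → F (swap i j * w) = c₁ • F w
  col : ∀ (i j : Fin n) (w : Perm (Fin n)), (i : ℕ) + 1 = j → (t (d i)).2 = (t (d j)).2 →
    w i < w j → F (w * swap i j) = c₂ • F w

/-- Either a row descent can be stripped on the left, or a column descent on the right, or `w` is
the shortest element of its double coset. -/
theorem IsSemiinvariant.descent_cases (ht : IsShape t) (hd : IsColReading t d)
    (hF : IsSemiinvariant t d c₁ c₂ F) (w : Perm (Fin n)) :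
    (∃ i j : Fin n, (i : ℕ) + 1 = j ∧ (t i).1 = (t j).1 ∧ w⁻¹ j < w⁻¹ i ∧
      F w = c₁ • F (swap i j * w)) ∨
    (∃ i j : Fin n, (i : ℕ) + 1 = j ∧ (t (d i)).2 = (t (d j)).2 ∧ w j < w i ∧
      F w = c₂ • F (w * swap i j)) ∨
    ((∀ i j : Fin n, i < j → (t i).1 = (t j).1 → w⁻¹ i < w⁻¹ j) ∧
      ∀ i j : Fin n, i < j → (t (d i)).2 = (t (d j)).2 → w i < w j) := by
  by_cases h1 : ∃ i j : Fin n, (i : ℕ) + 1 = j ∧ (t i).1 = (t j).1 ∧ w⁻¹ j < w⁻¹ i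
  · obtain ⟨i, j, hij, hr, hlt⟩ := h1
    refine Or.inl ⟨i, j, hij, hr, hlt, ?_⟩
    rw [← hF.row i j (swap i j * w) hij hr (by simpa using hlt)]
    simp
  by_cases h2 : ∃ i j : Fin n, (i : ℕ) + 1 = j ∧ (t (d i)).2 = (t (d j)).2 ∧ w j < w i
  · obtain ⟨i, j, hij, hr, hlt⟩ := h2
    refine Or.inr (Or.inl ⟨i, j, hij, hr, hlt, ?_⟩)
    rw [← hF.col i j (w * swap i j) hij hr (by simpa using hlt)]
    simp [mul_assoc]
  refine Or.inr (Or.inr ⟨fun i j hij h => ?_, fun i j hij h => ?_⟩)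
  · refine lt_of_forall_adj_lt ht.row_monotone w⁻¹ (fun k l hkl hr => ?_) hij h
    exact (lt_or_gt_of_adj hkl w⁻¹).resolve_right fun hh => h1 ⟨k, l, hkl, hr, hh⟩
  · refine lt_of_forall_adj_lt hd.monotone w (fun k l hkl hr => ?_) hij h
    exact (lt_or_gt_of_adj hkl w).resolve_right fun hh => h2 ⟨k, l, hkl, hr, hh⟩

/-- Stripping descents preserves failure of transversality and reduces to a shortest double coset
element. There a collision can be chosen with adjacent positions and adjacent values, so that s w =
w s' with s in the row and s' in the column group. Then c₁ F(w) = c₂ F(w) forces F(w) = 0. -/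
theorem IsSemiinvariant.eq_zero (ht : IsShape t) (hd : IsColReading t d) (hc : c₁ ≠ c₂)
    (hF : IsSemiinvariant t d c₁ c₂ F) {w : Perm (Fin n)} (hw : ¬ IsTransversal t d w) :
    F w = 0 := by
  induction hk : length w using Nat.strong_induction_on generalizing w with
  | _ N ih =>
    rcases hF.descent_cases ht hd w with ⟨i, j, hij, hr, hlt, e⟩ | ⟨i, j, hij, hr, hlt, e⟩ | ⟨h1, h2⟩
    · rw [e, ih (length (swap i j * w)) (by have := length_swap_mul_of_gt hij w hlt; omega) _ rfl,
        smul_zero]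
      intro h
      exact hw (by simpa using h.swap_mul hr)
    · rw [e, ih (length (w * swap i j)) (by have := length_mul_swap_of_gt hij w hlt; omega) _ rfl,
        smul_zero]
      intro h
      exact hw (by simpa [mul_assoc] using h.mul_swap hr)
    · have : ∃ x y : Fin n, x < y ∧ (t (d x)).2 = (t (d y)).2 ∧ (t (w x)).1 = (t (w y)).1 := by
        unfold IsTransversal at hw
        push Not at hw
        obtain ⟨x, y, hxy, e1, e2⟩ := hw
        rcases lt_or_gt_of_ne hxy with h | h
        · exact ⟨x, y, h, e1, e2⟩
        · exact ⟨y, x, h, e1.symm, e2.symm⟩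
      obtain ⟨x, y, hxy, e1, e2⟩ := this
      have hx : (x : ℕ) + 1 < n := by have := y.2; have : (x : ℕ) < y := hxy; omega
      -- By monotonicity on the block, the neighbour of `x` already collides with `x`.
      obtain ⟨x', hx'⟩ : ∃ x' : Fin n, (x : ℕ) + 1 = x' := ⟨⟨x + 1, hx⟩, rfl⟩
      have hxx := lt_of_adj hx'
      have hx'y : x' ≤ y := by rw [Fin.le_def]; have : (x : ℕ) < y := hxy; omega
      have m1 := hd.monotone hxx.le
      have m2 := hd.monotone hx'y
      simp only at m1 m2
      have c1 : (t (d x)).2 = (t (d x')).2 := by omega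
      have l1 := h2 x x' hxx c1
      have l2 : w x' ≤ w y := by
        rcases hx'y.lt_or_eq with h | h
        · exact (h2 x' y h (by omega)).le
        · rw [h]
      have m3 := ht.row_monotone l1.le
      have m4 := ht.row_monotone l2
      simp only at m3 m4
      have ha : ((w x : Fin n) : ℕ) + 1 < n := by
        have := (w x').2; have : (w x : ℕ) < w x' := l1; omega
      obtain ⟨b, hb⟩ : ∃ b : Fin n, ((w x : Fin n) : ℕ) + 1 = b := ⟨⟨w x + 1, ha⟩, rfl⟩
      have hab := lt_of_adj hb
      have hbx : b ≤ w x' := by rw [Fin.le_def]; have : (w x : ℕ) < w x' := l1; omega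
      have m5 := ht.row_monotone hab.le
      have m6 := ht.row_monotone hbx
      simp only at m5 m6
      -- A value strictly between `w x` and `w x'` would be taken at a position strictly between two
      -- adjacent positions.
      have hbw : b = w x' := by
        by_contra hne
        have k1 := h1 _ _ hab (by omega)
        have k2 := h1 _ _ (lt_of_le_of_ne hbx hne) (by omega)
        rw [perm_inv_apply] at k1 k2
        rw [Fin.lt_def] at k1 k2
        omega
      have f1 := hF.row (w x) b w hb (by omega) (by rw [hbw]; simpa using hxx)
      have f2 := hF.col x x' w hx' c1 l1
      rw [hbw, ← Equiv.mul_swap_eq_swap_mul, f2] at f1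
      have : (c₂ - c₁) • F w = 0 := by rw [sub_smul, f1, sub_self]
      exact (smul_eq_zero.1 this).resolve_left (sub_ne_zero.2 hc.symm)

/-- Each stripped descent gives one factor and lowers the matching inversion count by one.
Transversality ensures that the other count is unchanged: two positions with values in one row lie
in different columns, and conversely. -/
theorem IsSemiinvariant.eq_smul (ht : IsShape t) (hd : IsColReading t d)
    (hF : IsSemiinvariant t d c₁ c₂ F) {w : Perm (Fin n)} (hw : IsTransversal t d w) :
    F w = (c₁ ^ labelInv (fun k => (t k).1) w⁻¹ *
      c₂ ^ labelInv (fun k => (t (d k)).2) w) • F d := by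
  induction hk : length w using Nat.strong_induction_on generalizing w with
  | _ N ih =>
    rcases hF.descent_cases ht hd w with ⟨i, j, hij, hr, hlt, e⟩ | ⟨i, j, hij, hr, hlt, e⟩ | ⟨h1, h2⟩
    · have hw' := hw.swap_mul hr
      rw [e, ih (length (swap i j * w)) (by have := length_swap_mul_of_gt hij w hlt; omega) hw' rfl,
        smul_smul]
      have a1 := labelInv_mul_swap (f := fun k => (t k).1) hij hr (w⁻¹ * swap i j)
        (by simpa using hlt)
      rw [mul_assoc, Equiv.swap_mul_self, mul_one] at a1
      have a2 : labelInv (fun k => (t (d k)).2) (swap i j * w) =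
          labelInv (fun k => (t (d k)).2) w := by
        refine labelInv_swap_mul hij w fun h => ?_
        exact hw _ _ (fun e => hlt.ne e.symm) h (by simpa using hr)
      rw [a2, a1, mul_inv_rev, Equiv.swap_inv, pow_succ]
      congr 1
      ring
    · have hw' := hw.mul_swap hr
      rw [e, ih (length (w * swap i j)) (by have := length_mul_swap_of_gt hij w hlt; omega) hw' rfl,
        smul_smul]
      have a1 := labelInv_mul_swap (f := fun k => (t (d k)).2) hij hr (w * swap i j)
        (by simpa using hlt)
      rw [mul_assoc, Equiv.swap_mul_self, mul_one] at a1
      have a2 : labelInv (fun k => (t k).1) (w * swap i j)⁻¹ =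
          labelInv (fun k => (t k).1) w⁻¹ := by
        rw [mul_inv_rev, Equiv.swap_inv]
        refine labelInv_swap_mul hij w⁻¹ fun h => ?_
        rw [inv_inv] at h
        exact hw i j (lt_of_adj hij).ne hr h
      rw [a2, a1, pow_succ]
      congr 1
      ring
    · rw [hw.eq_of_distinguished ht hd h1 h2, (hd.labelInv_eq_zero ht).1,
        (hd.labelInv_eq_zero ht).2, pow_zero, pow_zero, one_mul, one_smul]

end Semiinvariant

/-- The row index of a cell is the number of cells above it in its column. -/
theorem card_col_pairs (ht : IsShape t) (hd : IsColReading t d) :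
    (Finset.univ.filter fun p : Fin n × Fin n =>
      p.1 < p.2 ∧ (t (d p.1)).2 = (t (d p.2)).2).card = ∑ k, (t k).1 := by
  have h1 : ∀ l, (Finset.univ.filter fun k : Fin n =>
      k < l ∧ (t (d k)).2 = (t (d l)).2).card = (t (d l)).1 := by
    intro l
    rw [← Finset.card_range (t (d l)).1]
    refine Finset.card_bij (fun k _ => (t (d k)).1) ?_ ?_ ?_
    · intro k hk
      rw [Finset.mem_filter] at hk
      rw [Finset.mem_range]
      have := hd k l hk.2.1
      omega
    · intro a ha b hb e
      rw [Finset.mem_filter] at ha hb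
      exact d.injective (ht.inj (Prod.ext e (ha.2.2.trans hb.2.2.symm)))
    · intro m hm
      rw [Finset.mem_range] at hm
      obtain ⟨k, hk⟩ := ht.lower (d l) (m, (t (d l)).2) (Prod.le_def.2 ⟨hm.le, le_rfl⟩)
      obtain ⟨k, rfl⟩ := d.surjective k
      refine ⟨k, ?_, by rw [hk]⟩
      rw [Finset.mem_filter]
      exact ⟨Finset.mem_univ _, hd.lt_of_lex (Or.inr ⟨by rw [hk], by rw [hk]; exact hm⟩), by rw [hk]⟩
  rw [← Equiv.sum_comp d fun k => (t k).1, ← Finset.sum_congr rfl fun l _ => h1 l]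
  simp only [Finset.card_filter]
  rw [Fintype.sum_prod_type, Finset.sum_comm]

theorem labelInv_col_le (ht : IsShape t) (hd : IsColReading t d) (w : Perm (Fin n)) :
    labelInv (fun k => (t (d k)).2) w ≤ ∑ k, (t k).1 := by
  rw [← card_col_pairs ht hd]
  exact Finset.card_le_card fun p hp => by
    rw [Finset.mem_filter] at hp ⊢
    exact ⟨hp.1, hp.2.1⟩

/-- Reading the columns from bottom to top yields a transversal permutation with the maximal
number of column inversions. -/
theorem exists_transversal_maximal (ht : IsShape t) (hd : IsColReading t d) :
    ∃ w, IsTransversal t d w ∧ labelInv (fun k => (t k).1) w⁻¹ = 0 ∧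
      labelInv (fun k => (t (d k)).2) w = ∑ k, (t k).1 := by
  set w := Tuple.sort fun k => toLex ((t k).2, OrderDual.toDual (t k).1) with hw
  have hm : ∀ i j, i < j → (t (w i)).2 < (t (w j)).2 ∨
      ((t (w i)).2 = (t (w j)).2 ∧ (t (w j)).1 < (t (w i)).1) := by
    intro i j hij
    have hm := Tuple.monotone_sort (fun k => toLex ((t k).2, OrderDual.toDual (t k).1)) hij.le
    simp only [Function.comp_apply, Prod.Lex.toLex_le_toLex, ← hw, OrderDual.toDual_le_toDual] at hm
    rcases hm with h | ⟨h1, h2⟩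
    · exact Or.inl h
    · refine Or.inr ⟨h1, lt_of_le_of_ne h2 fun e => hij.ne ?_⟩
      exact w.injective (ht.inj (Prod.ext e.symm h1))
  have hcol : ∀ k, (t (w k)).2 = (t (d k)).2 := by
    -- Both readings sort the cells by column, so they run through the same sequence of column
    -- indices.
    have m1 : Monotone ((fun k => (t k).2) ∘ w) := by
      intro i j hij
      rcases hij.lt_or_eq with h | rfl
      · have := hm i j h
        simp only [Function.comp_apply]
        omega
      · exact le_rfl
    have e1 := Tuple.comp_sort_eq_comp_iff_monotone.2 m1
    have e2 := Tuple.comp_sort_eq_comp_iff_monotone (f := fun k => (t k).2) (σ := d).2 hd.monotone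
    intro k
    exact (congrFun e1 k).trans (congrFun e2 k).symm
  refine ⟨w, fun i j hij hc hr => hij ?_, ?_, ?_⟩
  · rw [← hcol, ← hcol] at hc
    exact w.injective (ht.inj (Prod.ext hr hc))
  · rw [labelInv, Finset.card_eq_zero, Finset.filter_eq_empty_iff]
    rintro ⟨a, b⟩ - ⟨⟨hab, hr⟩, hlt⟩
    have h1 := hm _ _ hlt
    simp only [perm_apply_inv] at h1 hr hab
    have h2 := ht.lex a b hab
    omega
  · rw [← card_col_pairs ht hd, labelInv]
    congr 1
    refine Finset.filter_congr fun p _ => and_iff_left_of_imp fun hp => ht.lt_of_row_lt ?_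
    have := hm _ _ hp.1
    have h2 := hp.2
    rw [← hcol, ← hcol] at h2
    omega

end ColumnReading

/-! ### Shortest paths between tableaux and the invariant form -/

section Paths

variable {n : ℕ} {K : Type*} [Field K] {q : K} {br : ℤ → K} {t : Fin n → ℕ × ℕ} {κ : Type*}

theorem simpleMatrix_mul_apply_of_not_std {i j : Fin n} (hij : i ≠ j) (M : Matrix (SYT t) κ K)
    {a : SYT t} (h : ¬ Std t (a.1 * swap i j)) (b : κ) : (simpleMatrix q br t i j * M) a b =
      (q - 1 + (br (contentDiff t a.1 i j))⁻¹) * M a b := by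
  rw [simpleMatrix_mul_apply hij, rowEntry_of_not _ h, mul_zero, add_zero]

theorem simpleMatrix_apply_self (i j : Fin n) (a : SYT t) :
    simpleMatrix q br t i j a a = q - 1 + (br (contentDiff t a.1 i j))⁻¹ := by
  simp [simpleMatrix]

theorem simpleMatrix_apply_eq_zero {i j : Fin n} {a b : SYT t} (h1 : b ≠ a)
    (h2 : b.1 ≠ a.1 * swap i j) : simpleMatrix q br t i j a b = 0 := by
  simp [simpleMatrix, h1, h2]

theorem mul_simpleMatrix_apply_of_not_std {i j : Fin n} (M : Matrix κ (SYT t) K)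
    {a : SYT t} (h : ¬ Std t (a.1 * swap i j)) (x : κ) : (M * simpleMatrix q br t i j) x a =
      (q - 1 + (br (contentDiff t a.1 i j))⁻¹) * M x a := by
  rw [Matrix.mul_apply, Finset.sum_eq_single a, simpleMatrix_apply_self, mul_comm]
  · intro c _ hc
    rw [simpleMatrix_apply_eq_zero hc.symm, mul_zero]
    intro e
    refine h ?_
    rw [e, mul_assoc, Equiv.swap_mul_self, mul_one]
    exact c.2
  · simp

theorem mul_simpleMatrix_apply {i j : Fin n} (hij : i ≠ j) (M : Matrix κ (SYT t) K)
    {a : SYT t} (h : Std t (a.1 * swap i j)) (x : κ) : (M * simpleMatrix q br t i j) x a =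
      (q - 1 + (br (contentDiff t a.1 i j))⁻¹) * M x a +
        (q + (br (-contentDiff t a.1 i j))⁻¹) * M x ⟨a.1 * swap i j, h⟩ := by
  have hne : a.1 * swap i j ≠ a.1 := fun e => hij (Equiv.swap_eq_one_iff.1 (mul_eq_left.1 e))
  set a' : SYT t := ⟨a.1 * swap i j, h⟩ with ha'
  have hne' : a' ≠ a := fun e => hne (congrArg Subtype.val e)
  have e : a'.1 * swap i j = a.1 := by simp [ha', mul_assoc]
  have h2 : simpleMatrix q br t i j a' a = q + (br (-contentDiff t a.1 i j))⁻¹ := by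
    simp [simpleMatrix, hne'.symm, e]
    simp [ha', contentDiff_mul_swap]
  rw [Matrix.mul_apply, Finset.sum_eq_add_of_mem a a' (Finset.mem_univ _) (Finset.mem_univ _)
    hne'.symm, simpleMatrix_apply_self, h2, mul_comm, mul_comm (M x a')]
  intro c _ hc
  rw [simpleMatrix_apply_eq_zero hc.1.symm, mul_zero]
  intro e2
  refine hc.2 (Subtype.ext ?_)
  show c.1 = a.1 * swap i j
  rw [e2, mul_assoc, Equiv.swap_mul_self, mul_one]

variable (hb : IsBracket q br) (ht : IsShape t)

theorem length_le_of_mul_swap {i j : Fin n} (hij : (i : ℕ) + 1 = j) (w : Perm (Fin n)) :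
    length w ≤ length (w * swap i j) + 1 := by
  rcases lt_or_gt_of_adj hij w with h | h
  · have := length_mul_swap hij w h; omega
  · have := length_mul_swap_of_gt hij w h; omega

/-- A simple matrix moves a tableau by at most one exchange, so the superstandard tableau cannot be
linked to `a` in fewer than `length a` factors. -/
theorem seminormal_apply_row_eq_zero (w : Perm (Fin n)) (a : SYT t) (h : length w < length a.1) :
    seminormal hb ht w a (rowSYT ht) = 0 := by
  induction w using left_induction generalizing a with
  | one =>
    rw [seminormal_one, Matrix.one_apply_ne]
    rintro rfl
    exact lt_irrefl _ h
  | mul i j w hij hlt ih =>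
    have hl := length_swap_mul hij w hlt
    rw [seminormal_swap_mul hb ht hij w hlt, simpleMatrix_mul_apply (lt_of_adj hij).ne,
      ih a (by omega), mul_zero, zero_add]
    by_cases hs : Std t (a.1 * swap i j)
    · have e : rowEntry t (seminormal hb ht w) (a.1 * swap i j) (rowSYT ht) =
        seminormal hb ht w ⟨a.1 * swap i j, hs⟩ (rowSYT ht) := dif_pos hs
      have := length_le_of_mul_swap hij a.1
      rw [e, ih _ (by simp only; omega), mul_zero]
    · rw [rowEntry_of_not _ hs, mul_zero]

theorem seminormal_row_apply_eq_zero (w : Perm (Fin n)) (a : SYT t) (h : length w < length a.1) :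
    seminormal hb ht w (rowSYT ht) a = 0 := by
  induction w using right_induction generalizing a with
  | one =>
    rw [seminormal_one, Matrix.one_apply_ne]
    rintro rfl
    exact lt_irrefl _ h
  | mul i j w hij hlt ih =>
    have hl := length_mul_swap hij w hlt
    rw [← (isHecke_seminormal hb ht).mul_swap_of_lt hij w hlt, seminormal_swap hb ht hij]
    by_cases hs : Std t (a.1 * swap i j)
    · have := length_le_of_mul_swap hij a.1
      rw [mul_simpleMatrix_apply (lt_of_adj hij).ne _ hs, ih a (by omega), ih _ (by simp only; omega),
        mul_zero, mul_zero, add_zero]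
    · rw [mul_simpleMatrix_apply_of_not_std _ hs, ih a (by omega), mul_zero]

/-- The coefficient of the superstandard tableau on the shortest path to the tableau `a`. -/
noncomputable def pathIn (a : SYT t) : K := seminormal hb ht a.1 (rowSYT ht) a

/-- The coefficient of the tableau `a` on the shortest path to the superstandard tableau. -/
noncomputable def pathOut (a : SYT t) : K := seminormal hb ht a.1⁻¹ a (rowSYT ht)

theorem pathIn_row : pathIn hb ht (rowSYT ht) = 1 := by
  rw [pathIn, show (rowSYT ht).1 = 1 from rfl, seminormal_one, Matrix.one_apply_eq]

theorem pathOut_row : pathOut hb ht (rowSYT ht) = 1 := by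
  rw [pathOut, show (rowSYT ht).1 = 1 from rfl, inv_one, seminormal_one, Matrix.one_apply_eq]

/-- In the last factor the diagonal term vanishes because the remaining word is too short; only the
off-diagonal entry survives. -/
theorem pathIn_step {a : SYT t} {i j : Fin n} (hij : (i : ℕ) + 1 = j) (hlt : a.1 j < a.1 i)
    (hs : Std t (a.1 * swap i j)) : pathIn hb ht a =
      (q + (br (-contentDiff t a.1 i j))⁻¹) * pathIn hb ht ⟨a.1 * swap i j, hs⟩ := by
  have hl := length_mul_swap_of_gt hij a.1 hlt
  have e := (isHecke_seminormal hb ht).mul_swap_of_lt hij (a.1 * swap i j) (by simpa using hlt)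
  rw [mul_assoc, Equiv.swap_mul_self, mul_one, seminormal_swap hb ht hij] at e
  rw [pathIn, ← e, mul_simpleMatrix_apply (lt_of_adj hij).ne _ hs,
    seminormal_row_apply_eq_zero hb ht _ a (by omega), mul_zero, zero_add]
  rfl

theorem pathOut_step {a : SYT t} {i j : Fin n} (hij : (i : ℕ) + 1 = j) (hlt : a.1 j < a.1 i)
    (hs : Std t (a.1 * swap i j)) : pathOut hb ht a =
      (q + (br (contentDiff t a.1 i j))⁻¹) * pathOut hb ht ⟨a.1 * swap i j, hs⟩ := by
  have hl := length_mul_swap_of_gt hij a.1 hlt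
  have e := seminormal_swap_mul hb ht hij (a.1 * swap i j)⁻¹ (by simpa using hlt)
  rw [mul_inv_rev, Equiv.swap_inv, ← mul_assoc, Equiv.swap_mul_self, one_mul] at e
  rw [pathOut, e, simpleMatrix_mul_apply (lt_of_adj hij).ne,
    seminormal_apply_row_eq_zero hb ht _ a (by
      rw [← length_inv, mul_inv_rev, inv_inv, Equiv.swap_inv]; omega), mul_zero, zero_add]
  congr 1
  rw [pathOut]
  simp only [mul_inv_rev, Equiv.swap_inv]
  exact dif_pos hs

theorem pathIn_ne_zero (a : SYT t) : pathIn hb ht a ≠ 0 := by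
  induction a using SYT.induction ht with
  | one => rw [pathIn_row]; exact one_ne_zero
  | swap a i j hij hlt hs ih =>
    rw [pathIn_step hb ht hij hlt hs]
    refine mul_ne_zero (hb.q_add_inv_ne_zero ?_) ih
    have := a.2.two_le_contentDiff hs hij
    omega

theorem pathOut_ne_zero (a : SYT t) : pathOut hb ht a ≠ 0 := by
  induction a using SYT.induction ht with
  | one => rw [pathOut_row]; exact one_ne_zero
  | swap a i j hij hlt hs ih =>
    rw [pathOut_step hb ht hij hlt hs]
    exact mul_ne_zero (hb.q_add_inv_ne_zero (a.2.two_le_contentDiff hs hij)) ih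

/-- An exchange multiplies `pathOut` and `pathIn` by the two opposite off-diagonal entries, so the
quotient of the paths is exactly the scaling which symmetrizes the matrix. -/
theorem simpleMatrix_symm {i j : Fin n} (hij : (i : ℕ) + 1 = j) (a b : SYT t) :
    simpleMatrix q br t i j a b * (pathOut hb ht b / pathIn hb ht b) =
      pathOut hb ht a / pathIn hb ht a * simpleMatrix q br t i j b a := by
  have hne := (lt_of_adj hij).ne
  have key : ∀ (a : SYT t) (hs : Std t (a.1 * swap i j)), a.1 j < a.1 i →
      simpleMatrix q br t i j a ⟨a.1 * swap i j, hs⟩ *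
        (pathOut hb ht ⟨a.1 * swap i j, hs⟩ / pathIn hb ht ⟨a.1 * swap i j, hs⟩) =
      pathOut hb ht a / pathIn hb ht a * simpleMatrix q br t i j ⟨a.1 * swap i j, hs⟩ a := by
    intro a hs hlt
    have h2 : simpleMatrix q br t i j ⟨a.1 * swap i j, hs⟩ a =
        q + (br (-contentDiff t a.1 i j))⁻¹ := by
      have hne' : a ≠ ⟨a.1 * swap i j, hs⟩ := fun e => hne
        (Equiv.swap_eq_one_iff.1 (mul_eq_left.1 (congrArg Subtype.val e).symm))
      simp [simpleMatrix, hne', mul_assoc]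
      rw [contentDiff_mul_swap]
    have d := a.2.two_le_contentDiff hs hij
    have z2 := hb.q_add_inv_ne_zero (d := -contentDiff t a.1 i j) (by omega)
    have z3 := pathIn_ne_zero hb ht ⟨a.1 * swap i j, hs⟩
    rw [simpleMatrix_apply_swap hne, h2, pathIn_step hb ht hij hlt hs, pathOut_step hb ht hij hlt hs]
    generalize q + (br (-contentDiff t a.1 i j))⁻¹ = x at z2 ⊢
    field_simp
  by_cases h1 : b = a
  · subst h1; ring
  by_cases h2 : b.1 = a.1 * swap i j
  · have hs : Std t (a.1 * swap i j) := h2 ▸ b.2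
    obtain rfl : b = ⟨a.1 * swap i j, hs⟩ := Subtype.ext h2
    rcases lt_or_gt_of_adj hij a.1 with h | h
    · have hs' : Std t ((a.1 * swap i j) * swap i j) := by
        rw [mul_assoc, Equiv.swap_mul_self, mul_one]; exact a.2
      have e : (⟨(a.1 * swap i j) * swap i j, hs'⟩ : SYT t) = a :=
        Subtype.ext (by simp [mul_assoc])
      have := key ⟨a.1 * swap i j, hs⟩ hs' (by simpa using h)
      rw [e] at this
      linear_combination -this
    · exact key a hs h
  · have h3 : a.1 ≠ b.1 * swap i j := fun e => h2 (by rw [e, mul_assoc]; simp)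
    rw [simpleMatrix_apply_eq_zero h1 h2, simpleMatrix_apply_eq_zero (Ne.symm h1) h3, zero_mul,
      mul_zero]

/-- The seminormal representation preserves a nondegenerate diagonal symmetric form. -/
theorem seminormal_symm (w : Perm (Fin n)) (a b : SYT t) :
    seminormal hb ht w a b * (pathOut hb ht b / pathIn hb ht b) =
      pathOut hb ht a / pathIn hb ht a * seminormal hb ht w⁻¹ b a := by
  induction w using left_induction generalizing a with
  | one =>
    rw [inv_one, seminormal_one]
    by_cases h : a = b
    · subst h; ring
    · simp [h, Ne.symm h]
  | mul i j w hij hlt ih =>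
    rw [seminormal_swap_mul hb ht hij w hlt, mul_inv_rev, Equiv.swap_inv,
      ← (isHecke_seminormal hb ht).mul_swap_of_lt hij w⁻¹ hlt, seminormal_swap hb ht hij,
      Matrix.mul_apply, Matrix.mul_apply, Finset.sum_mul, Finset.mul_sum]
    refine Finset.sum_congr rfl fun c _ => ?_
    rw [mul_assoc, ih, ← mul_assoc, simpleMatrix_symm hb ht hij]
    ring

end Paths

/-! ### The Schur element from the row and column tableaux -/

section RowColumn

variable {n : ℕ} {K : Type*} [Field K] {q : K} {br : ℤ → K} {t : Fin n → ℕ × ℕ}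
  (hb : IsBracket q br) (ht : IsShape t) {d : Perm (Fin n)} (hd : IsColReading t d)

/-- The standard tableau filled column by column. -/
def colSYT (hd : IsColReading t d) : SYT t := ⟨d, hd.std⟩

theorem not_std_row (ht : IsShape t) {i j : Fin n} (hij : (i : ℕ) + 1 = j)
    (h : (t i).1 = (t j).1) :
    ¬ Std t ((rowSYT ht).1 * swap i j) ∧ contentDiff t (rowSYT ht).1 i j = 1 := by
  have h1 := ht.lex i j (lt_of_adj hij)
  have hs : ¬ Std t ((rowSYT ht).1 * swap i j) := fun hs =>
    hs.not_le_of_mul_swap hij (Prod.le_def.2 ⟨h.le, by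
      show (t i).2 ≤ (t j).2
      omega⟩)
  refine ⟨hs, ?_⟩
  rcases contentDiff_of_not_std ht (rowSYT ht).2 hs hij with h2 | h2
  · exact h2.2
  · have h3 : (t j).2 = (t i).2 := h2.1
    omega

theorem not_std_col (ht : IsShape t) (hd : IsColReading t d) {i j : Fin n} (hij : (i : ℕ) + 1 = j)
    (h : (t (d i)).2 = (t (d j)).2) :
    ¬ Std t ((colSYT hd).1 * swap i j) ∧ contentDiff t (colSYT hd).1 i j = -1 := by
  have h1 := hd i j (lt_of_adj hij)
  have hs : ¬ Std t ((colSYT hd).1 * swap i j) := fun hs =>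
    hs.not_le_of_mul_swap hij (Prod.le_def.2 ⟨by
      show (t (d i)).1 ≤ (t (d j)).1
      omega, h.le⟩)
  refine ⟨hs, ?_⟩
  rcases contentDiff_of_not_std ht (colSYT hd).2 hs hij with h2 | h2
  · have h3 : (t (d j)).1 = (t (d i)).1 := h2.1
    omega
  · exact h2.2

theorem simpleMatrix_mul_row {κ : Type*} (hb : IsBracket q br) (ht : IsShape t)
    {i j : Fin n} (hij : (i : ℕ) + 1 = j) (h : (t i).1 = (t j).1) (M : Matrix (SYT t) κ K) (b : κ) :
    (simpleMatrix q br t i j * M) (rowSYT ht) b = q * M (rowSYT ht) b := by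
  obtain ⟨h1, h2⟩ := not_std_row ht hij h
  rw [simpleMatrix_mul_apply_of_not_std (lt_of_adj hij).ne _ h1, h2, hb.inv_one]
  ring

theorem mul_simpleMatrix_row {κ : Type*} (hb : IsBracket q br) (ht : IsShape t)
    {i j : Fin n} (hij : (i : ℕ) + 1 = j) (h : (t i).1 = (t j).1) (M : Matrix κ (SYT t) K) (b : κ) :
    (M * simpleMatrix q br t i j) b (rowSYT ht) = q * M b (rowSYT ht) := by
  obtain ⟨h1, h2⟩ := not_std_row ht hij h
  rw [mul_simpleMatrix_apply_of_not_std _ h1, h2, hb.inv_one]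
  ring

theorem simpleMatrix_mul_col {κ : Type*} (hb : IsBracket q br) (ht : IsShape t)
    (hd : IsColReading t d)
    {i j : Fin n} (hij : (i : ℕ) + 1 = j) (h : (t (d i)).2 = (t (d j)).2) (M : Matrix (SYT t) κ K) (b : κ) :
    (simpleMatrix q br t i j * M) (colSYT hd) b = -M (colSYT hd) b := by
  obtain ⟨h1, h2⟩ := not_std_col ht hd hij h
  rw [simpleMatrix_mul_apply_of_not_std (lt_of_adj hij).ne _ h1, h2, hb.inv_neg_one]
  ring

theorem mul_simpleMatrix_col {κ : Type*} (hb : IsBracket q br) (ht : IsShape t)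
    (hd : IsColReading t d)
    {i j : Fin n} (hij : (i : ℕ) + 1 = j) (h : (t (d i)).2 = (t (d j)).2) (M : Matrix κ (SYT t) K) (b : κ) :
    (M * simpleMatrix q br t i j) b (colSYT hd) = -M b (colSYT hd) := by
  obtain ⟨h1, h2⟩ := not_std_col ht hd hij h
  rw [mul_simpleMatrix_apply_of_not_std _ h1, h2, hb.inv_neg_one]
  ring

/-- A row reflection contributes q to each of the two coefficients and q⁻¹ through the length, in
total q. A column reflection contributes (-1)² and q⁻¹. -/
theorem isSemiinvariant_coeff : IsSemiinvariant t d q q⁻¹ fun w =>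
    (q ^ length w)⁻¹ * seminormal hb ht w (rowSYT ht) (colSYT hd) *
      seminormal hb ht w⁻¹ (colSYT hd) (rowSYT ht) where
  row i j w hij hr hlt := by
    have := hb.q_ne
    rw [length_swap_mul hij w hlt, seminormal_swap_mul hb ht hij w hlt, mul_inv_rev,
      Equiv.swap_inv, ← (isHecke_seminormal hb ht).mul_swap_of_lt hij w⁻¹ hlt,
      seminormal_swap hb ht hij, simpleMatrix_mul_row hb ht hij hr, mul_simpleMatrix_row hb ht hij hr,
      smul_eq_mul, pow_succ]
    field_simp
  col i j w hij hr hlt := by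
    have := hb.q_ne
    rw [length_mul_swap hij w hlt, ← (isHecke_seminormal hb ht).mul_swap_of_lt hij w hlt,
      mul_inv_rev, Equiv.swap_inv, seminormal_swap_mul hb ht hij w⁻¹ (by simpa using hlt),
      seminormal_swap hb ht hij, simpleMatrix_mul_col hb ht hd hij hr,
      mul_simpleMatrix_col hb ht hd hij hr, smul_eq_mul, pow_succ]
    field_simp

-- Orthogonality gives the Schur element as the sum of the semi-invariant function over `W`; only
-- transversal permutations contribute, each a monomial times the value at `d`.
open Classical in
theorem schurElement_eq (hq : q ≠ q⁻¹) : schurElement hb ht =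
    (∑ w ∈ Finset.univ.filter (IsTransversal t d), q ^ labelInv (fun k => (t k).1) w⁻¹ *
      q⁻¹ ^ labelInv (fun k => (t (d k)).2) w) *
    ((q ^ length d)⁻¹ * pathIn hb ht (colSYT hd) * pathOut hb ht (colSYT hd)) := by
  have h := coeffPairing_self hb ht (rowSYT ht) (colSYT hd) (colSYT hd) (rowSYT ht)
  rw [if_pos ⟨rfl, rfl⟩] at h
  rw [← h, coeffPairing, Finset.sum_filter, Finset.sum_mul]
  refine Finset.sum_congr rfl fun w _ => ?_
  by_cases hw : IsTransversal t d w
  · rw [if_pos hw]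
    exact (isSemiinvariant_coeff hb ht hd).eq_smul ht hd hw
  · rw [if_neg hw, zero_mul]
    exact (isSemiinvariant_coeff hb ht hd).eq_zero ht hd hq hw

end RowColumn

/-! ### The canonical tableau of a partition -/

section CanonicalTableau

theorem cellOf_lex (l : List ℕ) : ∀ j k, j < k → (cellOf l j).1 < (cellOf l k).1 ∨
    ((cellOf l j).1 = (cellOf l k).1 ∧ (cellOf l j).2 < (cellOf l k).2) := by
  induction l with
  | nil => intro j k h; exact Or.inr ⟨rfl, h⟩
  | cons a l ih =>
    intro j k h
    simp only [cellOf]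
    by_cases hk : k < a
    · rw [if_pos hk, if_pos (h.trans hk)]
      exact Or.inr ⟨rfl, h⟩
    · rw [if_neg hk]
      by_cases hj : j < a
      · rw [if_pos hj]; exact Or.inl (Nat.succ_pos _)
      · rw [if_neg hj]
        have := ih (j - a) (k - a) (by omega)
        simp only
        omega

theorem cellOf_snd_lt (l : List ℕ) : ∀ k < l.sum, (cellOf l k).2 < l.getD (cellOf l k).1 0 := by
  induction l with
  | nil => intro k hk; simp at hk
  | cons a l ih =>
    intro k hk
    simp only [cellOf]
    by_cases hka : k < a
    · rw [if_pos hka]; simpa using hka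
    · rw [if_neg hka]
      rw [List.sum_cons] at hk
      simpa using ih (k - a) (by omega)

theorem exists_cellOf_eq (l : List ℕ) : ∀ r c, c < l.getD r 0 → ∃ k < l.sum, cellOf l k = (r, c) := by
  induction l with
  | nil => intro r c h; simp at h
  | cons a l ih =>
    intro r c h
    cases r with
    | zero =>
      simp only [List.getD_cons_zero] at h
      exact ⟨c, by rw [List.sum_cons]; omega, by simp [cellOf, h]⟩
    | succ r =>
      simp only [List.getD_cons_succ] at h
      obtain ⟨k, hk, e⟩ := ih r c h
      refine ⟨a + k, by rw [List.sum_cons]; omega, ?_⟩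
      simp [cellOf, e]

theorem getD_antitone {l : List ℕ} (hl : l.Pairwise (· ≥ ·)) {r r' : ℕ} (h : r ≤ r') :
    l.getD r' 0 ≤ l.getD r 0 := by
  induction l generalizing r r' with
  | nil => simp
  | cons a l ih =>
    rw [List.pairwise_cons] at hl
    cases r' with
    | zero => rw [Nat.le_zero.1 h]
    | succ r' =>
      cases r with
      | zero =>
        simp only [List.getD_cons_succ, List.getD_cons_zero]
        by_cases hr : r' < l.length
        · rw [List.getD_eq_getElem _ _ hr]
          exact hl.1 _ (List.getElem_mem hr)
        · rw [List.getD_eq_default _ _ (not_lt.1 hr)]; exact Nat.zero_le _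
      | succ r =>
        simp only [List.getD_cons_succ]
        exact ih hl.2 (by omega)

variable {n : ℕ}

theorem sum_sort_parts (α : n.Partition) : (α.parts.sort (· ≥ ·)).sum = n := by
  rw [← Multiset.sum_coe, Multiset.sort_eq, α.parts_sum]

theorem isShape_tableau (α : n.Partition) : IsShape (tableau α) where
  lex j k h := cellOf_lex _ _ _ h
  inj j k h := by
    by_contra hne
    rcases lt_or_gt_of_ne hne with h1 | h1
    · have := cellOf_lex (α.parts.sort (· ≥ ·)) _ _ h1
      unfold tableau at h
      rw [h] at this
      omega
    · have := cellOf_lex (α.parts.sort (· ≥ ·)) _ _ h1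
      unfold tableau at h
      rw [h] at this
      omega
  lower k x hx := by
    have h1 := cellOf_snd_lt (α.parts.sort (· ≥ ·)) k (by rw [sum_sort_parts]; exact k.2)
    have h2 := Prod.le_def.1 hx
    have h3 := getD_antitone (Multiset.pairwise_sort α.parts (· ≥ ·)) h2.1
    obtain ⟨j, hj, e⟩ := exists_cellOf_eq (α.parts.sort (· ≥ ·)) x.1 x.2
      (lt_of_le_of_lt h2.2 (lt_of_lt_of_le h1 h3))
    rw [sum_sort_parts] at hj
    exact ⟨⟨j, hj⟩, e⟩

theorem tableau_injective : Function.Injective (tableau (n := n)) := by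
  intro α β h
  have key : ∀ α β : n.Partition, tableau α = tableau β → ∀ r c,
      c < (α.parts.sort (· ≥ ·)).getD r 0 → c < (β.parts.sort (· ≥ ·)).getD r 0 := by
    intro α β h r c hc
    obtain ⟨k, hk, e⟩ := exists_cellOf_eq _ r c hc
    rw [sum_sort_parts] at hk
    have e2 : cellOf (β.parts.sort (· ≥ ·)) k = (r, c) := by
      rw [← e]; exact (congrFun h ⟨k, hk⟩).symm
    have := cellOf_snd_lt (β.parts.sort (· ≥ ·)) k (by rw [sum_sort_parts]; exact hk)
    rwa [e2] at this
  have hg : ∀ r, (α.parts.sort (· ≥ ·)).getD r 0 = (β.parts.sort (· ≥ ·)).getD r 0 := fun r =>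
    le_antisymm (le_of_forall_lt fun c => key α β h r c) (le_of_forall_lt fun c => key β α h.symm r c)
  have hpos : ∀ (α : n.Partition) r, r < (α.parts.sort (· ≥ ·)).length ↔
      0 < (α.parts.sort (· ≥ ·)).getD r 0 := by
    intro α r
    constructor
    · intro hr
      rw [List.getD_eq_getElem _ _ hr]
      exact α.parts_pos ((Multiset.mem_sort _).1 (List.getElem_mem hr))
    · intro hr
      by_contra hc
      rw [List.getD_eq_default _ _ (not_lt.1 hc)] at hr
      exact lt_irrefl _ hr
  have hlen : (α.parts.sort (· ≥ ·)).length = (β.parts.sort (· ≥ ·)).length := by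
    refine le_antisymm (le_of_forall_lt fun r hr => ?_) (le_of_forall_lt fun r hr => ?_)
    · rw [hpos, hg] at hr; rwa [hpos]
    · rw [hpos, ← hg] at hr; rwa [hpos]
  have hl : α.parts.sort (· ≥ ·) = β.parts.sort (· ≥ ·) := by
    refine List.ext_getElem hlen fun r h1 h2 => ?_
    have := hg r
    rwa [List.getD_eq_getElem _ _ h1, List.getD_eq_getElem _ _ h2] at this
  refine Nat.Partition.ext ?_
  rw [← Multiset.sort_eq α.parts (· ≥ ·), hl, Multiset.sort_eq]

end CanonicalTableau

/-! ### Irreducible characters of the symmetric group (q = 1) -/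

section Characters

variable {n : ℕ}

theorem isBracket_one : IsBracket (1 : ℂ) fun d : ℤ => (d : ℂ) where
  q_ne := one_ne_zero
  one := by simp
  add d e := by simp
  ne_zero d hd := by simpa using hd

/-- Young's seminormal representation of `𝔖ₙ`. -/
noncomputable def youngRep (α : n.Partition) :
    Perm (Fin n) → Matrix (SYT (tableau α)) (SYT (tableau α)) ℂ :=
  seminormal isBracket_one (isShape_tableau α)

theorem youngRep_one (α : n.Partition) : youngRep α 1 = 1 := seminormal_one _ _

theorem youngRep_swap_mul (α : n.Partition) {i j : Fin n} (hij : (i : ℕ) + 1 = j)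
    (w : Perm (Fin n)) : youngRep α (swap i j * w) = youngRep α (swap i j) * youngRep α w := by
  have hT := isHecke_seminormal isBracket_one (isShape_tableau α)
  rcases lt_or_gt_of_adj hij w⁻¹ with h | h
  · exact (hT.mul_of_lt i j w hij h).symm
  · have := hT.mul_of_gt i j w hij h
    rw [one_smul, sub_self, zero_smul, add_zero] at this
    exact this.symm

theorem youngRep_mul (α : n.Partition) (v w : Perm (Fin n)) :
    youngRep α (v * w) = youngRep α v * youngRep α w := by
  induction v using left_induction with
  | one => rw [one_mul, youngRep_one, Matrix.one_mul]
  | mul i j v hij h ih =>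
    rw [mul_assoc, youngRep_swap_mul α hij, ih, youngRep_swap_mul α hij, Matrix.mul_assoc]

/-- The character of Young's seminormal representation. -/
noncomputable def youngChar (α : n.Partition) (w : Perm (Fin n)) : ℂ := (youngRep α w).trace

theorem youngChar_one (α : n.Partition) :
    youngChar α 1 = Fintype.card (SYT (tableau α)) := by
  rw [youngChar, youngRep_one, Matrix.trace_one]

theorem youngChar_conj (α : n.Partition) (v w : Perm (Fin n)) :
    youngChar α (v * w * v⁻¹) = youngChar α w := by
  rw [youngChar, youngRep_mul, Matrix.trace_mul_comm, ← youngRep_mul, ← mul_assoc,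
    inv_mul_cancel, one_mul, youngChar]

theorem sum_youngRep_mul (α β : n.Partition) (a b : SYT (tableau α)) (c d : SYT (tableau β)) :
    ∑ w, youngRep α w a b * youngRep β w⁻¹ c d =
      coeffPairing isBracket_one (isShape_tableau α) (isShape_tableau β) a b c d := by
  simp [coeffPairing, youngRep]

/-- Summing ρ(w) ρ(w⁻¹) = 1 over the group gives n! in each diagonal entry. -/
theorem card_mul_schurElement_one (α : n.Partition) :
    Fintype.card (SYT (tableau α)) * schurElement isBracket_one (isShape_tableau α) =
      (n.factorial : ℂ) := by
  have h1 : ∑ b, coeffPairing isBracket_one (isShape_tableau α) (isShape_tableau α)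
      (rowSYT (isShape_tableau α)) b b (rowSYT (isShape_tableau α)) =
      Fintype.card (SYT (tableau α)) * schurElement isBracket_one (isShape_tableau α) := by
    simp [coeffPairing_self]
  rw [← h1]
  simp only [← sum_youngRep_mul]
  rw [Finset.sum_comm]
  simp only [← Matrix.mul_apply, ← youngRep_mul, mul_inv_cancel, youngRep_one]
  simp [Fintype.card_perm]

theorem schurElement_one_ne_zero (α : n.Partition) :
    schurElement isBracket_one (isShape_tableau α) ≠ 0 := by
  intro h
  have := card_mul_schurElement_one α
  rw [h, mul_zero] at this
  exact Nat.factorial_ne_zero n (by exact_mod_cast this.symm)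

theorem sum_youngChar_mul (α β : n.Partition) :
    ∑ w, youngChar α w * youngChar β w⁻¹ = if α = β then (n.factorial : ℂ) else 0 := by
  by_cases h : α = β
  · subst h
    have := sum_trace_mul_trace isBracket_one (isShape_tableau α)
    rw [if_pos rfl, ← card_mul_schurElement_one α, ← this]
    simp [youngChar, youngRep]
  · rw [if_neg h]
    simp only [youngChar, Matrix.trace, Matrix.diag_apply, Finset.sum_mul_sum]
    rw [Finset.sum_comm]
    refine Finset.sum_eq_zero fun a _ => ?_
    rw [Finset.sum_comm]
    refine Finset.sum_eq_zero fun c _ => ?_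
    rw [sum_youngRep_mul, coeffPairing_of_ne _ _ _ fun e => h (tableau_injective e)]

/-- Class functions are functions of the cycle type. Orthogonality makes the seminormal characters
independent, and there are as many of them as cycle types, both being indexed by partitions. -/
theorem exists_eq_sum_youngChar (f : Perm (Fin n) → ℂ) (hf : ∀ v w, f (v * w * v⁻¹) = f w) :
    ∃ m : n.Partition → ℂ, ∀ w, f w = ∑ α, m α * youngChar α w := by
  classical
  have factor : ∀ f : Perm (Fin n) → ℂ, (∀ v w, f (v * w * v⁻¹) = f w) →
      ∃ g : (Fintype.card (Fin n)).Partition → ℂ, ∀ w, g w.partition = f w := by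
    intro f hf
    refine ⟨fun p => if h : ∃ w : Perm (Fin n), w.partition = p then f h.choose else 0,
      fun w => ?_⟩
    have h : ∃ v : Perm (Fin n), v.partition = w.partition := ⟨w, rfl⟩
    simp only [dif_pos h]
    obtain ⟨c, hc⟩ := isConj_iff.1 (Equiv.Perm.partition_eq_of_isConj.2 h.choose_spec)
    exact (hf c _).symm.trans (congrArg f hc)
  obtain ⟨g, hg⟩ := factor f hf
  choose G hG using fun α : n.Partition => factor (youngChar α) (youngChar_conj α)
  have hli : LinearIndependent ℂ G := by
    rw [Fintype.linearIndependent_iff]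
    intro c hc β
    have h1 : ∀ w, ∑ α, c α * youngChar α w = 0 := fun w => by
      have := congrFun hc w.partition
      simpa [hG] using this
    have h2 : ∑ w, (∑ α, c α * youngChar α w) * youngChar β w⁻¹ = c β * n.factorial := by
      simp only [Finset.sum_mul, mul_assoc]
      rw [Finset.sum_comm]
      simp only [← Finset.mul_sum, sum_youngChar_mul]
      simp
    simp only [h1, zero_mul, Finset.sum_const_zero] at h2
    exact (mul_eq_zero.1 h2.symm).resolve_right (by exact_mod_cast Nat.factorial_ne_zero n)
  have hcard : Fintype.card n.Partition = Module.finrank ℂ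
      ((Fintype.card (Fin n)).Partition → ℂ) := by
    rw [Module.finrank_fintype_fun_eq_card, Fintype.card_fin]
  have htop := hli.span_eq_top_of_card_eq_finrank' hcard
  have hmem : g ∈ Submodule.span ℂ (Set.range G) := htop ▸ Submodule.mem_top
  obtain ⟨m, hm⟩ := (Submodule.mem_span_range_iff_exists_fun ℂ).1 hmem
  refine ⟨m, fun w => ?_⟩
  rw [← hg, ← hm]
  simp [hG]

/-- Expansion of class functions in the irreducible characters. -/
theorem eq_sum_youngChar (f : Perm (Fin n) → ℂ) (hf : ∀ v w, f (v * w * v⁻¹) = f w)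
    (w : Perm (Fin n)) :
    f w = ∑ α, ((n.factorial : ℂ)⁻¹ * ∑ v, f v * youngChar α v⁻¹) * youngChar α w := by
  obtain ⟨m, hm⟩ := exists_eq_sum_youngChar f hf
  rw [hm w]
  refine Finset.sum_congr rfl fun β _ => ?_
  congr 1
  have h2 : ∑ w, (∑ α, m α * youngChar α w) * youngChar β w⁻¹ = m β * n.factorial := by
    simp only [Finset.sum_mul, mul_assoc]
    rw [Finset.sum_comm]
    simp only [← Finset.mul_sum, sum_youngChar_mul]
    simp
  simp only [hm, h2]
  have : (n.factorial : ℂ) ≠ 0 := by exact_mod_cast Nat.factorial_ne_zero n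
  field_simp

/-- Evaluate at 1 the expansion of n! times the delta function at 1. -/
theorem sum_card_sq :
    ∑ α : n.Partition, Fintype.card (SYT (tableau α)) ^ 2 = n.factorial := by
  have hn : (n.factorial : ℂ) ≠ 0 := by exact_mod_cast Nat.factorial_ne_zero n
  have := eq_sum_youngChar (fun w : Perm (Fin n) => if w = 1 then (n.factorial : ℂ) else 0)
    (fun v w => by simp only [conj_eq_one_iff]) 1
  simp only [if_true, ite_mul, zero_mul, Finset.sum_ite_eq', Finset.mem_univ, inv_one,
    youngChar_one, inv_mul_cancel_left₀ hn] at this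
  rw [← Nat.cast_inj (R := ℂ)]
  push_cast
  rw [this]
  exact Finset.sum_congr rfl fun α _ => sq _

/-- The Frobenius–Schur indicator is 1: the diagonal form given by `seminormal_symm` rewrites the
second factor ρ(w)_{ba} through ρ(w⁻¹)_{ab}, and orthogonality applies. -/
theorem sum_youngChar_sq (α : n.Partition) :
    ∑ w, youngChar α (w * w) = (n.factorial : ℂ) := by
  have e : ∀ w, youngChar α (w * w) = ∑ a, ∑ b, youngRep α w a b *
      (pathOut isBracket_one (isShape_tableau α) b / pathIn isBracket_one (isShape_tableau α) b *
       (pathIn isBracket_one (isShape_tableau α) a / pathOut isBracket_one (isShape_tableau α) a) *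
        youngRep α w⁻¹ a b) := by
    intro w
    rw [youngChar, youngRep_mul]
    simp only [Matrix.trace, Matrix.diag_apply, Matrix.mul_apply]
    refine Finset.sum_congr rfl fun a _ => Finset.sum_congr rfl fun b _ => ?_
    have h1 := seminormal_symm isBracket_one (isShape_tableau α) w b a
    have h2 := pathIn_ne_zero isBracket_one (isShape_tableau α) a
    have h3 := pathOut_ne_zero isBracket_one (isShape_tableau α) a
    congr 1
    change youngRep α w b a * _ = _ * youngRep α w⁻¹ a b at h1
    rw [mul_right_comm, ← h1]
    field_simp
  simp only [e]
  rw [Finset.sum_comm, ← card_mul_schurElement_one α]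
  have h4 : ∀ a b, ∑ w, youngRep α w a b *
      (pathOut isBracket_one (isShape_tableau α) b / pathIn isBracket_one (isShape_tableau α) b *
       (pathIn isBracket_one (isShape_tableau α) a / pathOut isBracket_one (isShape_tableau α) a) *
        youngRep α w⁻¹ a b) =
      if a = b then schurElement isBracket_one (isShape_tableau α) else 0 := by
    intro a b
    simp only [mul_left_comm (youngRep α _ a b)]
    rw [← Finset.mul_sum, sum_youngRep_mul, coeffPairing_self]
    have h2 := pathIn_ne_zero isBracket_one (isShape_tableau α) a
    have h3 := pathOut_ne_zero isBracket_one (isShape_tableau α) a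
    by_cases h : a = b
    · subst h; simp; field_simp
    · simp [h]
  have h5 : ∀ a, ∑ w, ∑ b, youngRep α w a b *
      (pathOut isBracket_one (isShape_tableau α) b / pathIn isBracket_one (isShape_tableau α) b *
       (pathIn isBracket_one (isShape_tableau α) a / pathOut isBracket_one (isShape_tableau α) a) *
        youngRep α w⁻¹ a b) = schurElement isBracket_one (isShape_tableau α) := by
    intro a
    rw [Finset.sum_comm]
    simp only [h4]
    simp
  simp only [h5]
  simp

/-- The number of involutions is the sum of the degrees. -/
theorem card_inv_eq_sum_card :
    Fintype.card (Inv n) = ∑ α : n.Partition, Fintype.card (SYT (tableau α)) := by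
  have hn : (n.factorial : ℂ) ≠ 0 := by exact_mod_cast Nat.factorial_ne_zero n
  have hcl : ∀ v w : Perm (Fin n),
      (∑ g : Perm (Fin n), if g * g = v * w * v⁻¹ then (1 : ℂ) else 0) =
        ∑ g : Perm (Fin n), if g * g = w then (1 : ℂ) else 0 := by
    intro v w
    refine Fintype.sum_equiv (MulAut.conj v⁻¹).toEquiv _ _ fun g => ?_
    congr 1
    simp only [MulEquiv.toEquiv_eq_coe, EquivLike.coe_coe, MulAut.conj_apply, inv_inv, eq_iff_iff]
    constructor
    · intro h
      calc v⁻¹ * g * v * (v⁻¹ * g * v) = v⁻¹ * (g * g) * v := by group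
        _ = w := by rw [h]; group
    · intro h
      rw [← h]; group
  have := eq_sum_youngChar
    (fun w : Perm (Fin n) => ∑ g : Perm (Fin n), if g * g = w then (1 : ℂ) else 0) hcl 1
  -- All coefficients of the function counting square roots equal 1; its value at 1 is the number of
  -- involutions.
  have e : ∀ α : n.Partition, ∑ v, (∑ g : Perm (Fin n), if g * g = v then (1 : ℂ) else 0) *
      youngChar α v⁻¹ = n.factorial := by
    intro α
    rw [← sum_youngChar_sq α]
    simp only [Finset.sum_mul]
    rw [Finset.sum_comm]
    simp only [ite_mul, one_mul, zero_mul, Finset.sum_ite_eq, Finset.mem_univ, if_true]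
    refine Fintype.sum_equiv (Equiv.inv _) _ _ fun g => ?_
    simp
  simp only [e, inv_mul_cancel₀ hn, one_mul, youngChar_one] at this
  rw [← Nat.cast_inj (R := ℂ), Fintype.card_subtype]
  push_cast
  rw [← this]
  simp [sq]

end Characters

/-! ### Generators of Young subgroups -/

section LabelPreserving

variable {n : ℕ}

/-- Permutations which preserve the blocks of a monotone labelling are products of adjacent
transpositions which do so. -/
theorem label_induction {f : Fin n → ℕ} (hf : Monotone f) {P : Perm (Fin n) → Prop} (one : P 1)
    (mul : ∀ (i j : Fin n) (w : Perm (Fin n)), (i : ℕ) + 1 = j → f i = f j → P w →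
      P (swap i j * w)) (w : Perm (Fin n)) (hw : ∀ k, f (w k) = f k) : P w := by
  induction hl : length w using Nat.strong_induction_on generalizing w with
  | _ m ih =>
  subst hl
  have hw' : ∀ k, f (w⁻¹ k) = f k := fun k => by
    rw [← hw (w⁻¹ k), perm_apply_inv]
  by_cases hc : ∀ i j : Fin n, (i : ℕ) + 1 = j → f i = f j → w⁻¹ i < w⁻¹ j
  · have h1 : w⁻¹ = 1 := by
      refine eq_one_of_forall_adj_lt _ fun i j hij => ?_
      by_cases he : f i = f j
      · exact hc i j hij he
      · by_contra hn
        have h2 := hf (not_lt.1 hn)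
        rw [hw', hw'] at h2
        exact he (le_antisymm (hf (lt_of_adj hij).le) h2)
    rw [inv_eq_one.1 h1]
    exact one
  · push Not at hc
    obtain ⟨i, j, hij, he, hle⟩ := hc
    have hlt : w⁻¹ j < w⁻¹ i :=
      lt_of_le_of_ne hle fun e => (lt_of_adj hij).ne' (w⁻¹.injective e)
    have h1 := length_swap_mul_of_gt hij w hlt
    have h2 := ih _ (by omega) (swap i j * w)
      (fun k => by rw [Equiv.Perm.mul_apply, label_swap he, hw]) rfl
    simpa using mul i j _ hij he h2

end LabelPreserving

/-! ### Young symmetrizers and Specht characters -/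

section YoungSymmetrizer

variable {n : ℕ}

open Classical in
/-- The stabilizer of the rows of the canonical tableau. -/
noncomputable def rowStab (α : n.Partition) : Finset (Perm (Fin n)) :=
  Finset.univ.filter fun p : Perm (Fin n) => ∀ k, (tableau α (p k)).1 = (tableau α k).1

open Classical in
/-- The stabilizer of the columns of the canonical tableau. -/
noncomputable def colStab (α : n.Partition) : Finset (Perm (Fin n)) :=
  Finset.univ.filter fun q : Perm (Fin n) => ∀ k, (tableau α (q k)).2 = (tableau α k).2

theorem mem_rowStab {α : n.Partition} {p : Perm (Fin n)} :
    p ∈ rowStab α ↔ ∀ k, (tableau α (p k)).1 = (tableau α k).1 := by simp [rowStab]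

theorem mem_colStab {α : n.Partition} {p : Perm (Fin n)} :
    p ∈ colStab α ↔ ∀ k, (tableau α (p k)).2 = (tableau α k).2 := by simp [colStab]

theorem eq_one_of_mem_rowStab_of_mem_colStab {α : n.Partition} {p : Perm (Fin n)}
    (h : p ∈ rowStab α) (h' : p ∈ colStab α) : p = 1 := by
  ext k : 1
  exact (isShape_tableau α).inj (Prod.ext (mem_rowStab.1 h k) (mem_colStab.1 h' k))

theorem one_mem_rowStab (α : n.Partition) : 1 ∈ rowStab α := mem_rowStab.2 fun _ => rfl

theorem one_mem_colStab (α : n.Partition) : 1 ∈ colStab α := mem_colStab.2 fun _ => rfl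

theorem mul_mem_rowStab {α : n.Partition} {p p' : Perm (Fin n)} (h : p ∈ rowStab α)
    (h' : p' ∈ rowStab α) : p * p' ∈ rowStab α :=
  mem_rowStab.2 fun k => by rw [Equiv.Perm.mul_apply, mem_rowStab.1 h, mem_rowStab.1 h']

theorem inv_mem_rowStab {α : n.Partition} {p : Perm (Fin n)} (h : p ∈ rowStab α) :
    p⁻¹ ∈ rowStab α :=
  mem_rowStab.2 fun k => by rw [← mem_rowStab.1 h, perm_apply_inv]

theorem mul_mem_colStab {α : n.Partition} {p p' : Perm (Fin n)} (h : p ∈ colStab α)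
    (h' : p' ∈ colStab α) : p * p' ∈ colStab α :=
  mem_colStab.2 fun k => by rw [Equiv.Perm.mul_apply, mem_colStab.1 h, mem_colStab.1 h']

theorem inv_mem_colStab {α : n.Partition} {p : Perm (Fin n)} (h : p ∈ colStab α) :
    p⁻¹ ∈ colStab α :=
  mem_colStab.2 fun k => by rw [← mem_colStab.1 h, perm_apply_inv]

/-- The sum of the row stabilizer. -/
noncomputable def rowSum (α : n.Partition) : MonoidAlgebra ℂ (Perm (Fin n)) :=
  ∑ p ∈ rowStab α, MonoidAlgebra.single p 1

/-- The signed sum of the column stabilizer. -/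
noncomputable def colSum (α : n.Partition) : MonoidAlgebra ℂ (Perm (Fin n)) :=
  ∑ q ∈ colStab α, MonoidAlgebra.single q ((Equiv.Perm.sign q : ℤ) : ℂ)

theorem youngSymmetrizer_eq (α : n.Partition) : youngSymmetrizer α = rowSum α * colSum α := rfl

theorem rowSum_mul_single {α : n.Partition} {r : Perm (Fin n)} (hr : r ∈ rowStab α) :
    rowSum α * MonoidAlgebra.single r 1 = rowSum α := by
  rw [rowSum, Finset.sum_mul]
  refine Finset.sum_nbij' (fun p => p * r) (fun p => p * r⁻¹)
    (fun p hp => mul_mem_rowStab hp hr) (fun p hp => mul_mem_rowStab hp (inv_mem_rowStab hr))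
    (fun p _ => by simp) (fun p _ => by simp) fun p _ => ?_
  rw [MonoidAlgebra.single_mul_single, mul_one]

theorem single_mul_colSum {α : n.Partition} {r : Perm (Fin n)} (hr : r ∈ colStab α) :
    MonoidAlgebra.single r 1 * colSum α = ((Equiv.Perm.sign r : ℤ) : ℂ) • colSum α := by
  rw [colSum, Finset.mul_sum, Finset.smul_sum]
  refine Finset.sum_nbij' (fun p => r * p) (fun p => r⁻¹ * p)
    (fun p hp => mul_mem_colStab hr hp) (fun p hp => mul_mem_colStab (inv_mem_colStab hr) hp)
    (fun p _ => by simp) (fun p _ => by simp) fun p _ => ?_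
  rw [MonoidAlgebra.single_mul_single, MonoidAlgebra.smul_single, one_mul, smul_eq_mul, map_mul]
  congr 1
  rcases Int.units_eq_one_or (Equiv.Perm.sign r) with h | h <;> simp [h]

theorem conj_mem_colStab {α : n.Partition} {d : Perm (Fin n)} {i j : Fin n}
    (h : (tableau α (d i)).2 = (tableau α (d j)).2) : d * swap i j * d⁻¹ ∈ colStab α := by
  refine mem_colStab.2 fun k => ?_
  have := label_swap (f := fun k => (tableau α (d k)).2) h (d⁻¹ k)
  simpa [Equiv.Perm.mul_apply, perm_apply_inv] using this

/-- The function w ↦ R (w d⁻¹) C, with R the row sum and C the signed column sum, is semi-invariant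
for the constants 1 and -1. So it vanishes off transversals and is otherwise a multiple of its value
R C at `d`. -/
theorem exists_rowSum_mul_mul_colSum (α : n.Partition) (a : MonoidAlgebra ℂ (Perm (Fin n))) :
    ∃ e : ℂ, rowSum α * a * colSum α = e • youngSymmetrizer α := by
  obtain ⟨d, hd⟩ := exists_isColReading (isShape_tableau α)
  have hF : IsSemiinvariant (tableau α) d (1 : ℂ) (-1)
      (fun w => rowSum α * MonoidAlgebra.single (w * d⁻¹) 1 * colSum α) := by
    constructor
    · intro i j w hij h _
      have hr : swap i j ∈ rowStab α :=
        mem_rowStab.2 fun k => label_swap (f := fun k => (tableau α k).1) h k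
      have e : MonoidAlgebra.single (swap i j * w * d⁻¹) (1 : ℂ) =
          MonoidAlgebra.single (swap i j) 1 * MonoidAlgebra.single (w * d⁻¹) 1 := by
        rw [MonoidAlgebra.single_mul_single, mul_one, mul_assoc]
      rw [one_smul, e, ← mul_assoc, rowSum_mul_single hr]
    · intro i j w hij h _
      have e : MonoidAlgebra.single (w * swap i j * d⁻¹) (1 : ℂ) =
          MonoidAlgebra.single (w * d⁻¹) 1 * MonoidAlgebra.single (d * swap i j * d⁻¹) 1 := by
        rw [MonoidAlgebra.single_mul_single, mul_one]
        congr 1; group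
      rw [e, ← mul_assoc, mul_assoc _ _ (colSum α), single_mul_colSum (conj_mem_colStab h),
        mul_smul_comm]
      congr 1
      simp [Equiv.Perm.sign_swap (lt_of_adj hij).ne]
  induction a using MonoidAlgebra.induction_linear with
  | zero => exact ⟨0, by simp⟩
  | add f g hf hg =>
    obtain ⟨e, he⟩ := hf
    obtain ⟨e', he'⟩ := hg
    exact ⟨e + e', by rw [mul_add, add_mul, he, he', add_smul]⟩
  | single g z =>
    have hz : MonoidAlgebra.single g z = z • MonoidAlgebra.single g (1 : ℂ) := by
      rw [MonoidAlgebra.smul_single, smul_eq_mul, mul_one]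
    have hg : g = g * d * d⁻¹ := by group
    rw [hz, mul_smul_comm, smul_mul_assoc]
    by_cases ht : IsTransversal (tableau α) d (g * d)
    · have := hF.eq_smul (isShape_tableau α) hd ht
      simp only [← hg, mul_inv_cancel, ← MonoidAlgebra.one_def, mul_one,
        ← youngSymmetrizer_eq] at this
      exact ⟨_, by rw [this, smul_smul]⟩
    · have := hF.eq_zero (isShape_tableau α) hd (by norm_num) ht
      simp only [← hg] at this
      exact ⟨0, by rw [this, smul_zero, zero_smul]⟩

theorem exists_youngSymmetrizer_mul_mul (α : n.Partition) (a : MonoidAlgebra ℂ (Perm (Fin n))) :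
    ∃ e : ℂ, youngSymmetrizer α * a * youngSymmetrizer α = e • youngSymmetrizer α := by
  obtain ⟨e, he⟩ := exists_rowSum_mul_mul_colSum α (colSum α * a * rowSum α)
  refine ⟨e, ?_⟩
  rw [← he, youngSymmetrizer_eq]
  simp only [mul_assoc]

theorem coeff_youngSymmetrizer_one (α : n.Partition) : (youngSymmetrizer α).coeff 1 = 1 := by
  classical
  rw [youngSymmetrizer_eq, rowSum, colSum, Finset.sum_mul_sum]
  simp only [MonoidAlgebra.single_mul_single, MonoidAlgebra.coeff_sum, Finsupp.finsetSum_apply,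
    MonoidAlgebra.coeff_single, Finsupp.single_apply, one_mul]
  rw [Finset.sum_eq_single_of_mem 1 (one_mem_rowStab α),
    Finset.sum_eq_single_of_mem 1 (one_mem_colStab α)]
  · simp
  · intro q _ hq
    rw [if_neg (by simpa using hq)]
  · intro p hp hp1
    refine Finset.sum_eq_zero fun q hq => if_neg fun e => hp1 ?_
    rw [eq_inv_of_mul_eq_one_left e] at hp ⊢
    exact eq_one_of_mem_rowStab_of_mem_colStab hp (inv_mem_colStab hq)

/-- Young's seminormal representation on the group algebra. -/
noncomputable def youngAlg (α : n.Partition) : MonoidAlgebra ℂ (Perm (Fin n)) →ₐ[ℂ]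
    Matrix (SYT (tableau α)) (SYT (tableau α)) ℂ :=
  MonoidAlgebra.lift ℂ _ _
    { toFun := youngRep α
      map_one' := youngRep_one α
      map_mul' := youngRep_mul α }

theorem youngAlg_single (α : n.Partition) (w : Perm (Fin n)) (z : ℂ) :
    youngAlg α (MonoidAlgebra.single w z) = z • youngRep α w := by
  simp [youngAlg]

theorem youngAlg_apply (α : n.Partition) (a : MonoidAlgebra ℂ (Perm (Fin n))) :
    youngAlg α a = ∑ w, a.coeff w • youngRep α w := by
  rw [youngAlg, MonoidAlgebra.lift_apply, Finsupp.sum_fintype _ _ (by simp)]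
  rfl

theorem youngRep_mul_row (α : n.Partition) {p : Perm (Fin n)} (hp : p ∈ rowStab α) :
    ∀ {κ : Type} (M : Matrix (SYT (tableau α)) κ ℂ) (b : κ),
      (youngRep α p * M) (rowSYT (isShape_tableau α)) b = M (rowSYT (isShape_tableau α)) b := by
  intro κ M b
  refine label_induction (isShape_tableau α).row_monotone
    (P := fun p => (youngRep α p * M) (rowSYT (isShape_tableau α)) b =
      M (rowSYT (isShape_tableau α)) b) ?_ ?_ p (mem_rowStab.1 hp)
  · rw [youngRep_one, Matrix.one_mul]
  · intro i j w hij he hw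
    rw [youngRep_mul, youngRep, seminormal_swap _ _ hij, Matrix.mul_assoc,
      simpleMatrix_mul_row isBracket_one _ hij he, one_mul]
    exact hw

theorem mul_youngRep_col (α : n.Partition) {d : Perm (Fin n)} (hd : IsColReading (tableau α) d)
    {p : Perm (Fin n)} (hp : ∀ k, (tableau α (d (p k))).2 = (tableau α (d k)).2) {κ : Type}
    (M : Matrix κ (SYT (tableau α)) ℂ) (b : κ) :
    (M * youngRep α p) b (colSYT hd) = ((Equiv.Perm.sign p : ℤ) : ℂ) * M b (colSYT hd) := by
  refine label_induction (f := fun k => (tableau α (d k)).2) hd.monotone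
    (P := fun p => ∀ M : Matrix κ (SYT (tableau α)) ℂ, (M * youngRep α p) b (colSYT hd) =
      ((Equiv.Perm.sign p : ℤ) : ℂ) * M b (colSYT hd)) ?_ ?_ p hp M
  · intro M
    rw [youngRep_one, Matrix.mul_one]; simp
  · intro i j w hij he hw M
    rw [youngRep_mul, ← Matrix.mul_assoc, hw, youngRep, seminormal_swap _ _ hij,
      mul_simpleMatrix_col isBracket_one (isShape_tableau α) hd hij he, map_mul,
      Equiv.Perm.sign_swap (lt_of_adj hij).ne]
    simp

/-- In ρ(c_α) ρ(d), at the row-filled and column-filled tableaux, the row group acts trivially and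
the sign of the column group cancels the sign in c_α. All terms equal the same nonzero path
coefficient. -/
theorem youngAlg_youngSymmetrizer_ne_zero (α : n.Partition) :
    youngAlg α (youngSymmetrizer α) ≠ 0 := by
  intro h0
  obtain ⟨d, hd⟩ := exists_isColReading (isShape_tableau α)
  have h1 : youngAlg α (youngSymmetrizer α) * youngRep α d = 0 := by rw [h0, Matrix.zero_mul]
  have h2 := congrFun (congrFun h1 (rowSYT (isShape_tableau α))) (colSYT hd)
  have hterm : ∀ p ∈ rowStab α, ∀ q ∈ colStab α,
      (((Equiv.Perm.sign q : ℤ) : ℂ) • youngRep α (p * q) * youngRep α d)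
        (rowSYT (isShape_tableau α)) (colSYT hd) =
        pathIn isBracket_one (isShape_tableau α) (colSYT hd) := by
    intro p hp q hq
    have e : youngRep α (p * q) * youngRep α d =
        youngRep α p * (youngRep α d * youngRep α (d⁻¹ * q * d)) := by
      simp only [← youngRep_mul]
      congr 1; group
    have hs : ((Equiv.Perm.sign q : ℤ) : ℂ) * ((Equiv.Perm.sign q : ℤ) : ℂ) = 1 := by
      rcases Int.units_eq_one_or (Equiv.Perm.sign q) with h | h <;> simp [h]
    rw [Matrix.smul_mul, e, Matrix.smul_apply, youngRep_mul_row α hp,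
      mul_youngRep_col α hd (fun k => by
        simp only [Equiv.Perm.mul_apply, perm_apply_inv]; exact mem_colStab.1 hq _),
      map_mul, map_mul, Equiv.Perm.sign_inv, mul_comm (Equiv.Perm.sign d), mul_assoc,
      Int.units_mul_self, mul_one, smul_eq_mul, ← mul_assoc, hs, one_mul]
    rfl
  have h3 : (youngAlg α (youngSymmetrizer α) * youngRep α d)
      (rowSYT (isShape_tableau α)) (colSYT hd) =
      (rowStab α).card * ((colStab α).card *
        pathIn isBracket_one (isShape_tableau α) (colSYT hd)) := by
    rw [youngSymmetrizer_eq, rowSum, colSum, Finset.sum_mul_sum]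
    simp only [MonoidAlgebra.single_mul_single, one_mul, map_sum, youngAlg_single,
      Finset.sum_mul, Matrix.sum_apply]
    rw [Finset.sum_congr rfl fun p hp => Finset.sum_congr rfl fun q hq => hterm p hp q hq]
    simp
  rw [h3] at h2
  have hR : ((rowStab α).card : ℂ) ≠ 0 := by
    exact_mod_cast (Finset.card_pos.2 ⟨1, one_mem_rowStab α⟩).ne'
  have hC : ((colStab α).card : ℂ) ≠ 0 := by
    exact_mod_cast (Finset.card_pos.2 ⟨1, one_mem_colStab α⟩).ne'
  exact mul_ne_zero hR (mul_ne_zero hC (pathIn_ne_zero _ _ _)) h2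

theorem exists_youngAlg_eq_single (α : n.Partition) (x y : SYT (tableau α)) :
    ∃ a : MonoidAlgebra ℂ (Perm (Fin n)),
      (∀ c d, youngAlg α a c d = if c = y ∧ d = x then 1 else 0) ∧
        ∀ β, β ≠ α → youngAlg β a = 0 := by
  have hγ := schurElement_one_ne_zero α
  have key : ∀ β c d, youngAlg β (∑ w, MonoidAlgebra.single w
      ((schurElement isBracket_one (isShape_tableau α))⁻¹ * youngRep α w⁻¹ x y)) c d =
      (schurElement isBracket_one (isShape_tableau α))⁻¹ *
        coeffPairing isBracket_one (isShape_tableau β) (isShape_tableau α) c d x y := by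
    intro β c d
    rw [map_sum, Matrix.sum_apply, ← sum_youngRep_mul, Finset.mul_sum]
    refine Finset.sum_congr rfl fun w _ => ?_
    rw [youngAlg_single, Matrix.smul_apply, smul_eq_mul]
    ring
  refine ⟨_, fun c d => (key α c d).trans ?_, fun β hβ => ?_⟩
  · rw [coeffPairing_self]
    split_ifs
    · rw [inv_mul_cancel₀ hγ]
    · rw [mul_zero]
  · ext c d
    rw [key, coeffPairing_of_ne _ _ _ fun e => hβ (tableau_injective e), mul_zero]
    rfl

/-- Choose `a` acting as a matrix unit in block `α` and by zero in the others, so that c a c = e c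
with e ≠ 0. In block `β` the left side is zero. -/
theorem youngAlg_youngSymmetrizer_of_ne {α β : n.Partition} (h : β ≠ α) :
    youngAlg β (youngSymmetrizer α) = 0 := by
  have h0 := youngAlg_youngSymmetrizer_ne_zero α
  obtain ⟨x, y, hxy⟩ : ∃ x y, youngAlg α (youngSymmetrizer α) x y ≠ 0 := by
    by_contra hc
    push Not at hc
    exact h0 (Matrix.ext hc)
  obtain ⟨a, ha, ha'⟩ := exists_youngAlg_eq_single α x y
  obtain ⟨e, he⟩ := exists_youngSymmetrizer_mul_mul α a
  have h1 := congrArg (youngAlg α) he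
  have h2 := congrArg (youngAlg β) he
  simp only [map_mul, map_smul] at h1 h2
  rw [ha' β h, Matrix.mul_zero, Matrix.zero_mul] at h2
  have h3 := congrFun (congrFun h1 x) y
  rw [Matrix.mul_apply] at h3
  simp only [Matrix.mul_apply, ha, Matrix.smul_apply, smul_eq_mul, mul_ite, mul_one, mul_zero,
    ite_and, Finset.sum_ite_eq', Finset.mem_univ, if_true, ite_mul, zero_mul] at h3
  have h4 : e ≠ 0 := by
    rintro rfl
    rw [zero_mul] at h3
    simp [hxy] at h3
  exact (smul_eq_zero.1 h2.symm).resolve_left h4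

theorem trace_youngAlg (α : n.Partition) (a : MonoidAlgebra ℂ (Perm (Fin n))) :
    (youngAlg α a).trace = ∑ w, a.coeff w * youngChar α w := by
  rw [youngAlg_apply, Matrix.trace_sum]
  simp [youngChar]

/-- By the expansion of the delta function at 1, the coefficient 1 of c_α at the identity is a
combination of its traces in all blocks, and only block `α` contributes. -/
theorem trace_youngAlg_youngSymmetrizer_ne_zero (α : n.Partition) :
    (youngAlg α (youngSymmetrizer α)).trace ≠ 0 := by
  intro h0
  have h1 : ∀ w : Perm (Fin n), (if w = 1 then (1 : ℂ) else 0) =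
      ∑ β, ((n.factorial : ℂ)⁻¹ * youngChar β 1) * youngChar β w := by
    intro w
    have := eq_sum_youngChar (fun w : Perm (Fin n) => if w = 1 then (1 : ℂ) else 0)
      (fun v w => by simp only [conj_eq_one_iff]) w
    simpa using this
  have h2 : ∑ w, (youngSymmetrizer α).coeff w * (if w = 1 then (1 : ℂ) else 0) = 1 := by
    simp [coeff_youngSymmetrizer_one]
  simp only [h1, Finset.mul_sum] at h2
  rw [Finset.sum_comm] at h2
  simp only [mul_left_comm _ (_ * youngChar _ 1)] at h2
  simp only [← Finset.mul_sum, ← trace_youngAlg] at h2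
  rw [Finset.sum_eq_zero] at h2
  · exact zero_ne_one h2
  · intro β _
    by_cases hβ : β = α
    · rw [hβ, h0, mul_zero]
    · rw [youngAlg_youngSymmetrizer_of_ne hβ, Matrix.trace_zero, mul_zero]

/-- The image of c_α in its own block has rank one (`h3`), and the square of a rank one matrix is
its trace times itself. -/
theorem youngSymmetrizer_mul_self (α : n.Partition) :
    youngSymmetrizer α * youngSymmetrizer α =
      (youngAlg α (youngSymmetrizer α)).trace • youngSymmetrizer α := by
  have h0 := youngAlg_youngSymmetrizer_ne_zero α
  obtain ⟨x, y, hxy⟩ : ∃ x y, youngAlg α (youngSymmetrizer α) x y ≠ 0 := by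
    by_contra hc
    push Not at hc
    exact h0 (Matrix.ext hc)
  obtain ⟨a, ha, ha'⟩ := exists_youngAlg_eq_single α x y
  obtain ⟨e, he⟩ := exists_youngSymmetrizer_mul_mul α a
  obtain ⟨κ, hκ⟩ := exists_youngSymmetrizer_mul_mul α 1
  rw [mul_one] at hκ
  have h1 := congrArg (youngAlg α) he
  have h2 := congrArg (youngAlg α) hκ
  simp only [map_mul, map_smul] at h1 h2
  set C := youngAlg α (youngSymmetrizer α) with hC
  have h3 : ∀ z w, C z y * C x w = e * C z w := by
    intro z w
    have h3 := congrFun (congrFun h1 z) w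
    rw [Matrix.mul_apply] at h3
    simpa only [Matrix.mul_apply, ha, Matrix.smul_apply, smul_eq_mul, mul_ite, mul_one, mul_zero,
      ite_and, Finset.sum_ite_eq', Finset.mem_univ, if_true, ite_mul, zero_mul] using h3
  have h4 : C x y = e := mul_right_cancel₀ hxy (h3 x y)
  have h5 := congrFun (congrFun h2 x) y
  rw [Matrix.mul_apply, Matrix.smul_apply, smul_eq_mul] at h5
  simp only [mul_comm (C x _), h3] at h5
  rw [← Finset.mul_sum, ← h4, mul_comm] at h5
  rw [hκ, ← mul_right_cancel₀ hxy h5]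
  rfl

theorem trace_mulLeft_comp_mulRight (g : Perm (Fin n)) (c : MonoidAlgebra ℂ (Perm (Fin n))) :
    LinearMap.trace ℂ _ (LinearMap.mulLeft ℂ (MonoidAlgebra.single g (1 : ℂ)) ∘ₗ
      LinearMap.mulRight ℂ c) = ∑ h, c.coeff (h⁻¹ * g⁻¹ * h) := by
  classical
  rw [LinearMap.trace_eq_matrix_trace ℂ (MonoidAlgebra.basis (Perm (Fin n)) ℂ)]
  simp only [Matrix.trace, Matrix.diag_apply, LinearMap.toMatrix_apply]
  refine Finset.sum_congr rfl fun h _ => ?_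
  rw [MonoidAlgebra.basis_apply]
  change (MonoidAlgebra.single g (1 : ℂ) * (MonoidAlgebra.single h 1 * c)).coeff h = _
  rw [MonoidAlgebra.coeff_single_mul_apply, MonoidAlgebra.coeff_single_mul_apply, one_mul, one_mul,
    mul_assoc]

/-- Right multiplication by c_α divided by its trace projects the group algebra onto the Specht
module. The character is thus the trace, on the whole algebra, of left multiplication by `g`
followed by this projection. -/
theorem irrChar_eq_sum (α : n.Partition) (g : Perm (Fin n)) :
    irrChar α g = (youngAlg α (youngSymmetrizer α)).trace⁻¹ *
      ∑ h, (youngSymmetrizer α).coeff (h⁻¹ * g⁻¹ * h) := by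
  have h0 := trace_youngAlg_youngSymmetrizer_ne_zero α
  rw [← trace_mulLeft_comp_mulRight, ← smul_eq_mul, ← map_smul]
  have hmem : ∀ x, ((youngAlg α (youngSymmetrizer α)).trace⁻¹ •
      (LinearMap.mulLeft ℂ (MonoidAlgebra.single g (1 : ℂ)) ∘ₗ
        LinearMap.mulRight ℂ (youngSymmetrizer α))) x ∈
      LinearMap.range (LinearMap.mulRight ℂ (youngSymmetrizer α)) := by
    intro x
    refine ⟨(youngAlg α (youngSymmetrizer α)).trace⁻¹ • (MonoidAlgebra.single g 1 * x), ?_⟩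
    simp [mul_assoc]
  rw [← LinearMap.trace_restrict_eq_of_forall_mem _ _ hmem, irrChar]
  change LinearMap.trace ℂ _ (spechtRep α g) = _
  congr 1
  ext x : 2
  obtain ⟨x, z, rfl⟩ := x
  simp only [spechtRep, MonoidHom.coe_mk, OneHom.coe_mk, LinearMap.coe_restrict_apply,
    LinearMap.mulLeft_apply, LinearMap.mulRight_apply, LinearMap.smul_apply, LinearMap.comp_apply]
  rw [mul_assoc z, youngSymmetrizer_mul_self, mul_smul_comm, mul_smul_comm, smul_smul,
    inv_mul_cancel₀ h0, one_smul]

/-- The Specht module affords the character of Young's seminormal representation. -/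
theorem irrChar_eq_youngChar (α : n.Partition) : irrChar α = youngChar α := by
  have h0 := trace_youngAlg_youngSymmetrizer_ne_zero α
  have hn : (n.factorial : ℂ) ≠ 0 := by exact_mod_cast Nat.factorial_ne_zero n
  have hcl : ∀ v w, irrChar α (v * w * v⁻¹) = irrChar α w := by
    intro v w
    rw [irrChar_eq_sum, irrChar_eq_sum]
    congr 1
    refine Fintype.sum_equiv (Equiv.mulLeft v⁻¹) _ _ fun h => ?_
    simp [mul_assoc]
  -- The pairing with `youngChar β` is n! tr ρ_β(c_α) / tr ρ_α(c_α), which vanishes for β ≠ α.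
  have hm : ∀ β, ∑ v, irrChar α v * youngChar β v⁻¹ =
      n.factorial * (if β = α then 1 else 0) := by
    intro β
    have h1 : ∀ h : Perm (Fin n), ∑ v, (youngSymmetrizer α).coeff (h⁻¹ * v⁻¹ * h) *
        youngChar β v⁻¹ = (youngAlg β (youngSymmetrizer α)).trace := by
      intro h
      rw [trace_youngAlg]
      refine Fintype.sum_equiv ((Equiv.inv _).trans (MulAut.conj h⁻¹).toEquiv) _ _ fun v => ?_
      have := youngChar_conj β h⁻¹ v⁻¹
      rw [inv_inv] at this
      simp [this]
    simp only [irrChar_eq_sum, mul_assoc, Finset.sum_mul]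
    rw [← Finset.mul_sum, Finset.sum_comm]
    simp only [← mul_assoc, h1]
    simp only [Finset.sum_const, Finset.card_univ, Fintype.card_perm, Fintype.card_fin,
      nsmul_eq_mul]
    by_cases hβ : β = α
    · subst hβ
      rw [if_pos rfl]
      field_simp
    · rw [youngAlg_youngSymmetrizer_of_ne hβ, if_neg hβ]
      simp
  funext w
  rw [eq_sum_youngChar (irrChar α) hcl w]
  simp only [hm, inv_mul_cancel_left₀ hn]
  simp

end YoungSymmetrizer

/-! ### Orientation signs on the centralizer of an involution -/

section CentralizerSign

variable {n : ℕ}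

theorem invSign_longest (y : Perm (Fin n)) :
    invSign (w₀ n) y = (-1) ^ (Finset.univ.filter fun i => i < y i).card := by
  unfold invSign
  rw [← Finset.prod_const]
  refine Finset.prod_congr rfl fun i hi => if_pos ?_
  rw [Finset.mem_filter] at hi
  exact Fin.rev_lt_rev.2 hi.2

theorem invSign_longest_conj (g : Perm (Fin n)) {y : Perm (Fin n)} (hy : y ^ 2 = 1) :
    invSign (w₀ n) (g * y * g⁻¹) = invSign (w₀ n) y := by
  have := invSign_prod_conj g y hy (fun _ _ => -1) fun _ _ => rfl
  rw [Finset.prod_const, Finset.prod_const] at this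
  rw [invSign_longest, invSign_longest, this]

theorem invSign_swap_of_apply {y : Perm (Fin n)} {k : Fin n} (hy : y ^ 2 = 1) (hk : k < y k) :
    invSign (swap k (y k)) y = -1 := by
  have hyy := inv_apply_apply hy
  unfold invSign
  rw [Finset.prod_eq_single_of_mem k (by simpa using hk)]
  · rw [Equiv.swap_apply_left, Equiv.swap_apply_right, if_pos hk]
  · intro i hi hik
    rw [Finset.mem_filter] at hi
    have h1 : i ≠ y k := by
      rintro rfl
      rw [hyy] at hi
      exact absurd hi.2 hk.not_gt
    have h2 : y i ≠ k := fun e => h1 (by rw [← e, hyy])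
    rw [Equiv.swap_apply_of_ne_of_ne hik h1,
      Equiv.swap_apply_of_ne_of_ne h2 fun e => hik (y.injective e), if_neg hi.2.not_gt]

/-- Exchanging two two-cycles either preserves both orientations or reverses both, according to
which end of the second cycle is `m`. -/
theorem invSign_swap_mul_swap {y : Perm (Fin n)} {k m : Fin n} (hy : y ^ 2 = 1) (hk : k < y k)
    (hm : m ≠ y m) (hkm : k ≠ m) (hym : y k ≠ m) :
    invSign (swap k m * swap (y k) (y m)) y = 1 := by
  have hyy := inv_apply_apply hy
  have hkym : k ≠ y m := fun e => hym (by rw [e, hyy])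
  have hykm : y k ≠ y m := fun e => hkm (y.injective e)
  have ek : (swap k m * swap (y k) (y m)) k = m := by
    rw [Equiv.Perm.mul_apply, Equiv.swap_apply_of_ne_of_ne hk.ne hkym, Equiv.swap_apply_left]
  have eyk : (swap k m * swap (y k) (y m)) (y k) = y m := by
    rw [Equiv.Perm.mul_apply, Equiv.swap_apply_left, Equiv.swap_apply_of_ne_of_ne hkym.symm hm.symm]
  have em : (swap k m * swap (y k) (y m)) m = k := by
    rw [Equiv.Perm.mul_apply, Equiv.swap_apply_of_ne_of_ne hym.symm hm, Equiv.swap_apply_right]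
  have eym : (swap k m * swap (y k) (y m)) (y m) = y k := by
    rw [Equiv.Perm.mul_apply, Equiv.swap_apply_right, Equiv.swap_apply_of_ne_of_ne hk.ne' hym]
  have eo : ∀ i, i ≠ k → i ≠ m → i ≠ y k → i ≠ y m →
      (swap k m * swap (y k) (y m)) i = i := by
    intro i h1 h2 h3 h4
    rw [Equiv.Perm.mul_apply, Equiv.swap_apply_of_ne_of_ne h3 h4,
      Equiv.swap_apply_of_ne_of_ne h1 h2]
  have hother : ∀ i, i < y i → i ≠ k → i ≠ m → i ≠ y m →
      (if (swap k m * swap (y k) (y m)) (y i) < (swap k m * swap (y k) (y m)) i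
        then (-1 : ℚ) else 1) = 1 := by
    intro i hi h1 h2 h4
    have h3 : i ≠ y k := by
      rintro rfl
      rw [hyy] at hi
      exact absurd hi hk.not_gt
    rw [eo i h1 h2 h3 h4, eo (y i) (fun e => h3 (by rw [← e, hyy])) (fun e => h4 (by rw [← e, hyy]))
      (fun e => h1 (y.injective e)) (fun e => h2 (y.injective e)), if_neg hi.not_gt]
  unfold invSign
  rcases lt_or_gt_of_ne hm with h | h
  · rw [Finset.prod_eq_mul_of_mem k m (by simpa using hk) (by simpa using h) hkm]
    · rw [ek, eyk, em, eym, if_neg h.not_gt, if_neg hk.not_gt, one_mul]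
    · intro i hi hne
      rw [Finset.mem_filter] at hi
      refine hother i hi.2 hne.1 hne.2 ?_
      rintro rfl
      rw [hyy] at hi
      exact absurd hi.2 h.not_gt
  · rw [Finset.prod_eq_mul_of_mem k (y m) (by simpa using hk) (by simpa [hyy] using h) hkym]
    · rw [ek, eyk, hyy, em, eym, if_pos h, if_pos hk]; norm_num
    · intro i hi hne
      rw [Finset.mem_filter] at hi
      refine hother i hi.2 hne.1 ?_ hne.2
      rintro rfl
      exact absurd hi.2 h.not_gt

/-- On the part of the centralizer of an involution `y` which fixes all fixed points of `y`, the
sign counts the two-cycles of `y` whose orientation is reversed. -/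
theorem sign_mul_invSign {y : Perm (Fin n)} (hy : y ^ 2 = 1) (q : Perm (Fin n))
    (hq : ∀ k, q (y k) = y (q k)) (hfix : ∀ k, y k = k → q k = k) :
    ((Equiv.Perm.sign q : ℤ) : ℚ) * invSign q y = 1 := by
  have hyy := inv_apply_apply hy
  induction hl : (Finset.univ.filter fun k => q k ≠ k).card using Nat.strong_induction_on
    generalizing q with
  | _ N ih =>
  subst hl
  by_cases h1 : q = 1
  · subst h1
    rw [invSign_one]; simp
  obtain ⟨k, hqk, hk⟩ : ∃ k, q k ≠ k ∧ k < y k := by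
    obtain ⟨k, hk⟩ : ∃ k, q k ≠ k := by
      by_contra hc
      push Not at hc
      exact h1 (Equiv.ext hc)
    rcases lt_or_gt_of_ne (fun e => hk (hfix k e) : y k ≠ k) with h | h
    · refine ⟨y k, ?_, by rwa [hyy]⟩
      rw [hq]
      exact fun e => hk (y.injective e)
    · exact ⟨k, hk, h⟩
  -- Strip off a factor `τ` of the centralizer which makes `k` a fixed point and satisfies the claim
  -- itself; both signs are multiplicative.
  have step : ∀ τ : Perm (Fin n), (∀ i, τ (y i) = y (τ i)) → (∀ i, q i = i → τ i = i) →
      τ (q k) = k →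
      ((Equiv.Perm.sign τ : ℤ) : ℚ) * invSign τ⁻¹ y = 1 →
      ((Equiv.Perm.sign q : ℤ) : ℚ) * invSign q y = 1 := by
    intro τ hτ h2 h3 h5
    have hc : ∀ i, (τ * q) (y i) = y ((τ * q) i) := fun i => by
      rw [Equiv.Perm.mul_apply, hq, hτ, Equiv.Perm.mul_apply]
    have hsub : (Finset.univ.filter fun i => (τ * q) i ≠ i) ⊂
        Finset.univ.filter fun i => q i ≠ i := by
      refine (Finset.ssubset_iff_of_subset fun i hi => ?_).2
        ⟨k, by simpa using hqk, fun h => (Finset.mem_filter.1 h).2 h3⟩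
      simp only [Finset.mem_filter, Finset.mem_univ, true_and] at hi ⊢
      exact fun e => hi (by rw [Equiv.Perm.mul_apply, e, h2 i e])
    have h6 := ih _ (Finset.card_lt_card hsub) (τ * q) hc
      (fun i hi => by rw [Equiv.Perm.mul_apply, hfix i hi]; exact h2 i (hfix i hi)) rfl
    have e : q = τ⁻¹ * (τ * q) := by group
    have hcy : (τ * q) * y * (τ * q)⁻¹ = y := by
      rw [mul_inv_eq_iff_eq_mul]
      exact Equiv.ext hc
    rw [e, invSign_mul _ _ _ hy, hcy, map_mul, Equiv.Perm.sign_inv]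
    push_cast
    linear_combination invSign τ⁻¹ y * ((Equiv.Perm.sign τ : ℤ) : ℚ) * h6 + h5
  -- Either `q` flips the two-cycle of `k` and `τ` is that transposition, or `q` moves it to another
  -- two-cycle and `τ` exchanges the two cycles.
  by_cases hm : q k = y k
  · have hyk : q (y k) = k := by rw [hq, hm, hyy]
    refine step (swap k (y k)) ?_ ?_ ?_ ?_
    · intro i
      by_cases h2 : i = k
      · subst h2; rw [Equiv.swap_apply_right, Equiv.swap_apply_left, hyy]
      by_cases h3 : i = y k
      · subst h3; rw [hyy, Equiv.swap_apply_right, Equiv.swap_apply_left]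
      rw [Equiv.swap_apply_of_ne_of_ne h2 h3, Equiv.swap_apply_of_ne_of_ne
        (fun e => h3 (by rw [← e, hyy])) (fun e => h2 (y.injective e))]
    · intro i hi
      refine Equiv.swap_apply_of_ne_of_ne ?_ ?_
      · rintro rfl; exact hqk hi
      · rintro rfl; rw [hyk] at hi; exact hk.ne hi
    · rw [hm, Equiv.swap_apply_right]
    · rw [Equiv.swap_inv, invSign_swap_of_apply hy hk, Equiv.Perm.sign_swap hk.ne]
      norm_num
  · have hyk : q (y k) = y (q k) := hq k
    have hkm : k ≠ q k := hqk.symm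
    have hmy : q k ≠ y (q k) := fun e => hk.ne (q.injective (by rw [hyk, ← e]))
    have hkym : k ≠ y (q k) := fun e => hm (by rw [e, hyy, ← e])
    have hykm : y k ≠ y (q k) := fun e => hkm (y.injective e)
    have hcomm : swap k (q k) * swap (y k) (y (q k)) = swap (y k) (y (q k)) * swap k (q k) := by
      refine (Equiv.Perm.disjoint_swap_swap ?_).commute
      simp [hkm, hk.ne, hkym, hykm, hmy, hm]
    refine step (swap k (q k) * swap (y k) (y (q k))) ?_ ?_ ?_ ?_
    · have h2 := Equiv.mul_swap_eq_swap_mul y k (q k)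
      have h3 := Equiv.mul_swap_eq_swap_mul y (y k) (y (q k))
      rw [hyy, hyy] at h3
      have h4 : swap k (q k) * swap (y k) (y (q k)) * y =
          y * (swap k (q k) * swap (y k) (y (q k))) := by
        rw [← mul_assoc, h2, mul_assoc (swap (y k) (y (q k))) y, h3, ← mul_assoc, hcomm]
      exact fun i => Equiv.congr_fun h4 i
    · intro i hi
      have h1 : i ≠ k := by rintro rfl; exact hqk hi
      have h2 : i ≠ q k := by rintro rfl; exact hqk (q.injective hi)
      have h3 : i ≠ y k := by rintro rfl; rw [hyk] at hi; exact hykm hi.symm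
      have h4 : i ≠ y (q k) := by
        intro e
        rw [← hyk] at e
        rw [e] at hi
        have := q.injective hi
        rw [hyk] at this
        exact hykm this.symm
      rw [Equiv.Perm.mul_apply, Equiv.swap_apply_of_ne_of_ne h3 h4,
        Equiv.swap_apply_of_ne_of_ne h1 h2]
    · rw [Equiv.Perm.mul_apply, Equiv.swap_apply_of_ne_of_ne hm hmy, Equiv.swap_apply_right]
    · rw [mul_inv_rev, Equiv.swap_inv, Equiv.swap_inv, ← hcomm,
        invSign_swap_mul_swap hy hk hmy hkm (Ne.symm hm), map_mul, Equiv.Perm.sign_swap hkm,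
        Equiv.Perm.sign_swap hykm]
      norm_num

end CentralizerSign

/-! ### The domino involution of a diagram -/

section Dominoes

variable {n : ℕ} {t : Fin n → ℕ × ℕ}

/-- The involution of the rows which exchanges `2i` and `2i + 1`. -/
def rowFlip (r : ℕ) : ℕ := if r % 2 = 0 then r + 1 else r - 1

theorem rowFlip_rowFlip (r : ℕ) : rowFlip (rowFlip r) = r := by
  unfold rowFlip; split_ifs <;> omega

open Classical in
/-- The entry in the other half of the vertical domino through the cell of `k`. -/
noncomputable def dominoFun (t : Fin n → ℕ × ℕ) (k : Fin n) : Fin n :=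
  if h : ∃ j, t j = (rowFlip (t k).1, (t k).2) then h.choose else k

theorem dominoFun_eq (ht : IsShape t) {k j : Fin n} (h : t j = (rowFlip (t k).1, (t k).2)) :
    dominoFun t k = j := by
  have h' : ∃ j, t j = (rowFlip (t k).1, (t k).2) := ⟨j, h⟩
  rw [dominoFun, dif_pos h']
  exact ht.inj (h'.choose_spec.trans h.symm)

theorem dominoFun_cases (t : Fin n → ℕ × ℕ) (k : Fin n) :
    t (dominoFun t k) = (rowFlip (t k).1, (t k).2) ∨
      ((¬ ∃ j, t j = (rowFlip (t k).1, (t k).2)) ∧ dominoFun t k = k) := by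
  by_cases h : ∃ j, t j = (rowFlip (t k).1, (t k).2)
  · left
    rw [dominoFun, dif_pos h]
    exact h.choose_spec
  · right
    exact ⟨h, by rw [dominoFun, dif_neg h]⟩

theorem dominoFun_involutive (ht : IsShape t) : Function.Involutive (dominoFun t) := by
  intro k
  rcases dominoFun_cases t k with h | ⟨_, h⟩
  · refine dominoFun_eq ht ?_
    rw [h, rowFlip_rowFlip]
  · rw [h, h]

/-- The involution which exchanges the entries of the vertical dominoes in the rows `2i` and
`2i + 1`. -/
noncomputable def domino (ht : IsShape t) : Perm (Fin n) := (dominoFun_involutive ht).toPerm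

theorem domino_sq (ht : IsShape t) : domino ht ^ 2 = 1 := by
  ext k : 1
  rw [pow_two]
  exact dominoFun_involutive ht k

theorem cell_domino (ht : IsShape t) {k : Fin n} (h : domino ht k ≠ k) :
    t (domino ht k) = (rowFlip (t k).1, (t k).2) :=
  (dominoFun_cases t k).resolve_right fun h' => h h'.2

theorem domino_eq (ht : IsShape t) {k j : Fin n} (h : t j = (rowFlip (t k).1, (t k).2)) :
    domino ht k = j := dominoFun_eq ht h

theorem row_even_of_lt_domino (ht : IsShape t) {k : Fin n} (h : k < domino ht k) :
    (t k).1 % 2 = 0 := by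
  have h1 := cell_domino ht h.ne'
  have h2 := ht.lex _ _ h
  rw [h1] at h2
  simp only [rowFlip] at h2
  split_ifs at h2 <;> omega

/-- A cell in an odd row always has its partner, the cell directly above. -/
theorem row_odd_iff (ht : IsShape t) {k : Fin n} : (t k).1 % 2 = 1 ↔ domino ht k < k := by
  constructor
  · intro h
    obtain ⟨j, hj⟩ := ht.lower k ((t k).1 - 1, (t k).2) (Prod.le_def.2 ⟨Nat.sub_le _ _, le_rfl⟩)
    have : domino ht k = j := domino_eq ht (by rw [hj, rowFlip, if_neg (by omega)])
    rw [this]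
    exact ht.lt_of_row_lt (by rw [hj]; simp only; omega)
  · intro h
    have h1 := cell_domino ht h.ne
    have h2 := ht.lex _ _ h
    rw [h1] at h2
    simp only [rowFlip] at h2
    split_ifs at h2 <;> omega

/-- Two-cycles correspond to cells in odd rows, and their number has the parity of the sum of all
row indices. -/
theorem invSign_longest_domino (ht : IsShape t) :
    invSign (w₀ n) (domino ht) = (-1) ^ ∑ k, (t k).1 := by
  have hyy := inv_apply_apply (domino_sq ht)
  rw [invSign_longest]
  have e1 : (Finset.univ.filter fun i => i < domino ht i).card =
      (Finset.univ.filter fun k => (t k).1 % 2 = 1).card := by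
    refine Finset.card_nbij' (fun i => domino ht i) (fun i => domino ht i) ?_ ?_ ?_ ?_
    · intro i hi
      simp only [Finset.coe_filter, Finset.mem_univ, true_and, Set.mem_ofPred_eq] at hi ⊢
      rw [row_odd_iff ht, hyy]; exact hi
    · intro i hi
      simp only [Finset.coe_filter, Finset.mem_univ, true_and, Set.mem_ofPred_eq] at hi ⊢
      rw [row_odd_iff ht] at hi
      rwa [hyy]
    · intro i _; exact hyy i
    · intro i _; exact hyy i
  rw [e1, ← Finset.prod_pow_eq_pow_sum, ← Finset.prod_const, Finset.prod_filter]
  refine Finset.prod_congr rfl fun k _ => ?_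
  split_ifs with h
  · rw [Odd.neg_one_pow (Nat.odd_iff.2 h)]
  · rw [Even.neg_one_pow (Nat.even_iff.2 (by omega))]

/-- Only the bottom cell of a column of odd length is unpaired. -/
theorem domino_fixed_unique (ht : IsShape t) {j k : Fin n} (hj : domino ht j = j)
    (hk : domino ht k = k) (h : (t j).2 = (t k).2) : j = k := by
  have key : ∀ j k : Fin n, domino ht j = j → domino ht k = k → (t j).2 = (t k).2 →
      (t k).1 ≤ (t j).1 := by
    intro j k hj hk h
    by_contra hc
    have hev : (t j).1 % 2 = 0 := by
      by_contra h1
      exact ((row_odd_iff ht).1 (by omega : (t j).1 % 2 = 1)).ne hj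
    obtain ⟨l, hl⟩ := ht.lower k ((t j).1 + 1, (t j).2)
      (Prod.le_def.2 ⟨by simp only; omega, h.le⟩)
    have h2 : domino ht j = l := domino_eq ht (by rw [hl, rowFlip, if_pos hev])
    rw [← h2, hj] at hl
    have := congrArg Prod.fst hl
    simp at this
  exact ht.inj (Prod.ext (le_antisymm (key k j hk hj h.symm) (key j k hj hk h)) h)

theorem invSign_row_domino (ht : IsShape t) {p : Perm (Fin n)} (hp : ∀ k, (t (p k)).1 = (t k).1) :
    invSign p (domino ht) = 1 := by
  unfold invSign
  refine Finset.prod_eq_one fun i hi => if_neg ?_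
  rw [Finset.mem_filter] at hi
  have h1 := row_even_of_lt_domino ht hi.2
  have h2 := cell_domino ht hi.2.ne'
  refine (ht.lt_of_row_lt ?_).not_gt
  rw [hp, hp, h2, rowFlip, if_pos h1]
  exact Nat.lt_succ_self _

/-- Contributions of the Young symmetrizer to the coefficient of the domino involution have no
cancellation. -/
theorem sign_mul_invSign_domino (ht : IsShape t) {p q : Perm (Fin n)}
    (hp : ∀ k, (t (p k)).1 = (t k).1) (hq : ∀ k, (t (q k)).2 = (t k).2)
    (hpq : ∀ k, (p * q) (domino ht k) = domino ht ((p * q) k)) :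
    ((Equiv.Perm.sign q : ℤ) : ℚ) * invSign (p * q) (domino ht) = 1 := by
  -- Since `p` preserves rows and `q` preserves columns, the cell of `q` applied to the partner of
  -- `k` is known: its row comes from `p * q`, its column from `k`.
  have hmoved : ∀ k, domino ht k ≠ k → q (domino ht k) = domino ht (q k) := by
    intro k hk
    have h1 : domino ht ((p * q) k) ≠ (p * q) k := by
      rw [← hpq]
      exact fun e => hk ((p * q).injective e)
    have h2 := cell_domino ht h1
    rw [← hpq] at h2
    have h3 := congrArg Prod.fst h2
    simp only [Equiv.Perm.mul_apply, hp] at h3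
    refine (domino_eq ht (Prod.ext h3 ?_)).symm
    rw [hq, cell_domino ht hk, hq]
  -- `q` maps the finite set of paired entries into itself, hence also its complement.
  have hfixed : ∀ k, domino ht k = k → domino ht (q k) = q k := by
    have hm : ∀ k, k ∈ (Finset.univ.filter fun k => domino ht k ≠ k) →
        q k ∈ (Finset.univ.filter fun k => domino ht k ≠ k) := by
      intro k hk
      simp only [Finset.mem_filter, Finset.mem_univ, true_and] at hk ⊢
      rw [← hmoved k hk]
      exact fun e => hk (q.injective e)
    intro k hk
    by_contra hc
    obtain ⟨l, hl, e⟩ := Finset.surj_on_of_inj_on_of_card_le (fun k _ => q k) hm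
      (fun _ _ _ _ e => q.injective e) le_rfl (q k) (by simpa using hc)
    have : l = k := (q.injective e).symm
    subst this
    simp [hk] at hl
  have hqfix : ∀ k, domino ht k = k → q k = k := fun k hk =>
    domino_fixed_unique ht (hfixed k hk) hk (hq k)
  have hqc : ∀ k, q (domino ht k) = domino ht (q k) := by
    intro k
    by_cases hk : domino ht k = k
    · rw [hfixed k hk, hk]
    · exact hmoved k hk
  have hc : q * domino ht * q⁻¹ = domino ht := by
    rw [mul_inv_eq_iff_eq_mul]
    exact Equiv.ext hqc
  rw [invSign_mul _ _ _ (domino_sq ht), hc, invSign_row_domino ht hp, one_mul]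
  exact sign_mul_invSign (domino_sq ht) q hqc hqfix

end Dominoes

/-! ### Multiplicities in the even and odd parts of the involution module -/

section ParityRep

variable {n : ℕ}

/-- The part of the involution module spanned by the involutions whose number of two-cycles has a
given parity. -/
noncomputable def parityRep (e : ℚ) (g : Perm (Fin n)) : Matrix (Inv n) (Inv n) ℂ :=
  Matrix.of fun y' y => if invSign (w₀ n) y.1 = e ∧ y' = Inv.map (MulAut.conj g) y
    then (invSign g y.1 : ℂ) else 0

theorem parityRep_mul (e : ℚ) (g h : Perm (Fin n)) :
    parityRep e g * parityRep e h = parityRep e (g * h) := by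
  ext y' y
  rw [Matrix.mul_apply, Finset.sum_eq_single (Inv.map (MulAut.conj h) y)]
  · have h1 : invSign (w₀ n) (Inv.map (MulAut.conj h) y).1 = invSign (w₀ n) y.1 :=
      invSign_longest_conj h y.2
    have h2 : Inv.map (MulAut.conj g) (Inv.map (MulAut.conj h) y) =
        Inv.map (MulAut.conj (g * h)) y := by
      simp [Inv.map]
    have h3 := invSign_mul g h y.1 y.2
    simp only [parityRep, Matrix.of_apply, h1, h2, h3]
    by_cases he : invSign (w₀ n) y.1 = e
    · by_cases hy : y' = Inv.map (MulAut.conj (g * h)) y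
      · simp only [he, hy, true_and, if_true]
        push_cast
        rfl
      · simp only [hy, and_false, if_false, zero_mul]
    · simp only [he, false_and, if_false, zero_mul]
  · intro z _ hz
    simp only [parityRep, Matrix.of_apply]
    rw [if_neg (fun hh : invSign (w₀ n) y.1 = e ∧ z = Inv.map (MulAut.conj h) y => hz hh.2),
      mul_zero]
  · intro h'; exact absurd (Finset.mem_univ _) h'

/-- The identity acts by the projection to one parity part; this is why `IsHecke` does not require a
unit. -/
theorem isHecke_parityRep (e : ℚ) : IsHecke (1 : ℂ) (parityRep (n := n) e) where
  one_mul w := by rw [parityRep_mul, one_mul]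
  mul_of_lt i j w _ _ := parityRep_mul _ _ _
  mul_of_gt i j w _ _ := by rw [parityRep_mul, one_smul, sub_self, zero_smul, add_zero]

theorem sum_coeff_youngSymmetrizer {M : Type*} [AddCommGroup M] [Module ℂ M] (α : n.Partition)
    (f : Perm (Fin n) → M) : ∑ w, (youngSymmetrizer α).coeff w • f w =
      ∑ p ∈ rowStab α, ∑ q ∈ colStab α, ((Equiv.Perm.sign q : ℤ) : ℂ) • f (p * q) := by
  classical
  rw [youngSymmetrizer_eq, rowSum, colSum, Finset.sum_mul_sum]
  simp only [MonoidAlgebra.single_mul_single, MonoidAlgebra.coeff_sum, Finsupp.finsetSum_apply,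
    MonoidAlgebra.coeff_single, Finsupp.single_apply, one_mul, Finset.sum_smul]
  rw [Finset.sum_comm]
  refine Finset.sum_congr rfl fun p _ => ?_
  rw [Finset.sum_comm]
  refine Finset.sum_congr rfl fun q _ => ?_
  simp

/-- The diagonal entry at the domino involution counts the pairs (p, q) whose product centralizes
it, and (1, 1) is one of them. -/
theorem sum_coeff_youngSymmetrizer_parityRep_ne_zero (α : n.Partition) :
    ∑ w, (youngSymmetrizer α).coeff w •
      parityRep ((-1) ^ ∑ k, (tableau α k).1) w ≠ 0 := by
  classical
  intro h0
  set y : Inv n := ⟨domino (isShape_tableau α), domino_sq _⟩ with hy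
  have h1 := congrFun (congrFun h0 y) y
  rw [sum_coeff_youngSymmetrizer] at h1
  have hterm : ∀ p ∈ rowStab α, ∀ q ∈ colStab α, (((Equiv.Perm.sign q : ℤ) : ℂ) •
      parityRep ((-1) ^ ∑ k, (tableau α k).1) (p * q)) y y =
        if y = Inv.map (MulAut.conj (p * q)) y then (1 : ℂ) else 0 := by
    intro p hp q hq
    rw [Matrix.smul_apply, parityRep, Matrix.of_apply]
    have h2 : invSign (w₀ n) y.1 = (-1) ^ ∑ k, (tableau α k).1 :=
      invSign_longest_domino (isShape_tableau α)
    simp only [h2, true_and]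
    split_ifs with h
    · have h3 := sign_mul_invSign_domino (isShape_tableau α) (mem_rowStab.1 hp) (mem_colStab.1 hq)
        (fun k => by
          have h4 := congrArg Subtype.val h
          change domino (isShape_tableau α) = (p * q) * domino (isShape_tableau α) * (p * q)⁻¹ at h4
          rw [eq_mul_inv_iff_mul_eq] at h4
          exact (Equiv.congr_fun h4 k).symm)
      rw [smul_eq_mul]
      exact_mod_cast congrArg (fun x : ℚ => (x : ℂ)) h3
    · rw [smul_zero]
  simp only [Matrix.sum_apply] at h1
  rw [Finset.sum_congr rfl fun p hp => Finset.sum_congr rfl fun q hq => hterm p hp q hq] at h1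
  rw [← Finset.sum_product' (f := fun p q =>
    if y = Inv.map (MulAut.conj (p * q)) y then (1 : ℂ) else 0), Finset.sum_boole,
    Matrix.zero_apply, Nat.cast_eq_zero, Finset.card_eq_zero] at h1
  have h5 : ((1, 1) : Perm (Fin n) × Perm (Fin n)) ∈ (rowStab α ×ˢ colStab α).filter
      (fun x => y = Inv.map (MulAut.conj (x.1 * x.2)) y) := by
    simp [one_mem_rowStab, one_mem_colStab, Inv.map]
  rw [h1] at h5
  simp at h5

/-- Each φ_α occurs in the part of parity n(α) because c_α acts there nontrivially. The total
dimension is the sum of all degrees, so there is no room for any further constituent. -/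
theorem trace_parityRep_sub (w : Perm (Fin n)) :
    (parityRep 1 w).trace - (parityRep (-1) w).trace =
      ∑ α : n.Partition, (-1) ^ (∑ k, (tableau α k).1) * youngChar α w := by
  have hex : ∀ e : ℚ, ∃ m : n.Partition → ℕ,
      (∀ w, (parityRep (n := n) e w).trace = ∑ α, (m α : ℂ) * youngChar α w) ∧
        ∀ α, e = (-1) ^ (∑ k, (tableau α k).1) → m α ≠ 0 := by
    intro e
    obtain ⟨m, hm, hm0⟩ := exists_multiplicity isBracket_one (t := fun α : n.Partition => tableau α)
      isShape_tableau tableau_injective schurElement_one_ne_zero sum_card_sq (isHecke_parityRep e)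
    refine ⟨m, hm, fun α he h => ?_⟩
    have := hm0 α h (fun w => (youngSymmetrizer α).coeff w) fun β hβ => by
      have := youngAlg_youngSymmetrizer_of_ne hβ
      rw [youngAlg_apply] at this
      exact this
    rw [he] at this
    exact sum_coeff_youngSymmetrizer_parityRep_ne_zero α this
  obtain ⟨m, hm, hm0⟩ := hex 1
  obtain ⟨m', hm', hm0'⟩ := hex (-1)
  have hdim : ∑ α : n.Partition, (m α + m' α) * Fintype.card (SYT (tableau α)) =
      ∑ α : n.Partition, Fintype.card (SYT (tableau α)) := by
    rw [← card_inv_eq_sum_card, ← Nat.cast_inj (R := ℂ)]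
    have h1 := hm 1
    have h2 := hm' 1
    simp only [youngChar_one] at h1 h2
    push_cast
    simp only [add_mul, Finset.sum_add_distrib]
    rw [← h1, ← h2, ← Matrix.trace_add]
    have h3 : parityRep (n := n) 1 1 + parityRep (-1) 1 = 1 := by
      ext y' y
      simp only [parityRep, Matrix.add_apply, Matrix.of_apply, invSign_one, Matrix.one_apply]
      have h4 : Inv.map (MulAut.conj (1 : Perm (Fin n))) y = y := by simp [Inv.map]
      rw [h4]
      rcases neg_one_pow_eq_or ℚ (Finset.univ.filter fun i => i < y.1 i).card with h | h <;>
        rw [invSign_longest, h] <;> norm_num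
    rw [h3, Matrix.trace_one]
  have hpos : ∀ α : n.Partition, 1 ≤ m α + m' α := by
    intro α
    rcases neg_one_pow_eq_or ℚ (∑ k, (tableau α k).1) with h | h
    · have := hm0 α h.symm
      omega
    · have := hm0' α h.symm
      omega
  have hone : ∀ α : n.Partition, m α + m' α = 1 := by
    intro α
    have h1 := (Finset.sum_eq_sum_iff_of_le (s := Finset.univ)
      (f := fun α : n.Partition => Fintype.card (SYT (tableau α)))
      (g := fun α => (m α + m' α) * Fintype.card (SYT (tableau α)))
      fun α _ => Nat.le_mul_of_pos_left _ (hpos α)).1 hdim.symm α (Finset.mem_univ _)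
    have h2 : 0 < Fintype.card (SYT (tableau α)) :=
      Fintype.card_pos_iff.2 ⟨rowSYT (isShape_tableau α)⟩
    nlinarith [hpos α]
  rw [hm, hm', ← Finset.sum_sub_distrib]
  refine Finset.sum_congr rfl fun α _ => ?_
  rw [← sub_mul]
  congr 1
  rcases Nat.even_or_odd (∑ k, (tableau α k).1) with h | h
  · have h1 := hm0 α (by rw [h.neg_one_pow])
    have h2 : m α = 1 ∧ m' α = 0 := by have := hone α; omega
    rw [h2.1, h2.2, h.neg_one_pow]; simp
  · have h1 := hm0' α (by rw [h.neg_one_pow])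
    have h2 : m α = 0 ∧ m' α = 1 := by have := hone α; omega
    rw [h2.1, h2.2, h.neg_one_pow]; simp

/-- One has wσ = (w w₀)(w₀σ), and w₀σ acts on a_y by +1 or -1 according to the parity of the number
of two-cycles of y. -/
theorem extInvolutionChar_eq_trace (w : Perm (Fin n)) :
    (extInvolutionChar n (ofW w * sg n) : ℂ) =
      (parityRep 1 (w * w₀ n)).trace - (parityRep (-1) (w * w₀ n)).trace := by
  classical
  have h1 : extInvolutionChar n (ofW w * sg n) = ∑ y : Inv n,
      if y = Inv.map (MulAut.conj (w * w₀ n)) y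
        then invSign (w₀ n) y.1 * invSign (w * w₀ n) y.1 else 0 := by
    change LinearMap.trace ℚ _ (extInvolutionRep n (ofW w * sg n)) = _
    rw [LinearMap.trace_eq_matrix_trace ℚ Finsupp.basisSingleOne]
    simp only [Matrix.trace, Matrix.diag_apply, LinearMap.toMatrix_apply,
      Finsupp.coe_basisSingleOne, map_mul]
    refine Finset.sum_congr rfl fun y _ => ?_
    have h2 : extInvolutionRep n (sg n) (Finsupp.single y 1) =
        Finsupp.single (Inv.map (graphAut n) y) 1 := extInvolutionRep_sg y
    have h3 : extInvolutionRep n (ofW w) (Finsupp.single (Inv.map (graphAut n) y) 1) =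
        Finsupp.single (Inv.map (MulAut.conj (w * w₀ n)) y)
          (invSign w (w₀ n * y.1 * (w₀ n)⁻¹)) := by
      rw [extInvolutionRep_ofW]
      simp [involutionRep, Inv.map, graphAut]
    have h4 := invSign_mul w (w₀ n) y.1 y.2
    have h5 : invSign (w₀ n) y.1 * invSign (w₀ n) y.1 = 1 := by
      rw [invSign_longest, ← mul_pow]; simp
    rw [Module.End.mul_apply, h2, h3]
    change (Finsupp.single (Inv.map (MulAut.conj (w * w₀ n)) y)
          (invSign w (w₀ n * y.1 * (w₀ n)⁻¹))) y = _
    rw [Finsupp.single_apply]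
    simp only [eq_comm (b := y)]
    congr 1
    rw [h4]
    linear_combination -invSign w (w₀ n * y.1 * (w₀ n)⁻¹) * h5
  rw [h1, ← Matrix.trace_sub]
  push_cast
  refine Finset.sum_congr rfl fun y _ => ?_
  simp only [parityRep, Matrix.diag_apply, Matrix.sub_apply, Matrix.of_apply]
  rcases neg_one_pow_eq_or ℚ (Finset.univ.filter fun i => i < y.1 i).card with h | h <;>
    rw [invSign_longest, h] <;>
    by_cases hy : y = Inv.map (MulAut.conj (w * w₀ n)) y
  · rw [if_pos hy, if_pos ⟨rfl, hy⟩, if_neg fun h' => absurd h'.1 (by norm_num)]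
    simp
  · rw [if_neg hy, if_neg fun h' => hy h'.2, if_neg fun h' => hy h'.2, sub_zero,
      Rat.cast_zero]
  · rw [if_pos hy, if_neg fun h' => absurd h'.1 (by norm_num), if_pos ⟨rfl, hy⟩]
    simp
  · rw [if_neg hy, if_neg fun h' => hy h'.2, if_neg fun h' => hy h'.2, sub_zero,
      Rat.cast_zero]

theorem extInvolutionChar_eq_sum (w : Perm (Fin n)) :
    (extInvolutionChar n (ofW w * sg n) : ℂ) =
      ∑ α : n.Partition, (-1) ^ (∑ k, (tableau α k).1) * irrChar α (w * w₀ n) := by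
  rw [extInvolutionChar_eq_trace, trace_parityRep_sub]
  simp only [irrChar_eq_youngChar]

end ParityRep

/-! ### Values of rational functions at a point -/

section Regular

variable {z : ℂ} {f g : RatFunc ℂ} {a b : ℂ}

/-- The rational function `f` is defined at `z` and has the value `c` there. -/
def HasValue (z : ℂ) (f : RatFunc ℂ) (c : ℂ) : Prop :=
  ∃ p r : Polynomial ℂ, r.eval z ≠ 0 ∧ p.eval z = c * r.eval z ∧
    f * algebraMap _ (RatFunc ℂ) r = algebraMap _ (RatFunc ℂ) p

theorem algebraMap_ne_zero_of_eval {r : Polynomial ℂ} (h : r.eval z ≠ 0) :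
    algebraMap _ (RatFunc ℂ) r ≠ 0 := by
  intro h0
  rw [map_eq_zero_iff _ (RatFunc.algebraMap_injective ℂ)] at h0
  rw [h0, Polynomial.eval_zero] at h
  exact h rfl

theorem HasValue.ofPolynomial (z : ℂ) (p : Polynomial ℂ) :
    HasValue z (algebraMap _ (RatFunc ℂ) p) (p.eval z) :=
  ⟨p, 1, by simp, by simp, by simp⟩

theorem HasValue.X (z : ℂ) : HasValue z RatFunc.X z := by
  simpa using HasValue.ofPolynomial z Polynomial.X

theorem HasValue.natCast (z : ℂ) (m : ℕ) : HasValue z (m : RatFunc ℂ) m := by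
  simpa using HasValue.ofPolynomial z (m : Polynomial ℂ)

theorem HasValue.zero (z : ℂ) : HasValue z 0 0 := by
  simpa using HasValue.natCast z 0

theorem HasValue.one (z : ℂ) : HasValue z 1 1 := by
  simpa using HasValue.natCast z 1

theorem HasValue.add (hf : HasValue z f a) (hg : HasValue z g b) : HasValue z (f + g) (a + b) := by
  obtain ⟨p, r, h1, h2, h3⟩ := hf
  obtain ⟨p', r', h1', h2', h3'⟩ := hg
  refine ⟨p * r' + p' * r, r * r', ?_, ?_, ?_⟩
  · rw [Polynomial.eval_mul]; exact mul_ne_zero h1 h1'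
  · simp only [Polynomial.eval_mul, Polynomial.eval_add, h2, h2']; ring
  · simp only [map_mul, map_add, ← h3, ← h3']; ring

theorem HasValue.mul (hf : HasValue z f a) (hg : HasValue z g b) : HasValue z (f * g) (a * b) := by
  obtain ⟨p, r, h1, h2, h3⟩ := hf
  obtain ⟨p', r', h1', h2', h3'⟩ := hg
  refine ⟨p * p', r * r', ?_, ?_, ?_⟩
  · rw [Polynomial.eval_mul]; exact mul_ne_zero h1 h1'
  · simp only [Polynomial.eval_mul, h2, h2']; ring
  · simp only [map_mul, ← h3, ← h3']; ring

theorem HasValue.neg (hf : HasValue z f a) : HasValue z (-f) (-a) := by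
  obtain ⟨p, r, h1, h2, h3⟩ := hf
  exact ⟨-p, r, h1, by simp [h2], by simp [← h3]⟩

theorem HasValue.sub (hf : HasValue z f a) (hg : HasValue z g b) : HasValue z (f - g) (a - b) := by
  rw [sub_eq_add_neg, sub_eq_add_neg]
  exact hf.add hg.neg

theorem HasValue.inv (hf : HasValue z f a) (ha : a ≠ 0) : HasValue z f⁻¹ a⁻¹ := by
  obtain ⟨p, r, h1, h2, h3⟩ := hf
  have hp : p.eval z ≠ 0 := by rw [h2]; exact mul_ne_zero ha h1
  have hr' := algebraMap_ne_zero_of_eval h1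
  have hp' := algebraMap_ne_zero_of_eval hp
  have hf : f ≠ 0 := by
    rintro rfl
    rw [zero_mul] at h3
    exact hp' h3.symm
  refine ⟨r, p, hp, ?_, ?_⟩
  · rw [h2, inv_mul_cancel_left₀ ha]
  · rw [← h3, inv_mul_cancel_left₀ hf]

theorem HasValue.pow (hf : HasValue z f a) (m : ℕ) : HasValue z (f ^ m) (a ^ m) := by
  induction m with
  | zero => simpa using HasValue.one z
  | succ m ih => rw [pow_succ, pow_succ]; exact ih.mul hf

theorem HasValue.sum {ι : Type*} (s : Finset ι) {f : ι → RatFunc ℂ} {c : ι → ℂ}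
    (h : ∀ i ∈ s, HasValue z (f i) (c i)) : HasValue z (∑ i ∈ s, f i) (∑ i ∈ s, c i) := by
  classical
  induction s using Finset.induction_on with
  | empty => simpa using HasValue.zero z
  | insert i s hi ih =>
    rw [Finset.sum_insert hi, Finset.sum_insert hi]
    exact (h i (Finset.mem_insert_self _ _)).add
      (ih fun j hj => h j (Finset.mem_insert_of_mem hj))

theorem HasValue.unique (h : HasValue z f a) (h' : HasValue z f b) : a = b := by
  obtain ⟨p, r, h1, h2, h3⟩ := h
  obtain ⟨p', r', h1', h2', h3'⟩ := h'
  have e : p * r' = p' * r := by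
    apply RatFunc.algebraMap_injective ℂ
    rw [map_mul, map_mul, ← h3, ← h3']; ring
  have e2 := congrArg (Polynomial.eval z) e
  rw [Polynomial.eval_mul, Polynomial.eval_mul, h2, h2'] at e2
  have h4 := mul_ne_zero h1 h1'
  exact mul_right_cancel₀ h4 (by linear_combination e2)

theorem HasValue.eval (h : HasValue z f a) :
    f.denom.eval z ≠ 0 ∧ RatFunc.eval (RingHom.id ℂ) z f = a := by
  obtain ⟨p, r, h1, h2, h3⟩ := h
  have hr : r ≠ 0 := by
    rintro rfl
    simp at h1
  have e : f = algebraMap _ (RatFunc ℂ) p / algebraMap _ (RatFunc ℂ) r :=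
    (eq_div_iff (algebraMap_ne_zero_of_eval h1)).2 h3
  have hd : f.denom.eval z ≠ 0 := by
    obtain ⟨s, hs⟩ := (RatFunc.denom_dvd hr).2 ⟨p, e⟩
    intro h0
    rw [hs, Polynomial.eval_mul, h0, zero_mul] at h1
    exact h1 rfl
  refine ⟨hd, ?_⟩
  have h5 := congrArg (Polynomial.eval z) ((RatFunc.num_mul_eq_mul_denom_iff hr).2 e)
  rw [Polynomial.eval_mul, Polynomial.eval_mul, h2] at h5
  change f.num.eval z / f.denom.eval z = a
  rw [div_eq_iff hd]
  exact mul_right_cancel₀ h1 (by linear_combination h5)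

theorem hasValue_of_eval (hd : f.denom.eval z ≠ 0) (h : RatFunc.eval (RingHom.id ℂ) z f = a) :
    HasValue z f a := by
  refine ⟨f.num, f.denom, hd, ?_, ?_⟩
  · change f.num.eval z / f.denom.eval z = a at h
    rwa [div_eq_iff hd] at h
  · have := RatFunc.num_div_denom f
    rwa [div_eq_iff (algebraMap_ne_zero_of_eval hd), eq_comm] at this

end Regular

/-! ### Quantum integers in u = v², at v = 1 and v = 0 -/

section GenericBracket

/-- The parameter `u = v²`. -/
noncomputable def genU : RatFunc ℂ := RatFunc.X ^ 2

/-- The quantum integers in `ℂ(v)`. -/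
noncomputable def genBr (d : ℤ) : RatFunc ℂ := (genU ^ d - 1) / (genU - 1)

theorem genU_ne_zero : genU ≠ 0 := pow_ne_zero _ RatFunc.X_ne_zero

theorem genU_pow_ne_one {m : ℕ} (hm : m ≠ 0) : genU ^ m ≠ 1 := by
  intro h
  have h0 : HasValue 0 (genU ^ m) 0 := by
    have := ((HasValue.X 0).pow 2).pow m
    rwa [zero_pow two_ne_zero, zero_pow hm] at this
  rw [h] at h0
  exact zero_ne_one (h0.unique (HasValue.one 0))

theorem genU_zpow_ne_one {d : ℤ} (hd : d ≠ 0) : genU ^ d ≠ 1 := by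
  rcases Int.natAbs_eq d with h | h
  · rw [h, zpow_natCast]
    exact genU_pow_ne_one (by omega)
  · rw [h, zpow_neg, zpow_natCast, inv_ne_one]
    exact genU_pow_ne_one (by omega)

theorem genU_sub_one_ne_zero : genU - 1 ≠ 0 := by
  have := genU_pow_ne_one one_ne_zero
  rw [pow_one] at this
  exact sub_ne_zero.2 this

theorem isBracket_gen : IsBracket genU genBr where
  q_ne := genU_ne_zero
  one := by rw [genBr, zpow_one, div_self genU_sub_one_ne_zero]
  add d e := by
    have := genU_sub_one_ne_zero
    rw [genBr, genBr, genBr, zpow_add₀ genU_ne_zero]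
    field_simp
    ring
  ne_zero d hd := div_ne_zero (sub_ne_zero.2 (genU_zpow_ne_one hd)) genU_sub_one_ne_zero

theorem genU_ne_inv : genU ≠ genU⁻¹ := by
  intro h
  refine genU_pow_ne_one (m := 2) two_ne_zero ?_
  rw [pow_two]
  nth_rewrite 2 [h]
  exact mul_inv_cancel₀ genU_ne_zero

theorem genU_hasValue_one : HasValue 1 genU 1 := by
  simpa [genU] using (HasValue.X 1).pow 2

theorem genU_hasValue_zero : HasValue 0 genU 0 := by
  simpa [genU] using (HasValue.X 0).pow 2

theorem genU_zpow_hasValue_one (d : ℤ) : HasValue 1 (genU ^ d) 1 := by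
  rcases Int.natAbs_eq d with h | h
  · rw [h, zpow_natCast]
    simpa using genU_hasValue_one.pow d.natAbs
  · rw [h, zpow_neg, zpow_natCast]
    simpa using (genU_hasValue_one.pow d.natAbs).inv (by simp)

theorem genBr_hasValue_one (d : ℤ) : HasValue 1 (genBr d) d := by
  induction d using Int.induction_on with
  | zero => simpa [isBracket_gen.zero] using HasValue.zero 1
  | succ d ih =>
    rw [isBracket_gen.add, isBracket_gen.one, mul_one]
    simpa using ih.add (genU_zpow_hasValue_one d)
  | pred d ih =>
    have h := isBracket_gen.add (-(d : ℤ) - 1) 1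
    rw [isBracket_gen.one, mul_one, sub_add_cancel] at h
    have h2 := ih.sub (genU_zpow_hasValue_one (-(d : ℤ) - 1))
    rw [h, add_sub_cancel_right] at h2
    simpa using h2

theorem genBr_inv_hasValue_one (d : ℤ) : HasValue 1 (genBr d)⁻¹ (d : ℂ)⁻¹ := by
  by_cases hd : d = 0
  -- Both inverses take the default value 0 here, so no restriction on `d` is needed.
  · subst hd
    simpa [isBracket_gen.zero] using HasValue.zero 1
  · exact (genBr_hasValue_one d).inv (by exact_mod_cast hd)

theorem genBr_hasValue_zero (m : ℕ) : HasValue 0 (genBr (m + 1)) 1 := by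
  induction m with
  | zero => simpa [isBracket_gen.one] using HasValue.one 0
  | succ m ih =>
    have h := isBracket_gen.add 1 ((m : ℤ) + 1)
    rw [isBracket_gen.one, zpow_one, add_comm (1 : ℤ)] at h
    push_cast
    rw [h]
    simpa using (HasValue.one 0).add (genU_hasValue_zero.mul ih)

/-- The expression is symmetric under d ↦ -d. For d ≥ 2, u + 1/[-d] = 1 - 1/[d] = u [d-1]/[d], which
absorbs u⁻¹; [d-1], [d] and u + 1/[d] all have the value 1 at v = 0. -/
theorem genBr_step_hasValue_zero {d : ℤ} (hd : d ≤ -2 ∨ 2 ≤ d) :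
    HasValue 0 (genU⁻¹ * ((genU + (genBr (-d))⁻¹) * (genU + (genBr d)⁻¹))) 1 := by
  have key : ∀ d : ℤ, 2 ≤ d →
      HasValue 0 (genU⁻¹ * ((genU + (genBr (-d))⁻¹) * (genU + (genBr d)⁻¹))) 1 := by
    intro d hd
    obtain ⟨m, rfl⟩ : ∃ m : ℕ, d = m + 1 + 1 := ⟨(d - 2).toNat, by omega⟩
    have h1 := isBracket_gen.add 1 ((m : ℤ) + 1)
    rw [isBracket_gen.one, zpow_one, add_comm (1 : ℤ)] at h1
    have hne := isBracket_gen.ne_zero ((m : ℤ) + 1 + 1) (by omega)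
    have hv := genBr_hasValue_zero (m + 1)
    push_cast at hv
    have e : genU⁻¹ * (genU + (genBr (-((m : ℤ) + 1 + 1)))⁻¹) =
        genBr (m + 1) * (genBr (m + 1 + 1))⁻¹ := by
      rw [isBracket_gen.neg_inv (by omega)]
      have := genU_ne_zero
      field_simp
      linear_combination h1
    rw [← mul_assoc, e]
    have h2 := ((genBr_hasValue_zero m).mul (hv.inv one_ne_zero)).mul
      (genU_hasValue_zero.add (hv.inv one_ne_zero))
    simpa using h2
  rcases hd with h | h
  · have := key (-d) (by omega)
    rwa [neg_neg, mul_comm (genU + (genBr d)⁻¹)] at this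
  · exact key d h

end GenericBracket

/-! ### Schur elements, generic degrees and the a-invariant -/

section GenericDegree

variable {n : ℕ} {t : Fin n → ℕ × ℕ}

theorem seminormal_hasValue_one (ht : IsShape t) (w : Perm (Fin n)) : ∀ a b : SYT t,
    HasValue 1 (seminormal isBracket_gen ht w a b) (seminormal isBracket_one ht w a b) := by
  induction w using left_induction with
  | one =>
    intro a b
    rw [seminormal_one, seminormal_one, Matrix.one_apply, Matrix.one_apply]
    split_ifs
    · exact HasValue.one 1
    · exact HasValue.zero 1
  | mul i j w hij h ih =>
    intro a b
    rw [seminormal_swap_mul _ _ hij _ h, seminormal_swap_mul _ _ hij _ h, Matrix.mul_apply,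
      Matrix.mul_apply]
    refine HasValue.sum _ fun c _ => HasValue.mul ?_ (ih c b)
    simp only [simpleMatrix, Matrix.of_apply]
    split_ifs
    · exact (genU_hasValue_one.sub (HasValue.one 1)).add (genBr_inv_hasValue_one _)
    · exact genU_hasValue_one.add (genBr_inv_hasValue_one _)
    · exact HasValue.zero 1

/-- Each exchange along the path contributes one factor from `genBr_step_hasValue_zero`. -/
theorem pathIn_mul_pathOut_hasValue_zero (ht : IsShape t) (a : SYT t) :
    HasValue 0 ((genU ^ length a.1)⁻¹ * pathIn isBracket_gen ht a * pathOut isBracket_gen ht a)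
      1 := by
  induction a using SYT.induction ht with
  | one =>
    rw [pathIn_row, pathOut_row, show (rowSYT ht).1 = 1 from rfl, length_one]
    simpa using HasValue.one 0
  | swap a i j hij hlt hs ih =>
    have h1 := genBr_step_hasValue_zero (a.2.two_le_contentDiff hs hij)
    rw [pathIn_step isBracket_gen ht hij hlt hs, pathOut_step isBracket_gen ht hij hlt hs,
      length_mul_swap_of_gt hij a.1 hlt, pow_succ, mul_inv]
    have := ih.mul h1
    rw [mul_one] at this
    convert this using 1
    ring

/-- After multiplication by u^{n(α)} each transversal contributes a monomial with a nonnegative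
exponent. The value at v = 0 counts those without row inversions and with the maximal number of
column inversions, and at least one exists. -/
theorem schurElement_hasValue_zero (ht : IsShape t) : ∃ c : ℂ, c ≠ 0 ∧
    HasValue 0 (genU ^ (∑ k, (t k).1) * schurElement isBracket_gen ht) c := by
  classical
  obtain ⟨d, hd⟩ := exists_isColReading ht
  have hsum : HasValue 0 (genU ^ (∑ k, (t k).1) * ∑ w with IsTransversal t d w,
      genU ^ labelInv (fun k => (t k).1) w⁻¹ * genU⁻¹ ^ labelInv (fun k => (t (d k)).2) w)
      (∑ w with IsTransversal t d w, 0 ^ (labelInv (fun k => (t k).1) w⁻¹ +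
        (∑ k, (t k).1 - labelInv (fun k => (t (d k)).2) w))) := by
    rw [Finset.mul_sum]
    refine HasValue.sum _ fun w _ => ?_
    have hle := labelInv_col_le ht hd w
    have e : genU ^ (∑ k, (t k).1) * (genU ^ labelInv (fun k => (t k).1) w⁻¹ *
        genU⁻¹ ^ labelInv (fun k => (t (d k)).2) w) =
        genU ^ (labelInv (fun k => (t k).1) w⁻¹ +
          (∑ k, (t k).1 - labelInv (fun k => (t (d k)).2) w)) := by
      have hu := genU_ne_zero
      nth_rewrite 1 [← Nat.sub_add_cancel hle]
      rw [pow_add, pow_add, inv_pow]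
      field_simp
    rw [e]
    exact genU_hasValue_zero.pow _
  have hU := pathIn_mul_pathOut_hasValue_zero ht (colSYT hd)
  have h := hsum.mul hU
  rw [mul_one, mul_assoc] at h
  refine ⟨_, ?_, by rw [schurElement_eq isBracket_gen ht hd genU_ne_inv]; exact h⟩
  simp only [zero_pow_eq, Finset.sum_boole]
  rw [Nat.cast_ne_zero, ← Nat.pos_iff_ne_zero, Finset.card_pos]
  obtain ⟨w, h1, h2, h3⟩ := exists_transversal_maximal ht hd
  exact ⟨w, by simp [h1, h2, h3]⟩

theorem schurElement_gen_ne_zero (ht : IsShape t) : schurElement isBracket_gen ht ≠ 0 := by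
  intro h
  obtain ⟨c, hc, hv⟩ := schurElement_hasValue_zero ht
  rw [h, mul_zero] at hv
  exact hc (hv.unique (HasValue.zero 0))

/-- The generic degree which belongs to a diagram. -/
noncomputable def shapeDegree (ht : IsShape t) : RatFunc ℂ :=
  (∑ w : Perm (Fin n), genU ^ length w) / schurElement isBracket_gen ht

theorem shapeDegree_eq (ht : IsShape t) : ∃ (f : RatFunc ℂ) (c : ℂ), c ≠ 0 ∧ HasValue 0 f c ∧
    shapeDegree ht = RatFunc.X ^ (2 * ∑ k, (t k).1) * f := by
  obtain ⟨c, hc, hv⟩ := schurElement_hasValue_zero ht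
  have hP : HasValue 0 (∑ w : Perm (Fin n), genU ^ length w)
      (∑ w : Perm (Fin n), 0 ^ length w) :=
    HasValue.sum _ fun w _ => genU_hasValue_zero.pow _
  refine ⟨_, _, ?_, hP.mul (hv.inv hc), ?_⟩
  · refine mul_ne_zero ?_ (inv_ne_zero hc)
    simp only [zero_pow_eq, Finset.sum_boole]
    rw [Nat.cast_ne_zero, ← Nat.pos_iff_ne_zero, Finset.card_pos]
    exact ⟨1, by simp [length_one]⟩
  · have h1 := schurElement_gen_ne_zero ht
    have h2 := genU_ne_zero
    rw [pow_mul, ← genU, shapeDegree]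
    field_simp

theorem genericDegree_eq_shapeDegree {d : ℕ}
    {T : Perm (Fin n) → Matrix (Fin d) (Fin d) (RatFunc ℂ)} (ht : IsShape t)
    (h1 : T 1 = 1) (hT : ∀ w, (T w).trace = (seminormal isBracket_gen ht w).trace) :
    genericDegree T = shapeDegree ht := by
  have hd : (d : RatFunc ℂ) = Fintype.card (SYT t) := by
    have := hT 1
    rwa [h1, seminormal_one, Matrix.trace_one, Matrix.trace_one, Fintype.card_fin] at this
  have hcard : (Fintype.card (SYT t) : RatFunc ℂ) ≠ 0 := by
    rw [Nat.cast_ne_zero]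
    exact (Fintype.card_pos_iff.2 ⟨rowSYT ht⟩).ne'
  rw [genericDegree, hd]
  simp only [hT]
  rw [← genU, sum_trace_mul_trace isBracket_gen ht, mul_div_mul_left _ _ hcard]
  rfl

theorem IsHeckeRep.isHecke {d : ℕ} {T : Perm (Fin n) → Matrix (Fin d) (Fin d) (RatFunc ℂ)}
    (hT : IsHeckeRep T) : IsHecke genU T where
  one_mul w := by rw [hT.one, Matrix.one_mul]
  mul_of_lt i j w hij h := hT.mul_of_lt _ _ ⟨i, j, hij, rfl⟩ (by
    rw [length_swap_mul hij w h]; omega)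
  mul_of_gt i j w hij h := hT.mul_of_gt _ _ ⟨i, j, hij, rfl⟩ (by
    have := length_swap_mul_of_gt hij w h; omega)

/-- The seminormal representation with rows and columns numbered. -/
noncomputable def seminormalFin (ht : IsShape t) (w : Perm (Fin n)) :
    Matrix (Fin (Fintype.card (SYT t))) (Fin (Fintype.card (SYT t))) (RatFunc ℂ) :=
  (seminormal isBracket_gen ht w).submatrix (Fintype.equivFin (SYT t)).symm
    (Fintype.equivFin (SYT t)).symm

theorem trace_seminormalFin (ht : IsShape t) (w : Perm (Fin n)) :
    (seminormalFin ht w).trace = (seminormal isBracket_gen ht w).trace :=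
  (Fintype.equivFin (SYT t)).symm.sum_comp fun a => seminormal isBracket_gen ht w a a

theorem isHeckeRep_seminormalFin (ht : IsShape t) : IsHeckeRep (seminormalFin ht) where
  one := by
    rw [seminormalFin, seminormal_one, Matrix.submatrix_one_equiv]
  mul_of_lt := by
    rintro _ w ⟨i, j, hij, rfl⟩ h
    rcases lt_or_gt_of_adj hij w⁻¹ with h' | h'
    · rw [seminormalFin, seminormalFin, Matrix.submatrix_mul_equiv,
        (isHecke_seminormal isBracket_gen ht).mul_of_lt i j w hij h']
      rfl
    · have := length_swap_mul_of_gt hij w h'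
      omega
  mul_of_gt := by
    rintro _ w ⟨i, j, hij, rfl⟩ h
    rcases lt_or_gt_of_adj hij w⁻¹ with h' | h'
    · have := length_swap_mul hij w h'
      omega
    · rw [seminormalFin, seminormalFin, Matrix.submatrix_mul_equiv,
        (isHecke_seminormal isBracket_gen ht).mul_of_gt i j w hij h']
      rfl

/-- Decompose `T` into seminormal representations and specialize at v = 1: orthogonality of the
seminormal characters of 𝔖ₙ leaves `α` with multiplicity one. The generic degree is thereby
independent of the chosen `T`. -/
theorem trace_eq_of_specializesTo {d : ℕ}
    {T : Perm (Fin n) → Matrix (Fin d) (Fin d) (RatFunc ℂ)} (hT : IsHeckeRep T)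
    {α : n.Partition} (hα : SpecializesTo T (irrChar α)) (w : Perm (Fin n)) :
    (T w).trace = (seminormal isBracket_gen (isShape_tableau α) w).trace := by
  obtain ⟨m, hm, -⟩ := exists_multiplicity isBracket_gen (t := fun α : n.Partition => tableau α)
    isShape_tableau tableau_injective (fun α => schurElement_gen_ne_zero (isShape_tableau α))
    sum_card_sq hT.isHecke
  have h1 : ∀ w, youngChar α w = ∑ β, (m β : ℂ) * youngChar β w := by
    intro w
    have h2 := hasValue_of_eval (hα w).1 (hα w).2
    rw [hm] at h2
    rw [← irrChar_eq_youngChar]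
    refine h2.unique (HasValue.sum _ fun β _ => (HasValue.natCast 1 _).mul
      (HasValue.sum _ fun a _ => ?_))
    exact seminormal_hasValue_one _ w a a
  have h3 : ∀ β, (m β : ℂ) = if α = β then 1 else 0 := by
    intro β
    have hn : (n.factorial : ℂ) ≠ 0 := by exact_mod_cast Nat.factorial_ne_zero n
    have h4 := sum_youngChar_mul α β
    simp only [h1, Finset.sum_mul, mul_assoc] at h4
    rw [Finset.sum_comm] at h4
    simp only [← Finset.mul_sum, sum_youngChar_mul] at h4
    simp only [mul_ite, mul_zero, Finset.sum_ite_eq', Finset.mem_univ, if_true] at h4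
    refine mul_right_cancel₀ hn (h4.trans ?_)
    split_ifs <;> simp
  rw [hm, Finset.sum_eq_single α]
  · have := h3 α
    rw [if_pos rfl] at this
    rw [show m α = 1 by exact_mod_cast this, Nat.cast_one, one_mul]
  · intro β _ hβ
    have := h3 β
    rw [if_neg hβ.symm] at this
    rw [show m β = 0 by exact_mod_cast this, Nat.cast_zero, zero_mul]
  · intro h; exact absurd (Finset.mem_univ _) h

/-- The `a`-invariant of the character labelled by `α` is the sum of the row indices (counted from
zero) of the boxes of the diagram of `α`. -/
theorem isAInvariant_iff (α : n.Partition) (a : ℕ) :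
    IsAInvariant (irrChar α) a ↔ a = ∑ k, (tableau α k).1 := by
  obtain ⟨f, c, hc, hf, he⟩ := shapeDegree_eq (isShape_tableau α)
  constructor
  · rintro ⟨d, T, hT, hα, p, q, hp, hq, hD⟩
    rw [genericDegree_eq_shapeDegree (isShape_tableau α) hT.one (trace_eq_of_specializesTo hT hα),
      he] at hD
    have hpq := (HasValue.ofPolynomial 0 p).mul ((HasValue.ofPolynomial 0 q).inv hq)
    rw [← div_eq_mul_inv] at hpq
    have hpq0 : p.eval 0 * (q.eval 0)⁻¹ ≠ 0 := mul_ne_zero hp (inv_ne_zero hq)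
    -- Comparison of the orders of vanishing at v = 0; it is applied in both directions.
    have key : ∀ (g h : RatFunc ℂ) (x y : ℂ) (i j : ℕ), HasValue 0 g x → HasValue 0 h y → x ≠ 0 →
        RatFunc.X ^ (2 * i) * g = RatFunc.X ^ (2 * j) * h → j ≤ i := by
      intro g h x y i j hg hh hx e
      by_contra hlt
      have e1 : g = RatFunc.X ^ (2 * (j - i)) * h := by
        refine mul_left_cancel₀ (pow_ne_zero (2 * i) RatFunc.X_ne_zero) (e.trans ?_)
        rw [← mul_assoc, ← pow_add]
        congr 2
        omega
      have h1 := ((HasValue.X 0).pow (2 * (j - i))).mul hh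
      rw [zero_pow (by omega), zero_mul, ← e1] at h1
      exact hx (hg.unique h1)
    exact le_antisymm (key _ _ _ _ _ _ hf hpq hc hD) (key _ _ _ _ _ _ hpq hf hpq0 hD.symm)
  · rintro rfl
    obtain ⟨p, r, h1, h2, h3⟩ := hf
    refine ⟨_, seminormalFin (isShape_tableau α), isHeckeRep_seminormalFin _, ?_, p, r, ?_, h1, ?_⟩
    · intro w
      rw [trace_seminormalFin, irrChar_eq_youngChar]
      exact HasValue.eval (HasValue.sum _ fun a _ => seminormal_hasValue_one _ w a a)
    · rw [h2]; exact mul_ne_zero hc h1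
    · rw [genericDegree_eq_shapeDegree (isShape_tableau α) (isHeckeRep_seminormalFin _).one
        (trace_seminormalFin _), he, ← h3, mul_div_cancel_right₀ _ (algebraMap_ne_zero_of_eval h1)]

end GenericDegree

/-! ### The extended group and the scalar action of w₀σ -/

section Extensions

variable {n : ℕ}

theorem longest_mul_longest (n : ℕ) : w₀ n * w₀ n = 1 := by
  ext i : 1
  simp [w₀]

theorem graphAut_mul_graphAut (n : ℕ) : graphAut n * graphAut n = 1 := by
  rw [graphAut, ← map_mul, longest_mul_longest, map_one]

/-- The image of the transposition of 0 and 1 fixes 0 as soon as n ≥ 3; for n = 2 the automorphism,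
and with it the extension, would be trivial. -/
theorem graphAut_ne_one (hn : 3 ≤ n) : graphAut n ≠ 1 := by
  intro h
  have h1 := Equiv.congr_fun (DFunLike.congr_fun h
    (swap (⟨0, by omega⟩ : Fin n) ⟨1, by omega⟩)) ⟨0, by omega⟩
  have h2 : Fin.rev (⟨0, by omega⟩ : Fin n) = ⟨n - 1, by omega⟩ := by
    ext; simp [Fin.rev]
  have h3 : (w₀ n)⁻¹ = w₀ n := inv_eq_of_mul_eq_one_left (longest_mul_longest n)
  have h4 : (swap (⟨0, by omega⟩ : Fin n) ⟨1, by omega⟩) (⟨n - 1, by omega⟩ : Fin n) =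
      ⟨n - 1, by omega⟩ :=
    Equiv.swap_apply_of_ne_of_ne (by simp [Fin.ext_iff]; omega) (by simp [Fin.ext_iff]; omega)
  rw [graphAut, MulAut.conj_apply, h3, Equiv.Perm.mul_apply, Equiv.Perm.mul_apply, MulAut.one_apply,
    Equiv.swap_apply_left] at h1
  change Fin.rev (swap _ _ (Fin.rev _)) = _ at h1
  rw [h2, h4] at h1
  have h5 := congrArg Fin.val h1
  simp [Fin.rev] at h5
  omega

/-- The generator of the group of graph automorphisms. -/
def gen (n : ℕ) : Subgroup.zpowers (graphAut n) := ⟨graphAut n, Subgroup.mem_zpowers (graphAut n)⟩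

theorem gen_mul_gen (n : ℕ) : gen n * gen n = 1 := Subtype.ext (graphAut_mul_graphAut n)

theorem eq_one_or_eq_gen (τ : Subgroup.zpowers (graphAut n)) : τ = 1 ∨ τ = gen n := by
  obtain ⟨k, hk⟩ := Subgroup.mem_zpowers_iff.1 τ.2
  rcases Int.even_or_odd' k with ⟨m, rfl | rfl⟩
  · left
    refine Subtype.ext (hk.symm.trans ?_)
    rw [zpow_mul, zpow_ofNat, pow_two, graphAut_mul_graphAut, one_zpow]; rfl
  · right
    refine Subtype.ext (hk.symm.trans ?_)
    rw [zpow_add, zpow_mul, zpow_ofNat, pow_two, graphAut_mul_graphAut, one_zpow, zpow_one,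
      one_mul]; rfl

theorem eq_ofW_or_eq_ofW_mul_sg (x : ExtGroup n) :
    (∃ w, x = ofW w) ∨ ∃ w, x = ofW w * sg n := by
  rcases eq_one_or_eq_gen x.right with h | h
  · refine Or.inl ⟨x.left, ?_⟩
    ext1
    · simp [ofW]
    · simp [ofW, h]
  · refine Or.inr ⟨x.left, ?_⟩
    ext1
    · simp [ofW, sg]
    · simp [ofW, sg, h, gen]

theorem longest_sg_sq (n : ℕ) : (ofW (w₀ n) * sg n) * (ofW (w₀ n) * sg n) = 1 := by
  ext1
  · have h : graphAut n (w₀ n) = w₀ n := by simp [graphAut]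
    simp [ofW, sg, h, longest_mul_longest]
  · simpa [ofW, sg] using graphAut_mul_graphAut n

theorem ofW_mul_sg (w : Perm (Fin n)) :
    ofW w * sg n = ofW (w * w₀ n) * (ofW (w₀ n) * sg n) := by
  rw [← mul_assoc, ofW, ofW, ofW, ← map_mul, mul_assoc, longest_mul_longest, mul_one]

/-- The matrix (1 - e z)/2 is idempotent of trace zero, hence zero. -/
theorem eq_smul_one_of_sq_of_trace {κ : Type*} [Fintype κ] [DecidableEq κ] {z : Matrix κ κ ℂ}
    (hz : z * z = 1) {e : ℂ} (he : e * e = 1) (ht : z.trace = e * Fintype.card κ) :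
    z = e • (1 : Matrix κ κ ℂ) := by
  have h1 : ((1 / 2 : ℂ) • ((1 : Matrix κ κ ℂ) - e • z)) *
      ((1 / 2 : ℂ) • ((1 : Matrix κ κ ℂ) - e • z)) =
      (1 / 2 : ℂ) • ((1 : Matrix κ κ ℂ) - e • z) := by
    rw [smul_mul_smul_comm, sub_mul, mul_sub, mul_sub, smul_mul_smul_comm, hz, he]
    simp only [one_mul, mul_one, one_smul]
    module
  obtain ⟨m, hm, hm0⟩ := exists_nat_trace_eq h1
  have h2 : m = 0 := by
    rw [Matrix.trace_smul, Matrix.trace_sub, Matrix.trace_one, Matrix.trace_smul, ht, smul_eq_mul,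
      smul_eq_mul, ← mul_assoc e, he, one_mul, sub_self, mul_zero] at hm
    exact_mod_cast hm.symm
  have h3 := hm0 h2
  rw [smul_eq_zero] at h3
  have h4 := sub_eq_zero.1 (h3.resolve_left (by norm_num))
  rw [h4, smul_smul, he, one_smul]

theorem neg_one_pow_mul_self (a : ℕ) : (-1 : ℂ) ^ a * (-1) ^ a = 1 := by
  rw [← mul_pow]; simp

/-- The values of an extension of `φ` on which `w₀σ` has the trace `± φ(1)`. -/
theorem IsExtension.apply_mul_sg {φ : Perm (Fin n) → ℂ} {ψ : ExtGroup n → ℂ}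
    (h : IsExtension φ ψ) {a : ℕ} (ha : ψ (ofW (w₀ n) * sg n) = (-1) ^ a * φ 1)
    (w : Perm (Fin n)) : ψ (ofW w * sg n) = (-1) ^ a * φ (w * w₀ n) := by
  obtain ⟨⟨d, r, rfl⟩, hφ⟩ := h
  have hφ1 : φ 1 = d := by
    rw [← hφ, ofW, map_one, Representation.char_one]
    simp
  have h1 : LinearMap.toMatrix' (r (ofW (w₀ n) * sg n)) =
      ((-1 : ℂ) ^ a) • (1 : Matrix (Fin d) (Fin d) ℂ) := by
    refine eq_smul_one_of_sq_of_trace ?_ (neg_one_pow_mul_self a) ?_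
    · rw [← LinearMap.toMatrix'_mul, ← map_mul, longest_sg_sq, map_one, LinearMap.toMatrix'_one]
    · rw [← Matrix.trace_toLin'_eq, Matrix.toLin'_toMatrix', Fintype.card_fin, ← hφ1]
      exact ha
  have h2 : r (ofW (w₀ n) * sg n) = ((-1 : ℂ) ^ a) • 1 := by
    apply LinearMap.toMatrix'.injective
    rw [h1, map_smul, LinearMap.toMatrix'_one]
  rw [← hφ, ofW_mul_sg, Representation.character, map_mul, h2, mul_smul_comm, mul_one, map_smul,
    smul_eq_mul]
  rfl

end Extensions

/-! ### Existence and uniqueness of preferred extensions -/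

section PreferredExtension

variable {n : ℕ} (α : n.Partition) (e : ℂ)

open Classical in
/-- The permutation by which an element of the extended group acts, up to a sign. -/
noncomputable def untwist (x : ExtGroup n) : Perm (Fin n) :=
  x.left * if x.right = 1 then 1 else w₀ n

open Classical in
/-- The matrices of the extension of Young's seminormal representation for which `w₀σ` acts
by `e`. -/
noncomputable def extMatrix (x : ExtGroup n) :
    Matrix (SYT (tableau α)) (SYT (tableau α)) ℂ :=
  (if x.right = 1 then 1 else e) • youngRep α (untwist x)

/-- Since σ is conjugation by w₀, sending σ to w₀ extends the identity of `W` to a homomorphism from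
the extended group to `W`. Its composite with the seminormal representation is twisted by the
character σ ↦ e, which requires σ ≠ 1. -/
theorem extMatrix_mul (he : e * e = 1) (hn : 3 ≤ n) (x y : ExtGroup n) :
    extMatrix α e (x * y) = extMatrix α e x * extMatrix α e y := by
  have hg : gen n ≠ 1 := fun h => graphAut_ne_one hn (congrArg Subtype.val h)
  have h0 : (w₀ n)⁻¹ = w₀ n := inv_eq_of_mul_eq_one_left (longest_mul_longest n)
  have hc : ∀ g, (gen n : MulAut (Perm (Fin n))) g = w₀ n * g * (w₀ n)⁻¹ := fun g => rfl
  simp only [extMatrix, untwist, smul_mul_smul_comm, ← youngRep_mul, SemidirectProduct.mul_left,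
    SemidirectProduct.mul_right]
  rcases eq_one_or_eq_gen x.right with h1 | h1 <;> rcases eq_one_or_eq_gen y.right with h2 | h2 <;>
    simp [h1, h2, hg, hc, gen_mul_gen, he, mul_assoc, h0, longest_mul_longest]

/-- The preferred extension of Young's seminormal representation. -/
noncomputable def extRep (he : e * e = 1) (hn : 3 ≤ n) :
    Representation ℂ (ExtGroup n) (Fin (Fintype.card (SYT (tableau α))) → ℂ) where
  toFun x := Matrix.toLin' ((extMatrix α e x).submatrix (Fintype.equivFin _).symm
    (Fintype.equivFin _).symm)
  map_one' := by
    simp only [extMatrix, untwist, SemidirectProduct.one_right, SemidirectProduct.one_left,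
      if_true, mul_one, youngRep_one, one_smul, Matrix.submatrix_one_equiv, Matrix.toLin'_one]
    rfl
  map_mul' x y := by
    rw [extMatrix_mul α e he hn, ← Matrix.submatrix_mul_equiv _ _ _ (Fintype.equivFin _).symm,
      Matrix.toLin'_mul]
    rfl

theorem extRep_character (he : e * e = 1) (hn : 3 ≤ n) (x : ExtGroup n) :
    (extRep α e he hn).character x = (extMatrix α e x).trace := by
  change LinearMap.trace ℂ _ (Matrix.toLin' _) = _
  rw [Matrix.trace_toLin'_eq]
  exact (Fintype.equivFin _).symm.sum_comp fun a => extMatrix α e x a a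

theorem extRep_character_ofW (he : e * e = 1) (hn : 3 ≤ n) (w : Perm (Fin n)) :
    (extRep α e he hn).character (ofW w) = youngChar α w := by
  rw [extRep_character]
  simp [extMatrix, untwist, ofW, youngChar]

theorem extRep_character_longest (he : e * e = 1) (hn : 3 ≤ n) :
    (extRep α e he hn).character (ofW (w₀ n) * sg n) = e * youngChar α 1 := by
  have hg : gen n ≠ 1 := fun h => graphAut_ne_one hn (congrArg Subtype.val h)
  have h1 : (ofW (w₀ n) * sg n).right = gen n := by simp [ofW, sg, gen]
  have h2 : (ofW (w₀ n) * sg n).left = w₀ n := by simp [ofW, sg]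
  rw [extRep_character, extMatrix, untwist, h1, h2, if_neg hg, if_neg hg, longest_mul_longest,
    Matrix.trace_smul, smul_eq_mul, youngChar]

theorem isPreferredExtension_extRep (hn : 3 ≤ n) : IsPreferredExtension (irrChar α)
    (extRep α ((-1) ^ ∑ k, (tableau α k).1) (neg_one_pow_mul_self _) hn).character := by
  refine ⟨⟨⟨_, _, rfl⟩, fun w => ?_⟩, _, (isAInvariant_iff α _).2 rfl, ?_⟩
  · rw [extRep_character_ofW, irrChar_eq_youngChar]
  · rw [extRep_character_longest, irrChar_eq_youngChar]

variable {α}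

theorem IsPreferredExtension.apply_mul_sg {ψ : ExtGroup n → ℂ}
    (h : IsPreferredExtension (irrChar α) ψ) (w : Perm (Fin n)) :
    ψ (ofW w * sg n) = (-1) ^ (∑ k, (tableau α k).1) * irrChar α (w * w₀ n) := by
  obtain ⟨h1, a, ha, h2⟩ := h
  rw [← (isAInvariant_iff α a).1 ha]
  exact h1.apply_mul_sg h2 w

theorem IsPreferredExtension.unique {ψ ψ' : ExtGroup n → ℂ}
    (h : IsPreferredExtension (irrChar α) ψ) (h' : IsPreferredExtension (irrChar α) ψ') :
    ψ = ψ' := by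
  funext x
  rcases eq_ofW_or_eq_ofW_mul_sg x with ⟨w, rfl⟩ | ⟨w, rfl⟩
  · rw [h.1.2, h'.1.2]
  · rw [h.apply_mul_sg, h'.apply_mul_sg]

end PreferredExtension

end TwistedInvolution

/-! ### The main theorem -/

open TwistedInvolution in
theorem proposition3p1 (n : ℕ) (hn : 3 ≤ n) :
    (∀ α : n.Partition, ∃! a : ℕ, IsAInvariant (irrChar α) a) ∧
    (∀ α : n.Partition, ∃! ψ : ExtGroup n → ℂ, IsPreferredExtension (irrChar α) ψ) ∧
    ∀ ψ : n.Partition → ExtGroup n → ℂ,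
      (∀ α, IsPreferredExtension (irrChar α) (ψ α)) →
      ∀ w : Equiv.Perm (Fin n),
        (extInvolutionChar n (ofW w * sg n) : ℂ) = ∑ α : n.Partition, ψ α (ofW w * sg n) := by
  refine ⟨fun α => ⟨_, (isAInvariant_iff α _).2 rfl, fun a => (isAInvariant_iff α a).1⟩,
    fun α => ⟨_, isPreferredExtension_extRep α hn,
      fun ψ h => h.unique (isPreferredExtension_extRep α hn)⟩, fun ψ hψ w => ?_⟩
  rw [extInvolutionChar_eq_sum]
  exact Finset.sum_congr rfl fun α _ => ((hψ α).apply_mul_sg w).symm
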